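/- For every $n\in\mathbb N$ let $\{a_n(p,q): 1\le p\le q\le n\}$ be real random variables, all defined on one probability space, and let $X_n$ be the symmetric random $n\times n$ matrix with $X_n(q,p)=X_n(p,q)=\frac1{\sqrt n}a_n(p,q)$ for $1\le p\le q\le n$. Let $\lambda^{(n)}_1,\dots,\lambda^{(n)}_n$ be its eigenvalues and $\mu_n=\frac1n\sum_{k=1}^n\delta_{\lambda_k^{(n)}}$ its empirical spectral distribution. Consider the conditions (C1) $\mathbb E[a_n(p,q)]=0$, $\mathbb E[a_n(p,q)^2]=1$ and $\sup_n\max_{1\le p\le q\le n}\mathbb E[|a_n(p,q)|^k]<\infty$ for every $k\in\mathbb N$; (C2) for every $n$ the diagonals, i.e. the families $\{a_n(p,p+r):1\le p\le n-r\}$, $0\le r\le n-1$, are independent; (C3) for every $n$ there is a number $c_n$ such that $\mathrm{Cov}(a_n(p,p+r),a_n(q,q+r))=c_n$ for all $0\le r\le n-1$ and all $1\le p,q\le n-r$ with $p\ne q$; (C4) the limit $c=\lim_{n\to\infty}c_n$ exists. There are probability measures $\nu_c$ on $\mathbb R$, depending only on the number $c$ (and not on the probability space or on the distribution of the entries), such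 that the following holds. (a) If (C1)–(C4) hold, then $c\in[0,1]$ and, with probability $1$, $\mu_n$ converges weakly to $\nu_c$. (b) For $c\in[0,1]$ all moments of $\nu_c$ are finite, the odd moments vanish, and for every even $k\ge 0$ $$\int x^k\,d\nu_c(x)=\sum_{\pi\in\mathcal{PP}(k)}p_T(\pi)\,c^{k/2-h(\pi)}\qquad(0^0=1).$$ Here $\mathcal{PP}(k)$ is the set of partitions of $\{1,\dots,k\}$ into blocks $\{i,j\}$ of two elements. The Toeplitz volume $p_T(\pi)$ is defined by the linear system $x_i-x_{i-1}+x_j-x_{j-1}=0$, one equation for each block $\{i<j\}$ of $\pi$, in the unknowns $x_0,\dots,x_k$. Solve it for the variables $x_j$ with $j$ the larger element of its block; $p_T(\pi)$ is the Lebesgue measure of the set of values of the remaining $k/2+1$ variables for which all of $x_0,\dots,x_k$ lie in $[0,1]$. The height $h(\pi)$ is the number of blocks $\{i<j\}$ of $\pi$ such that $j=i+1$ or $\pi$ restricts to a pair partition of $\{i+1,\dots,j-1\}$. (c) $\nu_0$ is the semicircle law, with density $\frac1{2\pi}\sqrt{4-x^2}$ on $[-2,2]$. (d) $\nu_1$ is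 the Bryc–Dembo–Jiang Toeplitz limit: if $\xi_0,\xi_1,\dots$ are i.i.d. real random variables with mean $0$, variance $1$ and finite moments of every order, then, with probability $1$, the empirical spectral distribution of the Toeplitz matrix $\bigl(\frac1{\sqrt n}\xi_{|p-q|}\bigr)_{1\le p,q\le n}$ converges weakly to $\nu_1$. -/

import Mathlib

open MeasureTheory ProbabilityTheory Filter
open scoped Topology NNReal

noncomputable section

/-! ### Pair partitions, Toeplitz volume, height -/

/-- A pair partition of a `k`-element set, recorded by its partner map: `π i` is the unique
element different from `i` which lies in the same block as `i`. -/
abbrev PairPartition (k : ℕ) : Type :=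
  {π : Fin k → Fin k // ∀ i, π i ≠ i ∧ π (π i) = i}

/-- The unknowns are `x_0, …, x_k`; the element `i : Fin k` stands for the number `i + 1` in
`{1, …, k}`, so that its two variables `x_{(i+1)-1}` and `x_{i+1}` are `x i.castSucc` and
`x i.succ`. The undetermined variables are those that are not of the form `x i.succ` with `i` the
larger element of its block. -/
def freeVars {k : ℕ} (π : PairPartition k) : Finset (Fin (k + 1)) :=
  Finset.univ.filter fun v => ¬ ∃ i : Fin k, π.1 i < i ∧ v = i.succ

/-- The system of equations `x_i - x_{i-1} + x_l - x_{l-1} = 0`, for `i` and `l` in the same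
block. -/
def SolvesToeplitzSystem {k : ℕ} (π : PairPartition k) (x : Fin (k + 1) → ℝ) : Prop :=
  ∀ i : Fin k, x i.succ - x i.castSucc + x (π.1 i).succ - x (π.1 i).castSucc = 0

/-- The cross section of the cube: the values of the undetermined variables for which all
variables of the (uniquely determined) solution lie in `[0, 1]`. -/
def toeplitzSection {k : ℕ} (π : PairPartition k) : Set (freeVars π → ℝ) :=
  {y | ∃ x : Fin (k + 1) → ℝ, SolvesToeplitzSystem π x ∧ (∀ v, x v ∈ Set.Icc (0 : ℝ) 1) ∧
    ∀ v : freeVars π, x v = y v}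

/-- The Toeplitz volume `p_T(π)`. -/
def toeplitzVolume {k : ℕ} (π : PairPartition k) : ℝ :=
  (volume (toeplitzSection π)).toReal

/-- The height `h(π)`: the number of blocks `{i < j}` such that `π` restricts to a pair partition
of the elements strictly between `i` and `j` (in particular if `j = i + 1`). -/
def height {k : ℕ} (π : PairPartition k) : ℕ :=
  (Finset.univ.filter fun i : Fin k =>
    i < π.1 i ∧ ∀ l, i < l → l < π.1 i → i < π.1 l ∧ π.1 l < π.1 i).card

/-! ### Random matrices and their empirical spectral distribution -/

/-- The symmetric `n × n` matrix with entries `b p q / √n` for `p ≤ q`; only the values of `b` on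
and above the diagonal are used. -/
def symMatrix (n : ℕ) (b : Fin n → Fin n → ℝ) : Matrix (Fin n) (Fin n) ℝ :=
  Matrix.of fun p q => (1 / Real.sqrt n) * b (min p q) (max p q)

theorem symMatrix_isHermitian (n : ℕ) (b : Fin n → Fin n → ℝ) :
    (symMatrix n b).IsHermitian := by
  ext p q
  simp [symMatrix, Matrix.conjTranspose_apply, min_comm, max_comm]

/-- The point mass `δ_t`. -/
def pointMass (t : ℝ) : FiniteMeasure ℝ :=
  ⟨Measure.dirac t, inferInstance⟩

/-- The empirical eigenvalue distribution `(1 / n) ∑ δ_{λ_k}` of a real symmetric `n × n` matrix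
(a probability measure if `n ≥ 1`). -/
def empiricalSpectral {n : ℕ} {A : Matrix (Fin n) (Fin n) ℝ} (hA : A.IsHermitian) :
    FiniteMeasure ℝ :=
  (n : ℝ≥0)⁻¹ • ∑ k : Fin n, pointMass (hA.eigenvalues k)

/-- The empirical eigenvalue distribution of the symmetric matrix with entries `b p q / √n`. -/
def esd (n : ℕ) (b : Fin n → Fin n → ℝ) : FiniteMeasure ℝ :=
  empiricalSpectral (symMatrix_isHermitian n b)

/-- The conditions on the entries `a n p q`, `p ≤ q`, with on-diagonal covariances `cn n` and their
limit `c`. The values of `a n p q` for `q < p` play no role. -/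
structure DiagonalEnsemble {Ω : Type*} [MeasurableSpace Ω] (P : Measure Ω)
    (a : (n : ℕ) → Fin n → Fin n → Ω → ℝ) (cn : ℕ → ℝ) (c : ℝ) : Prop where
  measurable : ∀ n p q, p ≤ q → Measurable (a n p q)
  mean_zero : ∀ n p q, p ≤ q → ∫ ω, a n p q ω ∂P = 0
  variance_one : ∀ n p q, p ≤ q → ∫ ω, (a n p q ω) ^ 2 ∂P = 1
  /-- moments of every order are finite, uniformly in `n` and in the position -/
  moments : ∀ k : ℕ, ∃ M : ℝ, ∀ n p q, p ≤ q →
    Integrable (fun ω => |a n p q ω| ^ k) P ∧ ∫ ω, |a n p q ω| ^ k ∂P ≤ M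
  /-- for each `n`, the diagonals `{a n p q : p + r = q}`, `r = 0, …, n - 1`, are independent -/
  indep : ∀ n, iIndepFun
    (fun (r : Fin n) (ω : Ω) (z : {z : Fin n × Fin n // (z.1 : ℕ) + r = z.2}) =>
      a n z.1.1 z.1.2 ω) P
  /-- any two distinct entries on the same diagonal have covariance `cn n` -/
  cov_eq : ∀ (n r : ℕ) (p q p' q' : Fin n), (p : ℕ) + r = q → (p' : ℕ) + r = q' → p ≠ p' →
    covariance (a n p q) (a n p' q') P = cn n
  tendsto_cov : Tendsto cn atTop (𝓝 c)

/-! ### The two special laws -/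

/-- The semicircle law, with density `(1 / 2π) √(4 - x²)` on `[-2, 2]`. -/
def semicircleLaw : Measure ℝ :=
  volume.withDensity fun x => ENNReal.ofReal
    ((Set.Icc (-2 : ℝ) 2).indicator (fun x => 1 / (2 * Real.pi) * Real.sqrt (4 - x ^ 2)) x)

/-- `ξ` is an i.i.d. sequence of centred random variables with unit variance and finite moments of
every order. -/
structure IsStandardIID {Ω : Type*} [MeasurableSpace Ω] (P : Measure Ω) (ξ : ℕ → Ω → ℝ) :
    Prop where
  measurable : ∀ i, Measurable (ξ i)
  indep : iIndepFun ξ P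
  ident : ∀ i, IdentDistrib (ξ i) (ξ 0) P P
  mean_zero : ∫ ω, ξ 0 ω ∂P = 0
  variance_one : ∫ ω, (ξ 0 ω) ^ 2 ∂P = 1
  moments : ∀ k : ℕ, Integrable (fun ω => |ξ 0 ω| ^ k) P

/-- The empirical eigenvalue distribution of the random symmetric Toeplitz matrix
`(ξ_{|p - q|} / √n)`. -/
def toeplitzESD (n : ℕ) (ξ : ℕ → ℝ) : FiniteMeasure ℝ :=
  esd n fun p q => ξ ((q : ℕ) - (p : ℕ))

end

/-! The proof is by the method of moments. The k-th moment of μ_n is the sum over closed paths x_0,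
…, x_k = x_0 of the products of the entries along the steps, divided by n·√n^k. A step lies on the
diagonal indexed by the absolute value of its increment. By independence and centring, a path that
uses some diagonal exactly once has expectation zero (`integral_pathWeight_eq_zero`). Counting
degrees of freedom shows that, up to O(n^{(k+1)/2}) paths (`Negligible`), the other paths pair their
steps by diagonal according to a pair partition π, with opposite increments inside each block: equal
increments would turn closedness into an additional linear relation. These paths are integer
solutions of the Toeplitz system, and counting lattice points in a convex body gives
p_T(π)·n^{k/2+1} of them asymptotically (`tendsto_card_gridSolutions`).

For such a path the expectation factorises over the blocks. A block contributes 1 if its two steps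
use the same entry and c_n otherwise. Blocks counted by the height always use the same entry, since
the increments between them cancel in pairs; for any other block this is an extra relation, hence
negligible. So the expectation is c_n^{k/2-h(π)}, and the expected moments converge to
`limitMoment`.

Almost sure convergence comes from an O(n^{-2}) bound for the fourth central moments. Only
quadruples of paths in which each path shares a diagonal with another one contribute, and they have
two degrees of freedom fewer than the normalisation allows (`exists_determining_set`).

The moment of order 2m is at most 4^m·m!, so the moments determine the limit law and their
convergence implies weak convergence. The laws ν_c exist because a Gaussian ensemble with covariance
exactly c realises `limitMoment` as a limit of moments of probability measures. For c = 0 only the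
noncrossing partitions survive; each has volume one and they are counted by the Catalan numbers. For
c = 1 a random Toeplitz matrix is an ensemble with c_n = 1. -/

/-! ### The method of moments on the real line. -/

theorem hasDerivAt_exp_sub_sum (n : ℕ) (y : ℝ) :
    HasDerivAt (fun y : ℝ => Complex.exp (y * Complex.I) -
        ∑ j ∈ Finset.range (n + 1), ((y : ℂ) * Complex.I) ^ j / (j.factorial : ℂ))
      ((Complex.exp (y * Complex.I) -
        ∑ j ∈ Finset.range n, ((y : ℂ) * Complex.I) ^ j / (j.factorial : ℂ)) * Complex.I) y := by
  have hlin : HasDerivAt (fun y : ℝ => (y : ℂ) * Complex.I) Complex.I y := by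
    simpa using (Complex.ofRealCLM.hasDerivAt (x := y)).mul_const Complex.I
  have h1 : HasDerivAt (fun y : ℝ => Complex.exp (y * Complex.I))
      (Complex.exp (y * Complex.I) * Complex.I) y := hlin.cexp
  have h2 : HasDerivAt (fun y : ℝ => ∑ j ∈ Finset.range (n + 1),
      ((y : ℂ) * Complex.I) ^ j / (j.factorial : ℂ))
      (∑ j ∈ Finset.range (n + 1),
        (j * ((y : ℂ) * Complex.I) ^ (j - 1) * Complex.I) / (j.factorial : ℂ)) y := by
    refine HasDerivAt.fun_sum fun j _ => ?_
    exact (hlin.pow j).div_const _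
  convert! h1.sub h2 using 1
  rw [sub_mul, Finset.sum_range_succ', Finset.sum_mul]
  congr 1
  simp only [Nat.cast_zero, zero_mul, zero_div, add_zero, Nat.add_sub_cancel]
  refine Finset.sum_congr rfl fun j _ => ?_
  rw [Nat.factorial_succ]
  have : ((j : ℂ) + 1) ≠ 0 := by exact_mod_cast Nat.succ_ne_zero j
  have h' : (j.factorial : ℂ) ≠ 0 := by exact_mod_cast Nat.factorial_ne_zero j
  push_cast
  field_simp

/-- Induction on the order: the remainder of order n + 1 vanishes at 0 and its derivative is, up to
the factor i, the remainder of order n, so the mean value inequality integrates the bound. -/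
theorem norm_exp_mul_I_sub_sum_le_of_nonneg (n : ℕ) : ∀ y : ℝ, 0 ≤ y →
    ‖Complex.exp (y * Complex.I) -
        ∑ j ∈ Finset.range n, ((y : ℂ) * Complex.I) ^ j / (j.factorial : ℂ)‖
      ≤ y ^ n / n.factorial := by
  induction n with
  | zero => intro y _; simp [Complex.norm_exp_ofReal_mul_I]
  | succ n ih =>
    intro y hy
    have hB : ∀ x : ℝ, HasDerivAt (fun x : ℝ => x ^ (n + 1) / ((n + 1).factorial : ℝ))
        (x ^ n / (n.factorial : ℝ)) x := by
      intro x
      convert! (hasDerivAt_pow (n + 1) x).div_const ((n + 1).factorial : ℝ) using 1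
      rw [Nat.factorial_succ]
      have : ((n : ℝ) + 1) ≠ 0 := by positivity
      have h' : (n.factorial : ℝ) ≠ 0 := by positivity
      push_cast
      field_simp
    refine image_norm_le_of_norm_deriv_right_le_deriv_boundary (a := 0) (b := y)
      (f := fun y : ℝ => Complex.exp (y * Complex.I) -
        ∑ j ∈ Finset.range (n + 1), ((y : ℂ) * Complex.I) ^ j / (j.factorial : ℂ))
      (f' := fun y : ℝ => (Complex.exp (y * Complex.I) -
        ∑ j ∈ Finset.range n, ((y : ℂ) * Complex.I) ^ j / (j.factorial : ℂ)) * Complex.I)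
      (B := fun x : ℝ => x ^ (n + 1) / ((n + 1).factorial : ℝ))
      (B' := fun x => x ^ n / (n.factorial : ℝ)) ?_ ?_ ?_ hB ?_ ⟨hy, le_refl y⟩
    · exact fun x _ => (hasDerivAt_exp_sub_sum n x).continuousAt.continuousWithinAt
    · exact fun x _ => (hasDerivAt_exp_sub_sum n x).hasDerivWithinAt
    · rw [Finset.sum_range_succ']; simp
    · intro x hx
      simpa using ih x hx.1

theorem norm_exp_mul_I_sub_sum_le (n : ℕ) (y : ℝ) :
    ‖Complex.exp (y * Complex.I) -
        ∑ j ∈ Finset.range n, ((y : ℂ) * Complex.I) ^ j / (j.factorial : ℂ)‖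
      ≤ |y| ^ n / n.factorial := by
  rcases le_total 0 y with hy | hy
  · rw [abs_of_nonneg hy]
    exact norm_exp_mul_I_sub_sum_le_of_nonneg n y hy
  · rw [abs_of_nonpos hy]
    refine le_trans (le_of_eq ?_) (norm_exp_mul_I_sub_sum_le_of_nonneg n (-y) (by linarith))
    -- Complex conjugation exchanges y and -y.
    rw [← Complex.norm_conj]
    congr 1
    simp [← Complex.exp_conj, map_sum]

/-- The characteristic function is approximated by its Taylor polynomial. -/
theorem norm_charFun_sub_sum_le (μ : Measure ℝ) [IsProbabilityMeasure μ]
    (hint : ∀ k : ℕ, Integrable (fun x : ℝ => x ^ k) μ) (m : ℕ) (t : ℝ) :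
    ‖charFun μ t - ∑ j ∈ Finset.range (2 * m),
        ((t : ℂ) * Complex.I) ^ j / (j.factorial : ℂ) * ((∫ x, x ^ j ∂μ : ℝ) : ℂ)‖
      ≤ t ^ (2 * m) / (2 * m).factorial * ∫ x, x ^ (2 * m) ∂μ := by
  have e : ∀ j : ℕ, ((t : ℂ) * Complex.I) ^ j / (j.factorial : ℂ) * ((∫ x, x ^ j ∂μ : ℝ) : ℂ)
      = ∫ x : ℝ, (((t * x : ℝ) : ℂ) * Complex.I) ^ j / (j.factorial : ℂ) ∂μ := by
    intro j
    rw [← integral_complex_ofReal, ← integral_const_mul]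
    congr 1
    ext x
    push_cast
    ring
  have hi : ∀ j : ℕ, Integrable
      (fun x : ℝ => (((t * x : ℝ) : ℂ) * Complex.I) ^ j / (j.factorial : ℂ)) μ := by
    intro j
    have := ((hint j).ofReal (𝕜 := ℂ)).const_mul (((t : ℂ) * Complex.I) ^ j / (j.factorial : ℂ))
    refine this.congr (ae_of_all _ fun x => ?_)
    simp
    ring
  have hexp : Integrable (fun x : ℝ => Complex.exp (((t * x : ℝ) : ℂ) * Complex.I)) μ := by
    refine Integrable.of_bound (C := 1) (by fun_prop) (ae_of_all _ fun x => ?_)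
    rw [Complex.norm_exp_ofReal_mul_I]
  have hch : charFun μ t = ∫ x : ℝ, Complex.exp (((t * x : ℝ) : ℂ) * Complex.I) ∂μ := by
    rw [charFun_apply_real]
    simp
  rw [hch, Finset.sum_congr rfl fun j _ => e j, ← integral_finsetSum _ fun j _ => hi j,
    ← integral_sub hexp (integrable_finsetSum _ fun j _ => hi j), ← integral_const_mul]
  refine norm_integral_le_of_norm_le ((hint (2 * m)).const_mul _) (ae_of_all _ fun x => ?_)
  refine (norm_exp_mul_I_sub_sum_le (2 * m) (t * x)).trans (le_of_eq ?_)
  rw [(even_two_mul m).pow_abs]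
  ring

/-- The method of moments: convergence of all moments to those of a measure whose moments grow
slowly implies weak convergence. -/
theorem tendsto_probabilityMeasure_of_tendsto_moments {μ : ℕ → ProbabilityMeasure ℝ}
    {ν : ProbabilityMeasure ℝ} {M : ℕ → ℝ}
    (hμ : ∀ n k, Integrable (fun x : ℝ => x ^ k) (μ n : Measure ℝ))
    (hν : ∀ k, Integrable (fun x : ℝ => x ^ k) (ν : Measure ℝ))
    (hlim : ∀ k, Tendsto (fun n => ∫ x, x ^ k ∂(μ n : Measure ℝ)) atTop (𝓝 (M k)))
    (hνM : ∀ k, ∫ x, x ^ k ∂(ν : Measure ℝ) = M k)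
    (hM : ∀ t : ℝ, Tendsto (fun m : ℕ => t ^ (2 * m) / (2 * m).factorial * M (2 * m))
      atTop (𝓝 0)) :
    Tendsto μ atTop (𝓝 ν) := by
  rw [ProbabilityMeasure.tendsto_iff_tendsto_charFun]
  intro t
  rw [Metric.tendsto_atTop]
  intro ε hε
  -- The order m makes the Taylor remainder of ν smaller than ε/4. For large n the remainder of μ n
  -- and the difference of the two Taylor polynomials are also below ε/4.
  obtain ⟨m, hm⟩ := ((hM t).eventually (gt_mem_nhds (show (0 : ℝ) < ε / 4 by linarith))).exists
  set p : (ℕ → ℝ) → ℂ := fun a => ∑ j ∈ Finset.range (2 * m),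
    ((t : ℂ) * Complex.I) ^ j / (j.factorial : ℂ) * ((a j : ℝ) : ℂ) with hp
  have h1 : Tendsto (fun n => ‖p (fun j => ∫ x, x ^ j ∂(μ n : Measure ℝ)) - p M‖) atTop
      (𝓝 0) := by
    rw [tendsto_iff_norm_sub_tendsto_zero.symm]
    refine tendsto_finsetSum _ fun j _ => ?_
    exact (((Complex.continuous_ofReal.tendsto _).comp (hlim j)).const_mul _)
  have h2 : Tendsto (fun n => t ^ (2 * m) / (2 * m).factorial *
      ∫ x, x ^ (2 * m) ∂(μ n : Measure ℝ)) atTop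
      (𝓝 (t ^ (2 * m) / (2 * m).factorial * M (2 * m))) := (hlim _).const_mul _
  have h3 := (h1.eventually (gt_mem_nhds (show (0 : ℝ) < ε / 4 by linarith))).and
    (h2.eventually (gt_mem_nhds hm))
  obtain ⟨N, hN⟩ := eventually_atTop.1 h3
  refine ⟨N, fun n hn => ?_⟩
  obtain ⟨ha, hb⟩ := hN n hn
  have hc := norm_charFun_sub_sum_le (μ n : Measure ℝ) (hμ n) m t
  have hd := norm_charFun_sub_sum_le (ν : Measure ℝ) hν m t
  simp only [hνM] at hd
  rw [dist_eq_norm]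
  have : charFun (μ n : Measure ℝ) t - charFun (ν : Measure ℝ) t
      = (charFun (μ n : Measure ℝ) t - p (fun j => ∫ x, x ^ j ∂(μ n : Measure ℝ)))
        + (p (fun j => ∫ x, x ^ j ∂(μ n : Measure ℝ)) - p M)
        - (charFun (ν : Measure ℝ) t - p M) := by ring
  rw [this]
  refine (norm_sub_le _ _).trans_lt ?_
  have := norm_add_le (charFun (μ n : Measure ℝ) t - p (fun j => ∫ x, x ^ j ∂(μ n : Measure ℝ)))
    (p (fun j => ∫ x, x ^ j ∂(μ n : Measure ℝ)) - p M)
  simp only [hp] at *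
  linarith

/-- Chebyshev's inequality bounds all tails by C/r² at once. -/
theorem isTightMeasureSet_range_of_second_moment_le {μ : ℕ → ProbabilityMeasure ℝ} {C : ℝ}
    (hint : ∀ n, Integrable (fun x : ℝ => x ^ 2) (μ n : Measure ℝ))
    (hC : ∀ n, ∫ x, x ^ 2 ∂(μ n : Measure ℝ) ≤ C) :
    IsTightMeasureSet {((ρ : ProbabilityMeasure ℝ) : Measure ℝ) | ρ ∈ Set.range μ} := by
  refine isTightMeasureSet_of_tendsto_measure_norm_gt ?_
  have h0 : Tendsto (fun r : ℝ => ENNReal.ofReal (C / r ^ 2)) atTop (𝓝 0) := by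
    rw [← ENNReal.ofReal_zero]
    refine ENNReal.tendsto_ofReal ?_
    exact tendsto_const_nhds.div_atTop (tendsto_pow_atTop (by norm_num))
  refine tendsto_of_tendsto_of_tendsto_of_le_of_le' tendsto_const_nhds h0
    (Eventually.of_forall fun _ => zero_le) ?_
  filter_upwards [eventually_gt_atTop 0] with r hr
  refine iSup₂_le fun ρ hρ => ?_
  obtain ⟨_, ⟨n, rfl⟩, rfl⟩ := hρ
  have h1 := mul_meas_ge_le_integral_of_nonneg (μ := (μ n : Measure ℝ))
    (f := fun x : ℝ => x ^ 2) (ae_of_all _ fun x => sq_nonneg x) (hint n) (r ^ 2)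
  have h2 : (μ n : Measure ℝ).real {x | r ^ 2 ≤ x ^ 2} ≤ C / r ^ 2 := by
    rw [le_div_iff₀ (by positivity)]
    linarith [hC n]
  calc (μ n : Measure ℝ) {x | r < ‖x‖} ≤ (μ n : Measure ℝ) {x | r ^ 2 ≤ x ^ 2} := by
        refine measure_mono fun x hx => ?_
        simp only [Set.mem_ofPred_eq, Real.norm_eq_abs] at hx ⊢
        rw [← sq_abs x]
        exact pow_le_pow_left₀ hr.le hx.le 2
    _ ≤ _ := by
        rw [← ENNReal.ofReal_toReal (measure_ne_top (μ n : Measure ℝ) _)]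
        exact ENNReal.ofReal_le_ofReal h2

/-- A sequence of probability measures whose moments all converge has a limit point with the
limiting moments. -/
theorem exists_probabilityMeasure_of_tendsto_moments {μ : ℕ → ProbabilityMeasure ℝ} {M : ℕ → ℝ}
    (hμ : ∀ n k, Integrable (fun x : ℝ => x ^ k) (μ n : Measure ℝ))
    (hlim : ∀ k, Tendsto (fun n => ∫ x, x ^ k ∂(μ n : Measure ℝ)) atTop (𝓝 (M k))) :
    ∃ ν : ProbabilityMeasure ℝ, (∀ k, Integrable (fun x : ℝ => x ^ k) (ν : Measure ℝ)) ∧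
      ∀ k, ∫ x, x ^ k ∂(ν : Measure ℝ) = M k := by
  obtain ⟨C, hC⟩ := (hlim 2).bddAbove_range
  have hcomp := isCompact_closure_of_isTightMeasureSet
    (isTightMeasureSet_range_of_second_moment_le (fun n => hμ n 2) fun n => hC ⟨n, rfl⟩)
  -- Along an ultrafilter finer than `atTop` compactness gives a genuine limit, so no subsequence
  -- has to be extracted.
  set F : Ultrafilter ℕ := Ultrafilter.of atTop with hF
  have hFle : (F : Filter ℕ) ≤ atTop := Ultrafilter.of_le _
  obtain ⟨ν, -, hν⟩ := isCompact_iff_ultrafilter_le_nhds.1 hcomp (F.map μ) (by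
    rw [le_principal_iff]
    exact Filter.mem_map.2 (univ_mem' fun n => subset_closure ⟨n, rfl⟩))
  have hνF : Tendsto μ F (𝓝 ν) := hν
  rw [ProbabilityMeasure.tendsto_iff_forall_integral_tendsto] at hνF
  have hlimF : ∀ k, Tendsto (fun n => ∫ x, x ^ k ∂(μ n : Measure ℝ)) F (𝓝 (M k)) :=
    fun k => (hlim k).mono_left hFle
  -- Weak convergence applies to the truncations min(x^{2k}, R), and Fatou's lemma removes the
  -- truncation. This gives only an inequality, but it provides integrability.
  have heven : ∀ k : ℕ, Integrable (fun x : ℝ => x ^ (2 * k)) (ν : Measure ℝ) ∧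
      ∫ x, x ^ (2 * k) ∂(ν : Measure ℝ) ≤ M (2 * k) := by
    intro k
    have hpos : ∀ x : ℝ, 0 ≤ x ^ (2 * k) := fun x => (even_two_mul k).pow_nonneg x
    have hb : ∀ R : ℕ, ∫ x, min (x ^ (2 * k)) (R : ℝ) ∂(ν : Measure ℝ) ≤ M (2 * k) := by
      intro R
      let g : BoundedContinuousFunction ℝ ℝ := BoundedContinuousFunction.ofNormedAddCommGroup
        (fun x : ℝ => min (x ^ (2 * k)) (R : ℝ)) (by fun_prop) R (fun x => by
          rw [Real.norm_of_nonneg (le_min (hpos x) (Nat.cast_nonneg R))]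
          exact min_le_right _ _)
      refine le_of_tendsto_of_tendsto (hνF g) (hlimF (2 * k)) (Eventually.of_forall fun n => ?_)
      exact integral_mono (g.integrable _) (hμ n _) fun x => min_le_left _ _
    have hlint : ∫⁻ x, ENNReal.ofReal (x ^ (2 * k)) ∂(ν : Measure ℝ)
        ≤ ENNReal.ofReal (M (2 * k)) := by
      have h1 : ∀ x : ℝ, ENNReal.ofReal (x ^ (2 * k)) =
          liminf (fun R : ℕ => ENNReal.ofReal (min (x ^ (2 * k)) (R : ℝ))) atTop := by
        intro x
        refine (Tendsto.liminf_eq ?_).symm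
        refine tendsto_const_nhds.congr' ?_
        filter_upwards [eventually_ge_atTop ⌈x ^ (2 * k)⌉₊] with R hR
        rw [min_eq_left (Nat.ceil_le.1 hR)]
      simp_rw [h1]
      refine (lintegral_liminf_le fun R => by fun_prop).trans ?_
      refine liminf_le_of_le (by isBoundedDefault) fun b hb' => ?_
      obtain ⟨R, hR⟩ := hb'.exists
      refine hR.trans ?_
      rw [← ofReal_integral_eq_lintegral_ofReal]
      · exact ENNReal.ofReal_le_ofReal (hb R)
      · refine Integrable.of_bound (C := (R : ℝ)) (by fun_prop) (ae_of_all _ fun x => ?_)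
        rw [Real.norm_of_nonneg (le_min (hpos x) (Nat.cast_nonneg R))]
        exact min_le_right _ _
      · exact ae_of_all _ fun x => le_min (hpos x) (Nat.cast_nonneg R)
    have hi : Integrable (fun x : ℝ => x ^ (2 * k)) (ν : Measure ℝ) := by
      refine ⟨by fun_prop, ?_⟩
      rw [hasFiniteIntegral_iff_ofReal (ae_of_all _ hpos)]
      exact hlint.trans_lt ENNReal.ofReal_lt_top
    refine ⟨hi, ?_⟩
    have hMnn : 0 ≤ M (2 * k) :=
      ge_of_tendsto' (hlim (2 * k)) fun n => integral_nonneg hpos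
    rw [← ENNReal.ofReal_le_ofReal_iff hMnn,
      ofReal_integral_eq_lintegral_ofReal hi (ae_of_all _ hpos)]
    exact hlint
  have hint : ∀ k, Integrable (fun x : ℝ => x ^ k) (ν : Measure ℝ) := by
    intro k
    refine Integrable.mono' ((heven k).1.add (integrable_const 1)) (by fun_prop)
      (ae_of_all _ fun x => ?_)
    simp only [Pi.add_apply, norm_pow, Real.norm_eq_abs]
    have : x ^ (2 * k) = (|x| ^ k) ^ 2 := by rw [← pow_mul, mul_comm k 2, (even_two_mul k).pow_abs]
    rw [this]
    nlinarith [sq_nonneg (|x| ^ k - 1)]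
  refine ⟨ν, hint, fun k => ?_⟩
  have hMnn : 0 ≤ M (2 * (k + 1)) :=
    ge_of_tendsto' (hlim (2 * (k + 1))) fun n =>
      integral_nonneg fun x => (even_two_mul (k + 1)).pow_nonneg x
  -- Uniform integrability: clamping x to [-R, R] changes the k-th moment of each measure by at most
  -- 2/R times its moment of order 2(k + 1). This error is paid once along the sequence and once for
  -- ν.
  have hkey : ∀ R : ℝ, 1 ≤ R →
      |∫ x, x ^ k ∂(ν : Measure ℝ) - M k| ≤ 4 * M (2 * (k + 1)) / R := by
    intro R hR
    have hR0 : (0 : ℝ) < R := by linarith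
    set cl : ℝ → ℝ := fun x => max (-R) (min x R) with hcl
    have hclR : ∀ x, |cl x| ≤ R := fun x =>
      abs_le.2 ⟨le_max_left _ _, max_le (by linarith) (min_le_right _ _)⟩
    have hdiff : ∀ x : ℝ, |x ^ k - cl x ^ k| ≤ 2 / R * x ^ (2 * (k + 1)) := by
      intro x
      by_cases hx : |x| ≤ R
      · have : cl x = x := by
          simp only [hcl]
          rw [min_eq_left (abs_le.1 hx).2, max_eq_right (abs_le.1 hx).1]
        rw [this, sub_self, abs_zero]
        have := (even_two_mul (k + 1)).pow_nonneg x
        positivity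
      · push Not at hx
        have h1 : |x ^ k - cl x ^ k| ≤ 2 * |x| ^ k := by
          refine (abs_sub _ _).trans ?_
          rw [abs_pow, abs_pow]
          have := pow_le_pow_left₀ (abs_nonneg (cl x)) ((hclR x).trans hx.le) k
          linarith
        have h2 : x ^ (2 * (k + 1)) = |x| ^ k * |x| ^ (k + 1) * |x| := by
          rw [← (even_two_mul (k + 1)).pow_abs]
          ring
        refine h1.trans ?_
        rw [h2]
        have h3 : (1 : ℝ) ≤ |x| ^ (k + 1) := one_le_pow₀ (by linarith)
        have h4 : R ≤ |x| ^ (k + 1) * |x| := by nlinarith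
        have h5 : 0 ≤ |x| ^ k := by positivity
        rw [div_mul_eq_mul_div, le_div_iff₀ hR0]
        nlinarith [mul_le_mul_of_nonneg_left h4 h5]
    let g : BoundedContinuousFunction ℝ ℝ := BoundedContinuousFunction.ofNormedAddCommGroup
      (fun x : ℝ => cl x ^ k) (by fun_prop) (R ^ k) (fun x => by
        rw [norm_pow]
        exact pow_le_pow_left₀ (norm_nonneg _) (hclR x) k)
    have happ : ∀ ρ : Measure ℝ, IsProbabilityMeasure ρ →
        (∀ k : ℕ, Integrable (fun x : ℝ => x ^ k) ρ) →
        |∫ x, x ^ k ∂ρ - ∫ x, g x ∂ρ| ≤ 2 / R * ∫ x, x ^ (2 * (k + 1)) ∂ρ := by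
      intro ρ _ hρ
      rw [← integral_sub (hρ k) (g.integrable _), ← integral_const_mul, ← Real.norm_eq_abs]
      exact norm_integral_le_of_norm_le ((hρ _).const_mul _) (ae_of_all _ hdiff)
    have hl1 : Tendsto (fun n => |∫ x, x ^ k ∂(μ n : Measure ℝ) - ∫ x, g x ∂(μ n : Measure ℝ)|) F
        (𝓝 |M k - ∫ x, g x ∂(ν : Measure ℝ)|) := ((hlimF k).sub (hνF g)).abs
    have hl2 : |M k - ∫ x, g x ∂(ν : Measure ℝ)| ≤ 2 / R * M (2 * (k + 1)) :=
      le_of_tendsto_of_tendsto hl1 ((hlimF _).const_mul _)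
        (Eventually.of_forall fun n => happ _ inferInstance (hμ n))
    have h3 := happ ν inferInstance hint
    have h4 : 2 / R * ∫ x, x ^ (2 * (k + 1)) ∂(ν : Measure ℝ) ≤ 2 / R * M (2 * (k + 1)) :=
      mul_le_mul_of_nonneg_left (heven _).2 (by positivity)
    have h5 : 4 * M (2 * (k + 1)) / R = 2 / R * M (2 * (k + 1)) + 2 / R * M (2 * (k + 1)) := by
      ring
    rw [h5]
    have := abs_sub_le (∫ x, x ^ k ∂(ν : Measure ℝ)) (∫ x, g x ∂(ν : Measure ℝ)) (M k)
    rw [abs_sub_comm (∫ x, g x ∂(ν : Measure ℝ)) (M k)] at this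
    linarith
  have h0 : Tendsto (fun R : ℝ => 4 * M (2 * (k + 1)) / R) atTop (𝓝 0) :=
    tendsto_const_nhds.div_atTop tendsto_id
  have := ge_of_tendsto h0 ((eventually_ge_atTop 1).mono hkey)
  exact sub_eq_zero.1 (abs_nonpos_iff.1 this)

/-! ### Moments of the semicircle law. -/

theorem integral_sqrt_four_sub_sq : ∫ x in (-2 : ℝ)..2, √(4 - x ^ 2) = 2 * Real.pi := by
  have h := intervalIntegral.integral_comp_mul_left (a := -1) (b := 1)
    (fun x : ℝ => √(4 - x ^ 2)) (c := 2) two_ne_zero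
  have h2 : ∀ x : ℝ, √(4 - (2 * x) ^ 2) = 2 * √(1 - x ^ 2) := by
    intro x
    rw [show 4 - (2 * x) ^ 2 = 2 ^ 2 * (1 - x ^ 2) by ring, Real.sqrt_mul (by norm_num),
      Real.sqrt_sq (by norm_num)]
  simp only [h2, intervalIntegral.integral_const_mul, integral_sqrt_one_sub_sq] at h
  norm_num at h
  linarith

/-- The function x^{2m+1}(4 - x²)^{3/2} vanishes at ±2, so its derivative integrates to zero. The
resulting recursion is that of the Catalan numbers. -/
theorem integral_pow_mul_sqrt_rec (m : ℕ) :
    (m + 2) * ∫ x in (-2 : ℝ)..2, x ^ (2 * (m + 1)) * √(4 - x ^ 2) =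
      2 * (2 * m + 1) * ∫ x in (-2 : ℝ)..2, x ^ (2 * m) * √(4 - x ^ 2) := by
  set f : ℝ → ℝ := fun x => x ^ (2 * m + 1) * ((4 - x ^ 2) * √(4 - x ^ 2)) with hf
  set f' : ℝ → ℝ := fun x => 4 * (2 * m + 1) * (x ^ (2 * m) * √(4 - x ^ 2)) -
    (2 * m + 4) * (x ^ (2 * (m + 1)) * √(4 - x ^ 2)) with hf'
  have hder : ∀ x ∈ Set.Ioo (-2 : ℝ) 2, HasDerivAt f (f' x) x := by
    intro x hx
    have hpos : 0 < 4 - x ^ 2 := by nlinarith [hx.1, hx.2]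
    have hq : HasDerivAt (fun x : ℝ => 4 - x ^ 2) (-(2 * x)) x := by
      simpa using (hasDerivAt_pow 2 x).const_sub 4
    have hs := hq.sqrt hpos.ne'
    have hp := hasDerivAt_pow (2 * m + 1) x
    convert! hp.mul (hq.mul hs) using 1
    have hs0 : √(4 - x ^ 2) ≠ 0 := (Real.sqrt_pos.2 hpos).ne'
    have hsq : √(4 - x ^ 2) ^ 2 = 4 - x ^ 2 := Real.sq_sqrt hpos.le
    simp only [hf', Nat.add_sub_cancel, Pi.mul_apply]
    push_cast
    field_simp
    simp only [hsq]
    ring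
  have hint : ∀ j : ℕ, IntervalIntegrable (fun x : ℝ => x ^ j * √(4 - x ^ 2)) volume (-2) 2 :=
    fun j => Continuous.intervalIntegrable (by fun_prop) _ _
  have h := intervalIntegral.integral_eq_sub_of_hasDerivAt_of_le (a := -2) (b := 2) (by norm_num)
    (f := f) (f' := f') (by fun_prop) hder
    (((hint _).const_mul _).sub ((hint _).const_mul _))
  rw [intervalIntegral.integral_sub ((hint _).const_mul _) ((hint _).const_mul _),
    intervalIntegral.integral_const_mul, intervalIntegral.integral_const_mul] at h
  simp only [hf] at h
  norm_num at h
  linarith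

theorem integral_pow_mul_sqrt (m : ℕ) :
    ∫ x in (-2 : ℝ)..2, x ^ (2 * m) * √(4 - x ^ 2) = 2 * Real.pi * catalan m := by
  induction m with
  | zero => simpa using integral_sqrt_four_sub_sq
  | succ m ih =>
    have h := integral_pow_mul_sqrt_rec m
    rw [ih] at h
    have hc : ((m : ℝ) + 2) * catalan (m + 1) = 2 * (2 * m + 1) * catalan m := by
      have h1 := succ_mul_catalan_eq_centralBinom m
      have h2 := succ_mul_catalan_eq_centralBinom (m + 1)
      have h3 := Nat.succ_mul_centralBinom_succ m
      rw [← h1, ← h2] at h3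
      have h4 : ((m : ℝ) + 1) * (((m : ℝ) + 2) * catalan (m + 1)) =
          (m + 1) * (2 * (2 * m + 1) * catalan m) := by
        have : (((m + 1) * ((m + 1 + 1) * catalan (m + 1)) : ℕ) : ℝ) =
          ((2 * (2 * m + 1) * ((m + 1) * catalan m) : ℕ) : ℝ) := by exact_mod_cast h3
        push_cast at this
        linarith
      exact mul_left_cancel₀ (by positivity) h4
    have h5 : ((m : ℝ) + 2) * ∫ x in (-2 : ℝ)..2, x ^ (2 * (m + 1)) * √(4 - x ^ 2) =
        (m + 2) * (2 * Real.pi * catalan (m + 1)) := by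
      rw [h]
      linear_combination (-2 * Real.pi) * hc
    exact mul_left_cancel₀ (by positivity) h5

theorem integral_semicircleLaw (f : ℝ → ℝ) :
    ∫ x, f x ∂semicircleLaw =
      1 / (2 * Real.pi) * ∫ x in (-2 : ℝ)..2, f x * √(4 - x ^ 2) := by
  have hm : Measurable fun x : ℝ =>
      (Set.Icc (-2 : ℝ) 2).indicator (fun x => 1 / (2 * Real.pi) * √(4 - x ^ 2)) x :=
    Measurable.indicator (by fun_prop) measurableSet_Icc
  rw [semicircleLaw, integral_withDensity_eq_integral_toReal_smul hm.ennreal_ofReal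
    (ae_of_all _ fun _ => ENNReal.ofReal_lt_top), intervalIntegral.integral_of_le (by norm_num),
    ← integral_Icc_eq_integral_Ioc, ← integral_indicator measurableSet_Icc, ← integral_const_mul]
  congr 1
  ext x
  by_cases hx : x ∈ Set.Icc (-2 : ℝ) 2
  · simp only [Set.indicator_of_mem hx, smul_eq_mul]
    rw [ENNReal.toReal_ofReal (by positivity)]
    ring
  · simp [Set.indicator_of_notMem hx]

theorem integrable_semicircleLaw {f : ℝ → ℝ} (hf : Continuous f) :
    Integrable f semicircleLaw := by
  have hm : Measurable fun x : ℝ =>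
      (Set.Icc (-2 : ℝ) 2).indicator (fun x => 1 / (2 * Real.pi) * √(4 - x ^ 2)) x :=
    Measurable.indicator (by fun_prop) measurableSet_Icc
  rw [semicircleLaw, integrable_withDensity_iff_integrable_smul' hm.ennreal_ofReal
    (ae_of_all _ fun _ => ENNReal.ofReal_lt_top)]
  have h1 : IntegrableOn (fun x => 1 / (2 * Real.pi) * √(4 - x ^ 2) * f x)
      (Set.Icc (-2 : ℝ) 2) volume :=
    (by fun_prop : Continuous fun x => 1 / (2 * Real.pi) * √(4 - x ^ 2) * f x).integrableOn_Icc
  rw [← integrable_indicator_iff measurableSet_Icc] at h1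
  refine h1.congr (ae_of_all _ fun x => ?_)
  by_cases hx : x ∈ Set.Icc (-2 : ℝ) 2
  · simp only [Set.indicator_of_mem hx, smul_eq_mul]
    rw [ENNReal.toReal_ofReal (by positivity)]
  · simp [Set.indicator_of_notMem hx]

theorem isProbabilityMeasure_semicircleLaw : IsProbabilityMeasure semicircleLaw := by
  have h := integral_semicircleLaw fun _ => 1
  simp only [one_mul, integral_sqrt_four_sub_sq] at h
  rw [integral_const, smul_eq_mul, mul_one, one_div,
    inv_mul_cancel₀ (by positivity)] at h
  constructor
  rw [Measure.real, ENNReal.toReal_eq_one_iff] at h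
  exact h

theorem moment_semicircleLaw_even (m : ℕ) :
    ∫ x, x ^ (2 * m) ∂semicircleLaw = catalan m := by
  rw [integral_semicircleLaw, integral_pow_mul_sqrt, ← mul_assoc, one_div,
    inv_mul_cancel₀ (by positivity), one_mul]

theorem moment_semicircleLaw_odd (m : ℕ) :
    ∫ x, x ^ (2 * m + 1) ∂semicircleLaw = 0 := by
  rw [integral_semicircleLaw]
  have h := intervalIntegral.integral_comp_neg (a := -2) (b := 2)
    (fun x : ℝ => x ^ (2 * m + 1) * √(4 - x ^ 2))
  have hneg : ∀ x : ℝ, (-x) ^ (2 * m + 1) = -x ^ (2 * m + 1) := fun x =>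
    Odd.neg_pow ⟨m, rfl⟩ x
  simp only [neg_neg, even_two, Even.neg_pow, hneg, neg_mul, intervalIntegral.integral_neg] at h
  have : ∫ x in (-2 : ℝ)..2, x ^ (2 * m + 1) * √(4 - x ^ 2) = 0 := by linarith
  rw [this, mul_zero]

/-! ### The Toeplitz volume as a limit of lattice point counts. -/

theorem mem_freeVars {k : ℕ} {π : PairPartition k} {v : Fin (k + 1)} :
    v ∈ freeVars π ↔ ¬ ∃ i : Fin k, π.1 i < i ∧ v = i.succ := by
  simp [freeVars]

/-- To prove a property of all variables, prove it for the free ones and propagate it along the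
equations. -/
theorem freeVars_induction {k : ℕ} {π : PairPartition k} {p : Fin (k + 1) → Prop}
    (free : ∀ v ∈ freeVars π, p v)
    (dep : ∀ i, π.1 i < i → p i.castSucc → p (π.1 i).succ → p (π.1 i).castSucc → p i.succ)
    (v : Fin (k + 1)) : p v := by
  induction v using WellFoundedLT.induction with
  | ind v ih =>
    by_cases hv : v ∈ freeVars π
    · exact free v hv
    · rw [mem_freeVars, not_not] at hv
      obtain ⟨i, hi, rfl⟩ := hv
      have h1 : (π.1 i).succ < i.succ := by simpa using hi
      exact dep i hi (ih _ Fin.castSucc_lt_succ) (ih _ h1) (ih _ (Fin.castSucc_lt_succ.trans h1))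

theorem SolvesToeplitzSystem.succ_eq {k : ℕ} {π : PairPartition k} {x : Fin (k + 1) → ℝ}
    (hx : SolvesToeplitzSystem π x) (i : Fin k) :
    x i.succ = x i.castSucc - x (π.1 i).succ + x (π.1 i).castSucc := by
  have := hx i
  linarith

theorem SolvesToeplitzSystem.eq_of_eqOn_freeVars {k : ℕ} {π : PairPartition k}
    {x y : Fin (k + 1) → ℝ} (hx : SolvesToeplitzSystem π x) (hy : SolvesToeplitzSystem π y)
    (h : ∀ v ∈ freeVars π, x v = y v) : x = y := by
  funext v
  refine freeVars_induction (p := fun v => x v = y v) h (fun i _ h1 h2 h3 => ?_) v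
  rw [hx.succ_eq, hy.succ_eq, h1, h2, h3]

/-- A projection of the intersection of a linear subspace with the cube inherits compactness and
convexity; convexity makes the frontier a null set, which the lattice point count requires. -/
theorem toeplitzSection_eq_image {k : ℕ} (π : PairPartition k) :
    toeplitzSection π = (fun (x : Fin (k + 1) → ℝ) (v : freeVars π) => x v) ''
      ({x | SolvesToeplitzSystem π x} ∩ Set.Icc 0 1) := by
  ext y
  simp only [toeplitzSection, Set.mem_ofPred_eq, Set.mem_image, Set.mem_inter_iff, Set.mem_Icc,
    Pi.le_def, funext_iff, Pi.zero_apply, Pi.one_apply, forall_and]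
  constructor
  · rintro ⟨x, h1, h2, h3⟩
    exact ⟨x, ⟨h1, h2⟩, h3⟩
  · rintro ⟨x, ⟨h1, h2⟩, h3⟩
    exact ⟨x, h1, h2, h3⟩

theorem isCompact_toeplitzSection {k : ℕ} (π : PairPartition k) :
    IsCompact (toeplitzSection π) := by
  rw [toeplitzSection_eq_image]
  refine (IsCompact.inter_left isCompact_Icc ?_).image (by fun_prop)
  simp only [SolvesToeplitzSystem, Set.ofPred_forall]
  exact isClosed_iInter fun i => isClosed_eq (by fun_prop) continuous_const

theorem convex_toeplitzSection {k : ℕ} (π : PairPartition k) :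
    Convex ℝ (toeplitzSection π) := by
  rw [toeplitzSection_eq_image]
  have : IsLinearMap ℝ (fun (x : Fin (k + 1) → ℝ) (v : freeVars π) => x v) :=
    ⟨fun _ _ => rfl, fun _ _ => rfl⟩
  refine Convex.is_linear_image (Convex.inter ?_ (convex_Icc 0 1)) this
  intro x hx y hy a b _ _ _ i
  have h1 := hx i
  have h2 := hy i
  simp only [Pi.add_apply, Pi.smul_apply, smul_eq_mul]
  linear_combination a * h1 + b * h2

theorem toeplitzSection_subset_Icc {k : ℕ} (π : PairPartition k) :
    toeplitzSection π ⊆ Set.Icc 0 1 := by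
  rintro y ⟨x, -, h, hy⟩
  exact ⟨fun v => hy v ▸ (h v).1, fun v => hy v ▸ (h v).2⟩

theorem toeplitzVolume_nonneg {k : ℕ} (π : PairPartition k) : 0 ≤ toeplitzVolume π :=
  ENNReal.toReal_nonneg

theorem volume_Icc_zero_one_pi {ι : Type*} [Fintype ι] :
    volume (Set.Icc (0 : ι → ℝ) 1) = 1 := by
  rw [Real.volume_Icc_pi]
  simp

theorem toeplitzVolume_le_one {k : ℕ} (π : PairPartition k) : toeplitzVolume π ≤ 1 := by
  refine ENNReal.toReal_le_of_le_ofReal zero_le_one ?_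
  rw [ENNReal.ofReal_one, ← volume_Icc_zero_one_pi (ι := freeVars π)]
  exact measure_mono (toeplitzSection_subset_Icc π)

/-- The increments of a path with vertices in `Fin n`. -/
def increment {k n : ℕ} (x : Fin (k + 1) → Fin n) (i : Fin k) : ℤ :=
  (x i.succ : ℤ) - (x i.castSucc : ℤ)

/-- The solutions of the Toeplitz system with values in `{0, …, n - 1}`. -/
def gridSolutions {k : ℕ} (π : PairPartition k) (n : ℕ) : Finset (Fin (k + 1) → Fin n) :=
  Finset.univ.filter fun x => ∀ i, increment x i + increment x (π.1 i) = 0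

theorem solvesToeplitzSystem_of_mem_gridSolutions {k n : ℕ} {π : PairPartition k}
    {x : Fin (k + 1) → Fin n} (hx : x ∈ gridSolutions π n) (a : ℝ) :
    SolvesToeplitzSystem π fun v => a * (x v : ℕ) := by
  intro i
  have h := (Finset.mem_filter.1 hx).2 i
  have h' : (((increment x i + increment x (π.1 i) : ℤ)) : ℝ) = 0 := by exact_mod_cast h
  simp only [increment] at h'
  push_cast at h'
  linear_combination a * h'

open scoped Pointwise in
-- Division by n turns the values 0, …, n of `Fin (n + 1)` into grid points of [0, 1]; a solution
-- corresponds to its free coordinates.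
theorem card_gridSolutions_eq {k : ℕ} (π : PairPartition k) {n : ℕ} (hn : n ≠ 0) :
    (gridSolutions π (n + 1)).card = Nat.card ↑(toeplitzSection π ∩ (n : ℝ)⁻¹ •
      (Submodule.span ℤ (Set.range (Pi.basisFun ℝ (freeVars π))) : Set (freeVars π → ℝ))) := by
  have hn0 : (0 : ℝ) < n := by positivity
  have hn' : (n : ℝ) ≠ 0 := hn0.ne'
  have : NeZero n := ⟨hn⟩
  have hmem : ∀ y : freeVars π → ℝ, y ∈ (n : ℝ)⁻¹ •
      (Submodule.span ℤ (Set.range (Pi.basisFun ℝ (freeVars π))) : Set (freeVars π → ℝ)) ↔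
      ∀ v, (n : ℝ) * y v ∈ Set.range (algebraMap ℤ ℝ) := fun y =>
    BoxIntegral.unitPartition.mem_smul_span_iff (n := n)
  rw [← Nat.card_eq_finsetCard]
  refine Nat.card_eq_of_bijective
    (fun x => ⟨fun v => (n : ℝ)⁻¹ * ((x.1 v : ℕ) : ℝ), ?_, ?_⟩) ⟨?_, ?_⟩
  · refine ⟨fun v => (n : ℝ)⁻¹ * ((x.1 v : ℕ) : ℝ),
      solvesToeplitzSystem_of_mem_gridSolutions x.2 _, fun v => ⟨by positivity, ?_⟩, fun _ => rfl⟩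
    rw [inv_mul_le_iff₀ hn0, mul_one]
    exact_mod_cast Nat.lt_succ_iff.1 (x.1 v).2
  · rw [hmem]
    exact fun v => ⟨(x.1 v : ℕ), by simp [hn']⟩
  · intro x x' hxx'
    have h1 := solvesToeplitzSystem_of_mem_gridSolutions x.2 (n : ℝ)⁻¹
    have h2 := solvesToeplitzSystem_of_mem_gridSolutions x'.2 (n : ℝ)⁻¹
    have h3 := h1.eq_of_eqOn_freeVars h2 fun v hv =>
      congrFun (Subtype.ext_iff.1 hxx') ⟨v, hv⟩
    refine Subtype.ext (funext fun v => Fin.ext ?_)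
    have := mul_left_cancel₀ (inv_ne_zero hn') (congrFun h3 v)
    exact_mod_cast this
  · rintro ⟨y, ⟨x, hx, hbox, hxy⟩, hy⟩
    rw [hmem] at hy
    -- Each dependent variable is a combination of earlier ones with coefficients ±1, so integrality
    -- passes from the free variables to all.
    have hz : ∀ v, ∃ z : ℤ, (n : ℝ) * x v = z := by
      refine freeVars_induction (π := π) (fun v hv => ?_) ?_
      · obtain ⟨z, hz⟩ := hy ⟨v, hv⟩
        exact ⟨z, by rw [hxy ⟨v, hv⟩, ← hz]; simp⟩
      · rintro i - ⟨a, ha⟩ ⟨b, hb⟩ ⟨c, hc⟩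
        refine ⟨a - b + c, ?_⟩
        rw [hx.succ_eq]
        push_cast
        rw [← ha, ← hb, ← hc]
        ring
    choose z hz using hz
    have hz0 : ∀ v, 0 ≤ z v := fun v => by
      have : (0 : ℝ) ≤ z v := by rw [← hz]; exact mul_nonneg hn0.le (hbox v).1
      exact_mod_cast this
    have hzn : ∀ v, z v ≤ n := fun v => by
      have : (z v : ℝ) ≤ n := by rw [← hz]; exact mul_le_of_le_one_right hn0.le (hbox v).2
      exact_mod_cast this
    have hzc : ∀ v, ((z v).toNat : ℤ) = z v := fun v => Int.toNat_of_nonneg (hz0 v)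
    refine ⟨⟨fun v => ⟨(z v).toNat, by have := hzn v; omega⟩, ?_⟩, ?_⟩
    · refine Finset.mem_filter.2 ⟨Finset.mem_univ _, fun i => ?_⟩
      simp only [increment, hzc]
      have h := hx i
      have : (((z i.succ - z i.castSucc + (z (π.1 i).succ - z (π.1 i).castSucc) : ℤ)) : ℝ) = 0 := by
        push_cast
        simp only [← hz]
        linear_combination (n : ℝ) * h
      exact_mod_cast this
    · refine Subtype.ext (funext fun v => ?_)
      simp only
      have h1 : (((z v.1).toNat : ℕ) : ℝ) = z v.1 := by exact_mod_cast hzc v.1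
      rw [h1, ← hz, ← hxy v, inv_mul_cancel_left₀ hn']

theorem tendsto_card_gridSolutions {k : ℕ} (π : PairPartition k) :
    Tendsto (fun n : ℕ => ((gridSolutions π n).card : ℝ) / n ^ (freeVars π).card) atTop
      (𝓝 (toeplitzVolume π)) := by
  rw [← tendsto_add_atTop_iff_nat 1]
  have h1 := tendsto_card_div_pow_atTop_volume (toeplitzSection π)
    (isCompact_toeplitzSection π).isBounded (isCompact_toeplitzSection π).measurableSet
    ((convex_toeplitzSection π).addHaar_frontier volume)
  -- The lattice has mesh 1/n while the paths live in `Fin (n + 1)`; this factor replaces n by n + 1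
  -- in the normalisation.
  have h2 : Tendsto (fun n : ℕ => ((n : ℝ) / (n + 1)) ^ (freeVars π).card) atTop (𝓝 1) := by
    simpa using (tendsto_natCast_div_add_atTop (1 : ℝ)).pow (freeVars π).card
  have h3 := h1.mul h2
  rw [mul_one] at h3
  refine h3.congr' ?_
  filter_upwards [eventually_ge_atTop 1] with n hn
  have hn0 : n ≠ 0 := by omega
  have hn' : (n : ℝ) ≠ 0 := by exact_mod_cast hn0
  rw [card_gridSolutions_eq π hn0, Fintype.card_coe, div_pow, div_mul_div_comm, mul_comm,
    mul_div_mul_left _ _ (pow_ne_zero _ hn')]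
  push_cast
  rfl

/-- The smaller elements of the blocks. -/
def openers {k : ℕ} (π : PairPartition k) : Finset (Fin k) :=
  Finset.univ.filter fun i => i < π.1 i

theorem mem_openers {k : ℕ} {π : PairPartition k} {i : Fin k} : i ∈ openers π ↔ i < π.1 i := by
  simp [openers]

theorem card_compl_openers {k : ℕ} (π : PairPartition k) :
    (openers π)ᶜ.card = (openers π).card := by
  refine Finset.card_bij (fun i _ => π.1 i) ?_ ?_ ?_
  · intro i hi
    rw [Finset.mem_compl, mem_openers, not_lt] at hi
    rw [mem_openers, (π.2 i).2]
    exact lt_of_le_of_ne hi (π.2 i).1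
  · intro i _ j _ h
    rw [← (π.2 i).2, h, (π.2 j).2]
  · intro j hj
    rw [mem_openers] at hj
    refine ⟨π.1 j, ?_, (π.2 j).2⟩
    rw [Finset.mem_compl, mem_openers, (π.2 j).2, not_lt]
    exact hj.le

theorem two_mul_card_openers {k : ℕ} (π : PairPartition k) : 2 * (openers π).card = k := by
  have h := Finset.card_add_card_compl (openers π)
  rw [card_compl_openers, Fintype.card_fin] at h
  omega

/-- The dependent variables are the right endpoints of the k/2 closing steps among k + 1 variables.
-/
theorem card_freeVars {k : ℕ} (π : PairPartition k) :
    (freeVars π).card = (openers π).card + 1 := by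
  have h1 : (freeVars π)ᶜ.card = (openers π)ᶜ.card := by
    symm
    refine Finset.card_bij (fun i _ => i.succ) ?_ (fun i _ j _ h => Fin.succ_injective _ h) ?_
    · intro i hi
      rw [Finset.mem_compl, mem_openers, not_lt] at hi
      rw [Finset.mem_compl, mem_freeVars, not_not]
      exact ⟨i, lt_of_le_of_ne hi (π.2 i).1, rfl⟩
    · intro v hv
      rw [Finset.mem_compl, mem_freeVars, not_not] at hv
      obtain ⟨i, hi, rfl⟩ := hv
      refine ⟨i, ?_, rfl⟩
      rw [Finset.mem_compl, mem_openers, not_lt]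
      exact hi.le
  have h2 := Finset.card_add_card_compl (freeVars π)
  have h3 := card_compl_openers π
  have h4 := two_mul_card_openers π
  rw [Fintype.card_fin] at h2
  omega

/-! ### Paths and their increments. -/

/-- The common source of the upper bounds on numbers of paths: s records the starting points, d the
increments, and each increment in T has at most 2n + 1 values. -/
theorem card_le_mul_pow_of_determined {α A I : Type*} [Fintype A] (X : Finset α)
    (s : α → A) (d : α → I → ℤ) (n : ℕ) (hbox : ∀ x ∈ X, ∀ e, |d x e| ≤ n) (T : Finset I)
    (hinj : ∀ x ∈ X, ∀ y ∈ X, s x = s y → (∀ e ∈ T, d x e = d y e) → x = y) :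
    X.card ≤ Fintype.card A * (2 * n + 1) ^ T.card := by
  classical
  have h : X.card ≤ ((Finset.univ : Finset A) ×ˢ
      Fintype.piFinset fun _ : T => Finset.Icc (-(n : ℤ)) n).card := by
    refine Finset.card_le_card_of_injOn (fun x => (s x, fun e => d x e)) ?_ ?_
    · intro x hx
      simp only [Finset.coe_product, Set.mem_prod, Finset.mem_coe, Finset.mem_univ,
        Fintype.mem_piFinset, Finset.mem_Icc, true_and]
      exact fun e => abs_le.1 (hbox x hx e)
    · intro x hx y hy hxy
      simp only [Prod.mk.injEq, funext_iff] at hxy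
      exact hinj x hx y hy hxy.1 fun e he => hxy.2 ⟨e, he⟩
  refine h.trans (le_of_eq ?_)
  rw [Finset.card_product, Fintype.card_piFinset, Finset.prod_const, Int.card_Icc,
    Finset.card_univ, Finset.card_univ, Fintype.card_coe]
  congr 2
  omega

section Increment

variable {k n : ℕ}

theorem abs_increment_le (x : Fin (k + 1) → Fin n) (i : Fin k) : |increment x i| ≤ n := by
  have h1 := (x i.succ).2
  have h2 := (x i.castSucc).2
  rw [increment, abs_le]
  omega

theorem eq_of_increment_eq {x y : Fin (k + 1) → Fin n} (h0 : x 0 = y 0)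
    (h : ∀ i, increment x i = increment y i) : x = y := by
  funext v
  induction v using Fin.induction with
  | zero => exact h0
  | succ i ih =>
    have := h i
    rw [increment, increment, ih] at this
    exact Fin.ext (by omega)

/-- Increments between two positions telescope. -/
theorem sum_sub_between {A : Type*} [AddCommGroup A] (x : Fin (k + 1) → A) {i j : Fin k}
    (hij : i < j) :
    ∑ l, (if i < l ∧ l < j then x l.succ - x l.castSucc else 0) = x j.castSucc - x i.succ := by
  -- Extending x by zero to ℕ gives access to telescoping sums over intervals; the values beyond k
  -- never enter.
  set y : ℕ → A := fun v => if h : v < k + 1 then x ⟨v, h⟩ else 0 with hy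
  have ha : ∀ l : Fin k, y (l + 1) = x l.succ := fun l => by
    simp only [hy, dif_pos (Nat.succ_lt_succ l.2)]; rfl
  have hb : ∀ l : Fin k, y l = x l.castSucc := fun l => by
    simp only [hy, dif_pos (l.2.trans (Nat.lt_succ_self k))]; rfl
  have h1 : ∑ l : Fin k, (if i < l ∧ l < j then x l.succ - x l.castSucc else 0) =
      ∑ l : Fin k, (fun l : ℕ => if (i : ℕ) + 1 ≤ l ∧ l < j then y (l + 1) - y l else 0) l := by
    refine Finset.sum_congr rfl fun l _ => ?_
    simp only [ha, hb, Fin.lt_def, Nat.succ_le_iff]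
  rw [h1, Fin.sum_univ_eq_sum_range
    (fun l : ℕ => if (i : ℕ) + 1 ≤ l ∧ l < j then y (l + 1) - y l else 0) k, ← Finset.sum_filter]
  have h2 : (Finset.range k).filter (fun l => (i : ℕ) + 1 ≤ l ∧ l < j) =
      Finset.Ico ((i : ℕ) + 1) j := by
    ext l
    have := j.2
    simp only [Finset.mem_filter, Finset.mem_range, Finset.mem_Ico]
    omega
  rw [h2, Finset.sum_Ico_sub y (by exact hij), ha, hb]

theorem sum_increment_between (x : Fin (k + 1) → Fin n) {i j : Fin k} (hij : i < j) :
    ∑ l, (if i < l ∧ l < j then increment x l else 0) =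
      (x j.castSucc : ℤ) - (x i.succ : ℤ) :=
  sum_sub_between (fun v => (x v : ℤ)) hij

theorem sum_increment (x : Fin (k + 1) → Fin n) :
    ∑ i, increment x i = (x (Fin.last k) : ℤ) - (x 0 : ℤ) := by
  set y : ℕ → ℤ := fun v => if h : v < k + 1 then ((x ⟨v, h⟩ : ℕ) : ℤ) else 0 with hy
  have h1 : ∑ i, increment x i = ∑ l : Fin k, (fun l : ℕ => y (l + 1) - y l) l := by
    refine Finset.sum_congr rfl fun l _ => ?_
    have ha : y (l + 1) = (x l.succ : ℤ) := by
      simp only [hy, dif_pos (Nat.succ_lt_succ l.2)]; rfl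
    have hb : y l = (x l.castSucc : ℤ) := by
      simp only [hy, dif_pos (l.2.trans (Nat.lt_succ_self k))]; rfl
    simp only [ha, hb, increment]
  rw [h1, Fin.sum_univ_eq_sum_range (fun l : ℕ => y (l + 1) - y l) k, Finset.sum_range_sub]
  simp [hy, Fin.last]

end Increment

/-! ### Partitions of the steps according to the absolute value of the increment -/

/-- The element chosen for e depends only on the predicate "same value as e", which is literally the
same for all members of a class. -/
theorem exists_representative {I : Type*} (a : I → ℕ) :
    ∃ f : I → I, (∀ e, a (f e) = a e) ∧ ∀ e e', a e = a e' → f e = f e' := by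
  classical
  have h : ∀ e, ∃ e', a e' = a e := fun e => ⟨e, rfl⟩
  refine ⟨fun e => (h e).choose, fun e => (h e).choose_spec, fun e e' hee => ?_⟩
  have : (fun z => a z = a e) = fun z => a z = a e' := by rw [hee]
  simp only
  congr 1

/-- Records which steps share a diagonal, together with relative signs of their increments. On a
finite set of steps there are finitely many such patterns, so families of paths can be bounded
pattern by pattern. -/
theorem exists_representative_sign {I : Type*} (d : I → ℤ) :
    ∃ (f : I → I) (σ : I → ℤˣ), (∀ e, d e = σ e * d (f e)) ∧
      (∀ e e', (d e).natAbs = (d e').natAbs ↔ f e = f e') ∧ ∀ e, f (f e) = f e := by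
  obtain ⟨f, h1, h2⟩ := exists_representative fun e => (d e).natAbs
  have h3 : ∀ e, ∃ s : ℤˣ, d e = s * d (f e) := fun e => by
    rcases Int.natAbs_eq_natAbs_iff.1 (h1 e).symm with h | h
    · exact ⟨1, by simpa using h⟩
    · exact ⟨-1, by simpa using h⟩
  choose σ hσ using h3
  refine ⟨f, σ, hσ, fun e e' => ⟨h2 e e', fun h => ?_⟩, fun e => h2 _ _ (h1 e)⟩
  rw [← h1 e, ← h1 e', h]

section Fibers

variable {I : Type*} [Fintype I] [DecidableEq I] {f : I → I}

theorem sum_card_fiber (f : I → I) :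
    ∑ b ∈ Finset.univ.image f, (Finset.univ.filter fun e => f e = b).card = Fintype.card I := by
  rw [← Finset.card_univ]
  exact (Finset.card_eq_sum_card_fiberwise fun e _ =>
    Finset.mem_coe.2 (Finset.mem_image_of_mem f (Finset.mem_univ e))).symm

theorem two_le_card_fiber (h2 : ∀ e, ∃ e', e' ≠ e ∧ f e' = f e) {b : I}
    (hb : b ∈ Finset.univ.image f) : 2 ≤ (Finset.univ.filter fun e => f e = b).card := by
  obtain ⟨e, -, rfl⟩ := Finset.mem_image.1 hb
  obtain ⟨e', hne, he⟩ := h2 e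
  exact Finset.one_lt_card.2 ⟨e', by simp [he], e, by simp, hne⟩

theorem two_mul_card_image_le (h2 : ∀ e, ∃ e', e' ≠ e ∧ f e' = f e) :
    2 * (Finset.univ.image f).card ≤ Fintype.card I := by
  rw [← sum_card_fiber f, mul_comm, ← smul_eq_mul]
  exact Finset.card_nsmul_le_sum _ _ _ fun b hb => two_le_card_fiber h2 hb

/-- The excess of the class sizes over two. -/
theorem sum_card_fiber_sub_two (h2 : ∀ e, ∃ e', e' ≠ e ∧ f e' = f e) :
    ∑ b ∈ Finset.univ.image f, ((Finset.univ.filter fun e => f e = b).card - 2) +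
      2 * (Finset.univ.image f).card = Fintype.card I := by
  rw [← sum_card_fiber f, mul_comm, ← smul_eq_mul, ← Finset.sum_const, ← Finset.sum_add_distrib]
  exact Finset.sum_congr rfl fun b hb => Nat.sub_add_cancel (two_le_card_fiber h2 hb)

end Fibers

/-! ### Negligible families of paths. -/

/-- A family of sets of paths which is too small to contribute to the limit of the `k`-th moment. -/
def Negligible (k : ℕ) (X : (n : ℕ) → Finset (Fin (k + 1) → Fin n)) : Prop :=
  ∃ C : ℝ, ∀ n, ((X n).card : ℝ) * √n ≤ C * (n * √n ^ k)

theorem Negligible.mono {k : ℕ} {X Y : (n : ℕ) → Finset (Fin (k + 1) → Fin n)}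
    (hY : Negligible k Y) (h : ∀ n, X n ⊆ Y n) : Negligible k X := by
  obtain ⟨C, hC⟩ := hY
  refine ⟨C, fun n => le_trans ?_ (hC n)⟩
  gcongr
  exact h n

theorem negligible_of_forall_notMem {k : ℕ} {X : (n : ℕ) → Finset (Fin (k + 1) → Fin n)}
    (h : ∀ n, ∀ x, x ∉ X n) : Negligible k X :=
  ⟨0, fun n => by simp [Finset.eq_empty_of_forall_notMem (h n)]⟩

theorem Negligible.union {k : ℕ} {X Y : (n : ℕ) → Finset (Fin (k + 1) → Fin n)}
    (hX : Negligible k X) (hY : Negligible k Y) : Negligible k fun n => X n ∪ Y n := by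
  classical
  obtain ⟨C, hC⟩ := hX
  obtain ⟨D, hD⟩ := hY
  refine ⟨C + D, fun n => ?_⟩
  have : (((X n ∪ Y n).card : ℕ) : ℝ) ≤ (X n).card + (Y n).card := by
    exact_mod_cast Finset.card_union_le _ _
  calc _ ≤ (((X n).card : ℝ) + (Y n).card) * √n := by gcongr
    _ ≤ _ := by linarith [hC n, hD n]

theorem Negligible.biUnion {k : ℕ} {ι : Type*} (s : Finset ι)
    {X : ι → (n : ℕ) → Finset (Fin (k + 1) → Fin n)} (hX : ∀ i ∈ s, Negligible k (X i)) :
    Negligible k fun n => s.biUnion fun i => X i n := by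
  classical
  induction s using Finset.induction with
  | empty => exact ⟨0, fun n => by simp⟩
  | insert i s _ ih =>
    simp only [Finset.biUnion_insert]
    exact (hX i (Finset.mem_insert_self _ _)).union
      (ih fun j hj => hX j (Finset.mem_insert_of_mem hj))

theorem two_mul_add_one_pow_le {n : ℕ} (hn : 1 ≤ n) (s : ℕ) :
    ((2 * n + 1 : ℕ) : ℝ) ^ s ≤ 3 ^ s * (n : ℝ) ^ s := by
  rw [← mul_pow]
  have : (1 : ℝ) ≤ n := by exact_mod_cast hn
  gcongr
  push_cast
  linarith

/-- There are n starting points and at most (2n + 1)^|T| increments, and 2|T| + 1 ≤ k leaves a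
factor √n to spare against n·√n^k. -/
theorem negligible_of_determined {k : ℕ} {X : (n : ℕ) → Finset (Fin (k + 1) → Fin n)}
    (T : Finset (Fin k)) (hT : 2 * T.card + 1 ≤ k)
    (hinj : ∀ n, ∀ x ∈ X n, ∀ y ∈ X n, (∀ e ∈ T, increment x e = increment y e) →
      ∀ e, increment x e = increment y e) :
    Negligible k X := by
  refine ⟨3 ^ T.card, fun n => ?_⟩
  rcases Nat.eq_zero_or_pos n with rfl | hn
  · simp
  have h1 := card_le_mul_pow_of_determined (X n) (fun x => x 0) increment n
    (fun x _ => abs_increment_le x) T fun x hx y hy h0 h =>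
      eq_of_increment_eq h0 (hinj n x hx y hy h)
  rw [Fintype.card_fin] at h1
  have h2 : ((X n).card : ℝ) ≤ n * ((2 * n + 1 : ℕ) : ℝ) ^ T.card := by exact_mod_cast h1
  have h3 : (1 : ℝ) ≤ √n := Real.one_le_sqrt.2 (by exact_mod_cast hn)
  have h4 : (n : ℝ) ^ T.card * √n ≤ √n ^ k := by
    calc (n : ℝ) ^ T.card * √n = √n ^ (2 * T.card + 1) := by
          rw [pow_succ, pow_mul, Real.sq_sqrt (Nat.cast_nonneg n)]
      _ ≤ _ := pow_le_pow_right₀ h3 hT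
  calc ((X n).card : ℝ) * √n ≤ n * (3 ^ T.card * (n : ℝ) ^ T.card) * √n := by
        gcongr
        exact h2.trans (by gcongr; exact two_mul_add_one_pow_le hn _)
    _ = 3 ^ T.card * (n * ((n : ℝ) ^ T.card * √n)) := by ring
    _ ≤ _ := by gcongr

/-- A linear relation between the increments which does not follow from the pairing makes a set of
paths negligible. -/
theorem negligible_of_pairing_of_relation {k : ℕ} (π : PairPartition k) (σ : Fin k → ℤ)
    (l : Fin k → ℤ) (i₀ : Fin k) (hl : l i₀ + σ i₀ * l (π.1 i₀) ≠ 0)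
    {X : (n : ℕ) → Finset (Fin (k + 1) → Fin n)}
    (hσ : ∀ n, ∀ x ∈ X n, ∀ i, increment x (π.1 i) = σ i * increment x i)
    (hX : ∀ n, ∀ x ∈ X n, ∑ i, l i * increment x i = 0) : Negligible k X := by
  classical
  -- The opener of the block of i₀ can be dropped from the k/2 determining increments, because the
  -- relation recovers it from the others.
  obtain ⟨i₁, hi₁⟩ : ∃ i₁ ∈ openers π, i₁ = i₀ ∨ i₁ = π.1 i₀ := by
    rcases lt_or_gt_of_ne (π.2 i₀).1 with h | h
    · exact ⟨π.1 i₀, by rw [mem_openers, (π.2 i₀).2]; exact h, Or.inr rfl⟩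
    · exact ⟨i₀, by rw [mem_openers]; exact h, Or.inl rfl⟩
  have hcard := Finset.card_erase_of_mem hi₁.1
  have hpos := Finset.card_pos.2 ⟨i₁, hi₁.1⟩
  have hk := two_mul_card_openers π
  refine negligible_of_determined ((openers π).erase i₁) (by omega) fun n x hx y hy hT => ?_
  -- All relations are linear and homogeneous, so they hold for the difference of two paths, which
  -- has to be shown to vanish.
  set δ : Fin k → ℤ := fun i => increment x i - increment y i with hδ
  have hδσ : ∀ i, δ (π.1 i) = σ i * δ i := fun i => by
    simp only [hδ, hσ n x hx, hσ n y hy]; ring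
  have hδ0 : ∀ i, i ≠ i₀ → i ≠ π.1 i₀ → δ i = 0 := by
    intro i h1 h2
    have hT' : ∀ j ∈ openers π, j ≠ i₁ → δ j = 0 := fun j hj hne =>
      sub_eq_zero.2 (hT j (Finset.mem_erase.2 ⟨hne, hj⟩))
    have hne1 : i ≠ i₁ := by rcases hi₁.2 with h | h <;> rw [h] <;> assumption
    have hne2 : π.1 i ≠ i₁ := by
      rcases hi₁.2 with h | h <;> rw [h]
      · exact fun h => h2 (by rw [← h, (π.2 i).2])
      · exact fun h => h1 (by rw [← (π.2 i).2, h, (π.2 i₀).2])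
    rcases lt_or_gt_of_ne (π.2 i).1 with h | h
    · have h3 := hδσ (π.1 i)
      rw [(π.2 i).2] at h3
      rw [h3, hT' (π.1 i) (by rw [mem_openers, (π.2 i).2]; exact h) hne2, mul_zero]
    · exact hT' i (mem_openers.2 h) hne1
  have hsum : ∑ i, l i * δ i = 0 := by
    have := hX n x hx
    have h' := hX n y hy
    simp only [hδ, mul_sub, Finset.sum_sub_distrib]
    rw [this, h', sub_zero]
  have hi₀ : δ i₀ = 0 := by
    rw [Finset.sum_eq_add (a := i₀) (b := π.1 i₀) (π.2 i₀).1.symm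
      (fun i _ h => by rw [hδ0 i h.1 h.2, mul_zero]) (by simp) (by simp), hδσ] at hsum
    have : (l i₀ + σ i₀ * l (π.1 i₀)) * δ i₀ = 0 := by linear_combination hsum
    exact (mul_eq_zero.1 this).resolve_left hl
  intro e
  refine sub_eq_zero.1 ?_
  change δ e = 0
  by_cases h1 : e = i₀
  · rw [h1, hi₀]
  by_cases h2 : e = π.1 i₀
  · rw [h2, hδσ, hi₀, mul_zero]
  exact hδ0 e h1 h2

theorem sum_pair_eq_zero {A : Type*} [AddCommMonoid A] {k : ℕ} (π : PairPartition k)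
    (s : Finset (Fin k)) (hs : ∀ i ∈ s, π.1 i ∈ s) (d : Fin k → A) (hd : ∀ i ∈ s, d i + d (π.1 i) = 0) :
    ∑ i ∈ s, d i = 0 :=
  Finset.sum_involution (fun i _ => π.1 i) hd (fun i _ _ => (π.2 i).1) hs fun i _ => (π.2 i).2

/-! ### Path patterns and accidental coincidences. -/

/-- The closed paths. -/
def closedPaths (k n : ℕ) : Finset (Fin (k + 1) → Fin n) :=
  Finset.univ.filter fun x => x 0 = x (Fin.last k)

theorem mem_closedPaths {k n : ℕ} {x : Fin (k + 1) → Fin n} :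
    x ∈ closedPaths k n ↔ x 0 = x (Fin.last k) := by
  simp [closedPaths]

theorem mem_gridSolutions {k n : ℕ} {π : PairPartition k} {x : Fin (k + 1) → Fin n} :
    x ∈ gridSolutions π n ↔ ∀ i, increment x i + increment x (π.1 i) = 0 := by
  simp [gridSolutions]

theorem gridSolutions_subset_closedPaths {k n : ℕ} (π : PairPartition k) :
    gridSolutions π n ⊆ closedPaths k n := by
  intro x hx
  rw [mem_gridSolutions] at hx
  rw [mem_closedPaths]
  have h := sum_increment x
  rw [sum_pair_eq_zero π Finset.univ (fun _ _ => Finset.mem_univ _) _ fun i _ => hx i] at h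
  exact Fin.ext (by omega)

/-- Two steps lie on the same diagonal exactly if they are in the same block of `π`. -/
def HasPattern {k n : ℕ} (π : PairPartition k) (x : Fin (k + 1) → Fin n) : Prop :=
  ∀ i j, (increment x i).natAbs = (increment x j).natAbs ↔ j = i ∨ j = π.1 i

/-- The condition defining the blocks that are counted by `height`. -/
def IsClosedBlock {k : ℕ} (π : PairPartition k) (i : Fin k) : Prop :=
  ∀ l, i < l → l < π.1 i → i < π.1 l ∧ π.1 l < π.1 i

/-- The block of `i` is traversed back and forth at the same position. -/
def SamePosition {k n : ℕ} (π : PairPartition k) (x : Fin (k + 1) → Fin n) (i : Fin k) : Prop :=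
  x (π.1 i).succ = x i.castSucc

/-- The increments strictly inside the block telescope, and since the two steps of the block are
opposite, their sum is exactly the displacement between the two positions. -/
theorem samePosition_iff {k n : ℕ} {π : PairPartition k} {x : Fin (k + 1) → Fin n}
    (hx : x ∈ gridSolutions π n) {i : Fin k} (hi : i < π.1 i) :
    SamePosition π x i ↔ ∑ l, (if i < l ∧ l < π.1 i then increment x l else 0) = 0 := by
  rw [sum_increment_between x hi, SamePosition, Fin.ext_iff]
  have := mem_gridSolutions.1 hx i
  simp only [increment] at this
  omega

theorem samePosition_of_isClosedBlock {k n : ℕ} {π : PairPartition k} {x : Fin (k + 1) → Fin n}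
    (hx : x ∈ gridSolutions π n) {i : Fin k} (hi : i < π.1 i) (h : IsClosedBlock π i) :
    SamePosition π x i := by
  rw [samePosition_iff hx hi, ← Finset.sum_filter]
  refine sum_pair_eq_zero π _ (fun l hl => ?_) _ fun l _ => mem_gridSolutions.1 hx l
  simp only [Finset.mem_filter, Finset.mem_univ, true_and] at hl ⊢
  exact h l hl.1 hl.2

open scoped Classical in
-- Some step l inside the block has its partner outside, so the vanishing of the inner increment sum
-- involves l without its partner and is not a consequence of the pairing.
theorem negligible_samePosition {k : ℕ} (π : PairPartition k) (i : Fin k) (hi : i < π.1 i)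
    (h : ¬ IsClosedBlock π i) :
    Negligible k fun n => (gridSolutions π n).filter fun x => SamePosition π x i := by
  simp only [IsClosedBlock, not_forall] at h
  obtain ⟨l, h1, h2, h3⟩ := h
  refine negligible_of_pairing_of_relation π (fun _ => -1)
    (fun m => if i < m ∧ m < π.1 i then 1 else 0) l ?_ ?_ ?_
  · rw [if_pos ⟨h1, h2⟩, if_neg h3]
    norm_num
  · intro n x hx j
    have := mem_gridSolutions.1 (Finset.mem_filter.1 hx).1 j
    linarith
  · intro n x hx
    have hx' := Finset.mem_filter.1 hx
    refine Eq.trans (Finset.sum_congr rfl fun m _ => ?_) ((samePosition_iff hx'.1 hi).1 hx'.2)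
    split_ifs <;> simp

open scoped Classical in
-- Two different blocks on one diagonal satisfy increment i = ± increment j, a relation that the
-- pairing does not imply.
theorem negligible_gridSolutions_not_hasPattern {k : ℕ} (π : PairPartition k) :
    Negligible k fun n => (gridSolutions π n).filter fun x => ¬ HasPattern π x := by
  have key : ∀ p ∈ (Finset.univ : Finset (Fin k × Fin k × ℤˣ)), Negligible k fun n =>
      (gridSolutions π n).filter fun x => p.2.1 ≠ p.1 ∧ p.2.1 ≠ π.1 p.1 ∧
        increment x p.1 = p.2.2 * increment x p.2.1 := by
    rintro ⟨i, j, s⟩ -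
    by_cases hij : j ≠ i ∧ j ≠ π.1 i
    · refine negligible_of_pairing_of_relation π (fun _ => -1)
        (fun m => (if m = i then 1 else 0) - if m = j then (s : ℤ) else 0) i ?_ ?_ ?_
      · simp [hij.1.symm, hij.2.symm, (π.2 i).1]
      · intro n x hx m
        have := mem_gridSolutions.1 (Finset.mem_filter.1 hx).1 m
        linarith
      · intro n x hx
        have := (Finset.mem_filter.1 hx).2.2.2
        simp only [sub_mul, ite_mul, one_mul, zero_mul, Finset.sum_sub_distrib,
          Finset.sum_ite_eq', Finset.mem_univ, if_true]
        rw [this, sub_self]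
    · exact negligible_of_forall_notMem fun n x hx => absurd (Finset.mem_filter.1 hx).2 fun hx => hij ⟨hx.1, hx.2.1⟩
  refine (Negligible.biUnion _ key).mono fun n x hx => ?_
  obtain ⟨hx1, hx2⟩ := Finset.mem_filter.1 hx
  simp only [HasPattern, not_forall] at hx2
  obtain ⟨i, j, hij⟩ := hx2
  have hback : j = i ∨ j = π.1 i → (increment x i).natAbs = (increment x j).natAbs := by
    rintro (rfl | rfl)
    · rfl
    · have := mem_gridSolutions.1 hx1 i
      omega
  have h1 : (increment x i).natAbs = (increment x j).natAbs := by
    by_contra hne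
    exact hij ⟨fun h => absurd h hne, hback⟩
  have h2 : ¬ (j = i ∨ j = π.1 i) := fun h => hij ⟨fun _ => h, fun _ => h1⟩
  push Not at h2
  rcases Int.natAbs_eq_natAbs_iff.1 h1 with h | h
  · exact Finset.mem_biUnion.2 ⟨(i, j, 1), Finset.mem_univ _,
      Finset.mem_filter.2 ⟨hx1, h2.1, h2.2, by simpa using h⟩⟩
  · exact Finset.mem_biUnion.2 ⟨(i, j, -1), Finset.mem_univ _,
      Finset.mem_filter.2 ⟨hx1, h2.1, h2.2, by simpa using h⟩⟩

open scoped Classical in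
-- Some block has equal increments instead of opposite ones. It then enters the sum of all
-- increments with coefficient 2, and closedness becomes a nontrivial relation.
theorem negligible_hasPattern_not_gridSolutions {k : ℕ} (π : PairPartition k) :
    Negligible k fun n => (closedPaths k n).filter fun x =>
      HasPattern π x ∧ x ∉ gridSolutions π n := by
  have key : ∀ p ∈ (Finset.univ : Finset ((Fin k → ℤˣ) × Fin k)), Negligible k fun n =>
      (closedPaths k n).filter fun x => p.1 p.2 = 1 ∧
        ∀ i, increment x (π.1 i) = p.1 i * increment x i := by
    rintro ⟨σ, i⟩ -
    by_cases hσ : σ i = 1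
    · refine negligible_of_pairing_of_relation π (fun i => σ i) (fun _ => 1) i ?_ ?_ ?_
      · simp [hσ]
      · exact fun n x hx => (Finset.mem_filter.1 hx).2.2
      · intro n x hx
        have := mem_closedPaths.1 (Finset.mem_filter.1 hx).1
        simp [sum_increment, this]
    · exact negligible_of_forall_notMem fun n x hx => absurd (Finset.mem_filter.1 hx).2 fun hx => hσ hx.1
  refine (Negligible.biUnion _ key).mono fun n x hx => ?_
  obtain ⟨hx1, hx2, hx3⟩ := Finset.mem_filter.1 hx
  have h : ∀ i, ∃ s : ℤˣ, increment x (π.1 i) = s * increment x i ∧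
      (increment x i + increment x (π.1 i) ≠ 0 → s = 1) := by
    intro i
    rcases Int.natAbs_eq_natAbs_iff.1 ((hx2 i (π.1 i)).2 (Or.inr rfl)) with h | h
    · exact ⟨1, by simp [h], fun _ => rfl⟩
    · exact ⟨-1, by simp [h], fun h' => absurd (by rw [h]; ring) h'⟩
  choose σ h1 h2 using h
  rw [mem_gridSolutions] at hx3
  push Not at hx3
  obtain ⟨i, hi⟩ := hx3
  exact Finset.mem_biUnion.2 ⟨(σ, i), Finset.mem_univ _,
    Finset.mem_filter.2 ⟨hx1, h2 i hi, h1⟩⟩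

open scoped Classical in
/-- Paths which use no diagonal only once, and some diagonal more than twice. -/
theorem negligible_not_hasPattern (k : ℕ) :
    Negligible k fun n => Finset.univ.filter fun x : Fin (k + 1) → Fin n =>
      (∀ i, ∃ j, j ≠ i ∧ (increment x j).natAbs = (increment x i).natAbs) ∧
        ∀ π : PairPartition k, ¬ HasPattern π x := by
  have key : ∀ p ∈ (Finset.univ : Finset ((Fin k → Fin k) × (Fin k → ℤˣ))), Negligible k fun n =>
      Finset.univ.filter fun x : Fin (k + 1) → Fin n =>
        2 * (Finset.univ.image p.1).card + 1 ≤ k ∧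
        ∀ i, increment x i = p.2 i * increment x (p.1 i) := by
    rintro ⟨f, σ⟩ -
    by_cases hf : 2 * (Finset.univ.image f).card + 1 ≤ k
    · refine negligible_of_determined (Finset.univ.image f) hf fun n x hx y hy h e => ?_
      have h1 := (Finset.mem_filter.1 hx).2.2 e
      have h2 := (Finset.mem_filter.1 hy).2.2 e
      simp only at h1 h2
      rw [h1, h2, h (f e) (Finset.mem_image_of_mem f (Finset.mem_univ e))]
    · exact negligible_of_forall_notMem fun n x hx => absurd (Finset.mem_filter.1 hx).2 fun hx => hf hx.1
  refine (Negligible.biUnion _ key).mono fun n x hx => ?_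
  obtain ⟨-, hx1, hx2⟩ := Finset.mem_filter.1 hx
  obtain ⟨f, σ, h1, h2, h3⟩ := exists_representative_sign (increment x)
  refine Finset.mem_biUnion.2 ⟨(f, σ), Finset.mem_univ _,
    Finset.mem_filter.2 ⟨Finset.mem_univ _, ?_, h1⟩⟩
  have hf2 : ∀ e, ∃ e', e' ≠ e ∧ f e' = f e := fun e => by
    obtain ⟨e', h, h'⟩ := hx1 e
    exact ⟨e', h, (h2 _ _).1 h'⟩
  have hle := two_mul_card_image_le hf2
  have hsum := sum_card_fiber_sub_two hf2
  rw [Fintype.card_fin] at hle hsum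
  -- Otherwise there are exactly k/2 classes, the excess of the class sizes over two vanishes, and
  -- the classes are the blocks of a pair partition whose pattern is that of x.
  by_contra hcon
  have hzero : ∑ b ∈ Finset.univ.image f,
      ((Finset.univ.filter fun e => f e = b).card - 2) = 0 := by
    simp only at hcon; omega
  rw [Finset.sum_eq_zero_iff] at hzero
  have htwo : ∀ e, (Finset.univ.filter fun e' => f e' = f e).card = 2 := fun e => by
    have ha := hzero (f e) (Finset.mem_image_of_mem f (Finset.mem_univ e))
    have hb := two_le_card_fiber hf2 (Finset.mem_image_of_mem f (Finset.mem_univ e))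
    omega
  have hpart : ∀ e, ∃ e', e' ≠ e ∧ ∀ j, f e = f j ↔ j = e ∨ j = e' := by
    intro e
    obtain ⟨a, b, hab, hs⟩ := Finset.card_eq_two.1 (htwo e)
    have hj : ∀ j, f e = f j ↔ j = a ∨ j = b := fun j => by
      have : j ∈ Finset.univ.filter (fun e' => f e' = f e) ↔ j ∈ ({a, b} : Finset (Fin k)) := by
        rw [hs]
      simpa [eq_comm] using this
    rcases (hj e).1 rfl with rfl | rfl
    · exact ⟨b, hab.symm, hj⟩
    · exact ⟨a, hab, fun j => (hj j).trans or_comm⟩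
  choose π hπ1 hπ2 using hpart
  have hinv : ∀ i, π (π i) = i := fun i => by
    have hi : f i = f (π i) := (hπ2 i (π i)).2 (Or.inr rfl)
    have h4 : f i = f (π (π i)) := hi.trans ((hπ2 (π i) (π (π i))).2 (Or.inr rfl))
    exact ((hπ2 i _).1 h4).resolve_right (hπ1 (π i))
  exact hx2 ⟨π, fun i => ⟨hπ1 i, hinv i⟩⟩ fun i j => (h2 i j).trans (hπ2 i j)

/-! ### Path weights and independence of the diagonals. -/

section Weights

variable {Ω : Type*}

/-- The symmetrised entry at position `(p, q)`. -/
def entry {n : ℕ} (b : Fin n → Fin n → Ω → ℝ) (p q : Fin n) (ω : Ω) : ℝ :=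
  b (min p q) (max p q) ω

theorem entry_comm {n : ℕ} (b : Fin n → Fin n → Ω → ℝ) (p q : Fin n) :
    entry b p q = entry b q p := by
  funext ω
  simp only [entry, min_comm, max_comm]

/-- The entry used by step `i` of the path `x`. -/
def stepEntry {k n : ℕ} (b : Fin n → Fin n → Ω → ℝ) (x : Fin (k + 1) → Fin n) (i : Fin k) :
    Ω → ℝ :=
  entry b (x i.castSucc) (x i.succ)

/-- The product of the entries along a path. -/
def pathWeight {k n : ℕ} (b : Fin n → Fin n → Ω → ℝ) (x : Fin (k + 1) → Fin n) (ω : Ω) : ℝ :=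
  ∏ i, stepEntry b x i ω

/-- The σ-algebra generated by the diagonals with index in `S`. -/
@[reducible] def diagSigma {n : ℕ} (b : Fin n → Fin n → Ω → ℝ) (S : Set ℕ) : MeasurableSpace Ω :=
  ⨆ r ∈ {r : Fin n | (r : ℕ) ∈ S}, MeasurableSpace.comap
    (fun ω (z : {z : Fin n × Fin n // (z.1 : ℕ) + r = z.2}) => b z.1.1 z.1.2 ω)
    MeasurableSpace.pi

theorem measurable_entry_diagSigma {n : ℕ} (b : Fin n → Fin n → Ω → ℝ) {S : Set ℕ} {p q : Fin n}
    (h : ((q : ℤ) - (p : ℤ)).natAbs ∈ S) : Measurable[diagSigma b S] (entry b p q) := by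
  have hp := p.2
  have hq := q.2
  have hr : ((q : ℤ) - (p : ℤ)).natAbs < n := by omega
  set r : Fin n := ⟨((q : ℤ) - (p : ℤ)).natAbs, hr⟩ with hr_def
  have hz : ((min p q : Fin n) : ℕ) + (r : ℕ) = ((max p q : Fin n) : ℕ) := by
    simp only [hr_def]
    rcases le_total p q with h | h
    · rw [min_eq_left h, max_eq_right h]
      have : (p : ℕ) ≤ q := h
      omega
    · rw [min_eq_right h, max_eq_left h]
      have : (q : ℕ) ≤ p := h
      omega
  refine Measurable.mono (ma := MeasurableSpace.comap
    (fun ω (z : {z : Fin n × Fin n // (z.1 : ℕ) + r = z.2}) => b z.1.1 z.1.2 ω)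
    MeasurableSpace.pi) ?_ ?_ le_rfl
  · exact Measurable.comp (g := fun y : {z : Fin n × Fin n // (z.1 : ℕ) + r = z.2} → ℝ =>
      y ⟨(min p q, max p q), hz⟩) (measurable_pi_apply _) (comap_measurable _)
  · exact le_iSup₂_of_le r h le_rfl

theorem measurable_stepEntry_diagSigma {k n : ℕ} (b : Fin n → Fin n → Ω → ℝ) {S : Set ℕ}
    {x : Fin (k + 1) → Fin n} {i : Fin k} (h : (increment x i).natAbs ∈ S) :
    Measurable[diagSigma b S] (stepEntry b x i) :=
  measurable_entry_diagSigma b h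

theorem measurable_stepEntry_mul_diagSigma {k n : ℕ} (b : Fin n → Fin n → Ω → ℝ) {S : Set ℕ}
    {x : Fin (k + 1) → Fin n} {i j : Fin k} (hi : (increment x i).natAbs ∈ S)
    (hj : (increment x j).natAbs ∈ S) :
    Measurable[diagSigma b S] fun ω => stepEntry b x i ω * stepEntry b x j ω :=
  (measurable_stepEntry_diagSigma b hi).mul (measurable_stepEntry_diagSigma b hj)

theorem measurable_prod_stepEntry_diagSigma {k n : ℕ} (b : Fin n → Fin n → Ω → ℝ) {S : Set ℕ}
    {x : Fin (k + 1) → Fin n} (s : Finset (Fin k)) (h : ∀ i ∈ s, (increment x i).natAbs ∈ S) :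
    Measurable[diagSigma b S] fun ω => ∏ i ∈ s, stepEntry b x i ω :=
  @Finset.measurable_fun_prod _ _ _ _ _ _ (diagSigma b S) _ s
    fun i hi => measurable_stepEntry_diagSigma b (h i hi)

theorem measurable_pathWeight_diagSigma {k n : ℕ} (b : Fin n → Fin n → Ω → ℝ) {S : Set ℕ}
    {x : Fin (k + 1) → Fin n} (h : ∀ i, (increment x i).natAbs ∈ S) :
    Measurable[diagSigma b S] (pathWeight b x) :=
  measurable_prod_stepEntry_diagSigma b Finset.univ fun i _ => h i

end Weights

/-- A product is at most the corresponding power of its largest factor; the summand 1 is needed only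
for the empty product. This replaces Hölder's inequality in the moment bounds. -/
theorem abs_prod_le_one_add_sum {ι : Type*} (s : Finset ι) (y : ι → ℝ) :
    |∏ i ∈ s, y i| ≤ 1 + ∑ i ∈ s, |y i| ^ s.card := by
  rw [Finset.abs_prod]
  have hnn : 0 ≤ ∑ i ∈ s, |y i| ^ s.card := Finset.sum_nonneg fun i _ => by positivity
  rcases s.eq_empty_or_nonempty with rfl | hs
  · simp
  · obtain ⟨j, hj, hmax⟩ := s.exists_max_image (fun i => |y i|) hs
    have h1 : ∏ i ∈ s, |y i| ≤ |y j| ^ s.card := by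
      rw [← Finset.prod_const]
      exact Finset.prod_le_prod (fun i _ => abs_nonneg _) hmax
    have h2 : |y j| ^ s.card ≤ ∑ i ∈ s, |y i| ^ s.card :=
      Finset.single_le_sum (f := fun i => |y i| ^ s.card) (fun i _ => by positivity) hj
    linarith

namespace DiagonalEnsemble

variable {Ω : Type*} [mΩ : MeasurableSpace Ω] {P : Measure Ω}
  {a : (n : ℕ) → Fin n → Fin n → Ω → ℝ} {cn : ℕ → ℝ} {c : ℝ}

theorem measurable_entry (h : DiagonalEnsemble P a cn c) (n : ℕ) (p q : Fin n) :
    Measurable (entry (a n) p q) :=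
  h.measurable n _ _ min_le_max

theorem measurable_stepEntry (h : DiagonalEnsemble P a cn c) {k n : ℕ}
    (x : Fin (k + 1) → Fin n) (i : Fin k) : Measurable (stepEntry (a n) x i) :=
  h.measurable_entry n _ _

theorem measurable_pathWeight (h : DiagonalEnsemble P a cn c) {k n : ℕ}
    (x : Fin (k + 1) → Fin n) : Measurable (pathWeight (a n) x) :=
  Finset.measurable_fun_prod _ fun i _ => h.measurable_stepEntry x i

theorem comap_diagonal_le (h : DiagonalEnsemble P a cn c) (n : ℕ) (r : Fin n) :
    MeasurableSpace.comap
      (fun ω (z : {z : Fin n × Fin n // (z.1 : ℕ) + r = z.2}) => a n z.1.1 z.1.2 ω)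
      MeasurableSpace.pi ≤ mΩ := by
  refine Measurable.comap_le (measurable_pi_lambda _ fun z => h.measurable n _ _ ?_)
  have := z.2
  exact Fin.le_def.2 (by omega)

theorem diagSigma_le (h : DiagonalEnsemble P a cn c) (n : ℕ) (S : Set ℕ) :
    diagSigma (a n) S ≤ mΩ :=
  iSup₂_le fun r _ => h.comap_diagonal_le n r

theorem integral_stepEntry (h : DiagonalEnsemble P a cn c) {k n : ℕ}
    (x : Fin (k + 1) → Fin n) (i : Fin k) : ∫ ω, stepEntry (a n) x i ω ∂P = 0 :=
  h.mean_zero n _ _ min_le_max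

theorem memLp_entry (h : DiagonalEnsemble P a cn c) (n : ℕ) (p q : Fin n) (hpq : p ≤ q) :
    MemLp (a n p q) 2 P := by
  obtain ⟨M, hM⟩ := h.moments 2
  rw [memLp_two_iff_integrable_sq (h.measurable n p q hpq).aestronglyMeasurable]
  simpa using (hM n p q hpq).1

theorem indep_diagSigma (h : DiagonalEnsemble P a cn c) (n : ℕ) {S T : Set ℕ}
    (hST : Disjoint S T) : Indep (diagSigma (a n) S) (diagSigma (a n) T) P := by
  refine indep_iSup_of_disjoint (h.comap_diagonal_le n) (h.indep n) ?_
  exact Set.disjoint_left.2 fun r hr hr' => Set.disjoint_left.1 hST hr hr'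

/-- The form in which independence is used: expectations factorise over disjoint sets of diagonals,
without integrability hypotheses. -/
theorem integral_mul_of_disjoint (h : DiagonalEnsemble P a cn c) (n : ℕ) {S T : Set ℕ}
    (hST : Disjoint S T) {f g : Ω → ℝ} (hf : Measurable[diagSigma (a n) S] f)
    (hg : Measurable[diagSigma (a n) T] g) :
    ∫ ω, f ω * g ω ∂P = (∫ ω, f ω ∂P) * ∫ ω, g ω ∂P := by
  have hind : IndepFun f g P :=
    indep_of_indep_of_le_left (indep_of_indep_of_le_right (h.indep_diagSigma n hST)
      hg.comap_le) hf.comap_le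
  exact hind.integral_fun_mul_eq_mul_integral
    (hf.mono (h.diagSigma_le n S) le_rfl).aestronglyMeasurable
    (hg.mono (h.diagSigma_le n T) le_rfl).aestronglyMeasurable

/-- A diagonal visited only once makes the expectation vanish. -/
theorem integral_pathWeight_eq_zero (h : DiagonalEnsemble P a cn c) {k n : ℕ}
    (x : Fin (k + 1) → Fin n) (i : Fin k)
    (hi : ∀ j, j ≠ i → (increment x j).natAbs ≠ (increment x i).natAbs) :
    ∫ ω, pathWeight (a n) x ω ∂P = 0 := by
  have : ∀ ω, pathWeight (a n) x ω =
      stepEntry (a n) x i ω * ∏ j ∈ Finset.univ.erase i, stepEntry (a n) x j ω := fun ω =>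
    (Finset.mul_prod_erase _ _ (Finset.mem_univ i)).symm
  simp only [this]
  rw [h.integral_mul_of_disjoint n (S := {(increment x i).natAbs})
    (T := {(increment x i).natAbs}ᶜ) disjoint_compl_right
    (measurable_stepEntry_diagSigma _ rfl)
    (measurable_prod_stepEntry_diagSigma _ _ fun j hj => hi j (Finset.ne_of_mem_erase hj)),
    h.integral_stepEntry, zero_mul]

variable [IsProbabilityMeasure P]

theorem exists_moment_pathWeight_le (h : DiagonalEnsemble P a cn c) (k j : ℕ) :
    ∃ C : ℝ, ∀ n, ∀ x : Fin (k + 1) → Fin n,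
      Integrable (fun ω => |pathWeight (a n) x ω| ^ j) P ∧
        ∫ ω, |pathWeight (a n) x ω| ^ j ∂P ≤ C := by
  obtain ⟨M, hM⟩ := h.moments (j * k)
  refine ⟨1 + k * M, fun n x => ?_⟩
  have hb : ∀ ω, |pathWeight (a n) x ω| ^ j ≤ 1 + ∑ i, |stepEntry (a n) x i ω| ^ (j * k) := by
    intro ω
    have := abs_prod_le_one_add_sum Finset.univ fun i => stepEntry (a n) x i ω ^ j
    simp only [Finset.prod_pow, abs_pow, Finset.card_univ, Fintype.card_fin, ← pow_mul] at this
    exact this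
  have hi : ∀ i, Integrable (fun ω => |stepEntry (a n) x i ω| ^ (j * k)) P :=
    fun i => (hM n _ _ min_le_max).1
  have hI : Integrable (fun ω => 1 + ∑ i, |stepEntry (a n) x i ω| ^ (j * k)) P :=
    (integrable_const 1).add (integrable_finsetSum _ fun i _ => hi i)
  have hint : Integrable (fun ω => |pathWeight (a n) x ω| ^ j) P := by
    refine hI.mono' ?_ (ae_of_all _ fun ω => ?_)
    · have := h.measurable_pathWeight x
      exact (by fun_prop : Measurable fun ω => |pathWeight (a n) x ω| ^ j).aestronglyMeasurable
    · rw [Real.norm_of_nonneg (by positivity)]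
      exact hb ω
  refine ⟨hint, (integral_mono hint hI hb).trans ?_⟩
  rw [integral_add (integrable_const 1) (integrable_finsetSum _ fun i _ => hi i),
    integral_finsetSum _ fun i _ => hi i]
  have : ∑ i, ∫ ω, |stepEntry (a n) x i ω| ^ (j * k) ∂P ≤ ∑ _i : Fin k, M :=
    Finset.sum_le_sum fun i _ => (hM n _ _ min_le_max).2
  simpa using this

theorem integrable_pathWeight (h : DiagonalEnsemble P a cn c) {k n : ℕ}
    (x : Fin (k + 1) → Fin n) : Integrable (pathWeight (a n) x) P := by
  obtain ⟨C, hC⟩ := h.exists_moment_pathWeight_le k 1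
  have := (hC n x).1
  simp only [pow_one] at this
  exact (integrable_norm_iff (h.measurable_pathWeight x).aestronglyMeasurable).1 this

theorem exists_abs_integral_pathWeight_le (h : DiagonalEnsemble P a cn c) (k : ℕ) :
    ∃ C : ℝ, ∀ n, ∀ x : Fin (k + 1) → Fin n, |∫ ω, pathWeight (a n) x ω ∂P| ≤ C := by
  obtain ⟨C, hC⟩ := h.exists_moment_pathWeight_le k 1
  refine ⟨C, fun n x => (abs_integral_le_integral_abs).trans ?_⟩
  simpa using (hC n x).2

theorem integral_mul_eq_cov (h : DiagonalEnsemble P a cn c) {n r : ℕ} {p q p' q' : Fin n}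
    (hpq : (p : ℕ) + r = q) (hpq' : (p' : ℕ) + r = q') (hne : p ≠ p') :
    ∫ ω, a n p q ω * a n p' q' ω ∂P = cn n := by
  have hle : p ≤ q := Fin.le_def.2 (by omega)
  have hle' : p' ≤ q' := Fin.le_def.2 (by omega)
  have := h.cov_eq n r p q p' q' hpq hpq' hne
  rw [covariance_eq_sub (h.memLp_entry n p q hle) (h.memLp_entry n p' q' hle'),
    h.mean_zero n p q hle, zero_mul, sub_zero] at this
  exact this

open scoped Classical in
-- Opposite increments put both steps on the same diagonal: they use either the same matrix entry,
-- giving the variance, or two distinct ones, giving the covariance.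
theorem integral_stepEntry_mul (h : DiagonalEnsemble P a cn c) {k n : ℕ} {π : PairPartition k}
    {x : Fin (k + 1) → Fin n} (hx : x ∈ gridSolutions π n) (i : Fin k) :
    ∫ ω, stepEntry (a n) x i ω * stepEntry (a n) x (π.1 i) ω ∂P =
      if SamePosition π x i then 1 else cn n := by
  have hd := mem_gridSolutions.1 hx i
  simp only [increment] at hd
  split_ifs with hs
  · have h1 : x (π.1 i).castSucc = x i.succ := by
      have h2 := Fin.ext_iff.1 hs
      exact Fin.ext (by omega)
    have h3 : stepEntry (a n) x (π.1 i) = stepEntry (a n) x i := by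
      rw [stepEntry, stepEntry, h1, hs, entry_comm]
    simp only [h3, ← sq]
    exact h.variance_one n _ _ min_le_max
  · have hne : ((x (π.1 i).succ : ℕ)) ≠ x i.castSucc := fun h => hs (Fin.ext h)
    refine h.integral_mul_eq_cov
      (r := ((x i.succ : ℤ) - (x i.castSucc : ℤ)).natAbs) ?_ ?_ ?_
    · rcases le_total (x i.castSucc) (x i.succ) with h | h
      · rw [min_eq_left h, max_eq_right h]
        have := Fin.le_def.1 h
        omega
      · rw [min_eq_right h, max_eq_left h]
        have := Fin.le_def.1 h
        omega
    · rcases le_total (x (π.1 i).castSucc) (x (π.1 i).succ) with h | h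
      · rw [min_eq_left h, max_eq_right h]
        have := Fin.le_def.1 h
        omega
      · rw [min_eq_right h, max_eq_left h]
        have := Fin.le_def.1 h
        omega
    · rw [Ne, Fin.ext_iff]
      rcases le_total (x i.castSucc) (x i.succ) with h | h <;>
        rcases le_total (x (π.1 i).castSucc) (x (π.1 i).succ) with h' | h' <;>
        simp only [min_eq_left, min_eq_right, h, h'] <;>
        have h1 := Fin.le_def.1 h <;> have h2 := Fin.le_def.1 h' <;> omega

/-- Every block has a diagonal of its own, so the blocks are split off one after another by
independence. -/
theorem integral_pathWeight_of_hasPattern (h : DiagonalEnsemble P a cn c) {k n : ℕ}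
    {π : PairPartition k} {x : Fin (k + 1) → Fin n} (hx : HasPattern π x) :
    ∫ ω, pathWeight (a n) x ω ∂P =
      ∏ i ∈ openers π, ∫ ω, stepEntry (a n) x i ω * stepEntry (a n) x (π.1 i) ω ∂P := by
  classical
  have hprod : ∀ ω, pathWeight (a n) x ω =
      ∏ i ∈ openers π, stepEntry (a n) x i ω * stepEntry (a n) x (π.1 i) ω := by
    intro ω
    rw [pathWeight, ← Finset.prod_mul_prod_compl (openers π), Finset.prod_mul_distrib]
    congr 1
    symm
    refine Finset.prod_bij (fun i _ => π.1 i) ?_ ?_ ?_ fun i _ => rfl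
    · intro i hi
      rw [mem_openers] at hi
      rw [Finset.mem_compl, mem_openers, (π.2 i).2, not_lt]
      exact hi.le
    · intro i _ j _ hij
      rw [← (π.2 i).2, hij, (π.2 j).2]
    · intro j hj
      rw [Finset.mem_compl, mem_openers, not_lt] at hj
      refine ⟨π.1 j, ?_, (π.2 j).2⟩
      rw [mem_openers, (π.2 j).2]
      exact lt_of_le_of_ne hj (π.2 j).1
  simp only [hprod]
  suffices H : ∀ s : Finset (Fin k), s ⊆ openers π →
      ∫ ω, ∏ i ∈ s, stepEntry (a n) x i ω * stepEntry (a n) x (π.1 i) ω ∂P =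
      ∏ i ∈ s, ∫ ω, stepEntry (a n) x i ω * stepEntry (a n) x (π.1 i) ω ∂P from H _ subset_rfl
  intro s
  induction s using Finset.induction with
  | empty => intro _; simp
  | insert i s his ih =>
    intro hs
    have hi := mem_openers.1 (hs (Finset.mem_insert_self i s))
    simp only [Finset.prod_insert his]
    have hpair : ∀ j, (increment x (π.1 j)).natAbs = (increment x j).natAbs := fun j =>
      ((hx j (π.1 j)).2 (Or.inr rfl)).symm
    rw [← ih ((Finset.subset_insert i s).trans hs)]
    refine h.integral_mul_of_disjoint n (S := {(increment x i).natAbs})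
      (T := {(increment x i).natAbs}ᶜ) disjoint_compl_right ?_ ?_
    · exact measurable_stepEntry_mul_diagSigma _ rfl (hpair i)
    · refine @Finset.measurable_fun_prod _ _ _ _ _ _
        (diagSigma (a n) {(increment x i).natAbs}ᶜ) _ s fun j hj => ?_
      have hj' := mem_openers.1 (hs (Finset.mem_insert_of_mem hj))
      have hne : (increment x j).natAbs ∈ ({(increment x i).natAbs}ᶜ : Set ℕ) := by
        intro heq
        -- A common diagonal would make i equal to j or to the partner of j; the latter is
        -- impossible since both are openers.
        rcases (hx j i).1 heq with h1 | h1
        · exact his (h1 ▸ hj)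
        · rw [h1, (π.2 j).2] at hi
          exact absurd hi (not_lt.2 hj'.le)
      exact measurable_stepEntry_mul_diagSigma _ hne (by rw [hpair]; exact hne)

end DiagonalEnsemble

/-! ### Convergence of the expected moments. -/

theorem Negligible.tendsto {k : ℕ} {X : (n : ℕ) → Finset (Fin (k + 1) → Fin n)}
    (hX : Negligible k X) :
    Tendsto (fun n => ((X n).card : ℝ) / (n * √n ^ k)) atTop (𝓝 0) := by
  obtain ⟨C, hC⟩ := hX
  have h0 : Tendsto (fun n : ℕ => C / √n) atTop (𝓝 0) :=
    tendsto_const_nhds.div_atTop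
      ((Real.tendsto_sqrt_atTop).comp tendsto_natCast_atTop_atTop)
  refine tendsto_of_tendsto_of_tendsto_of_le_of_le' tendsto_const_nhds h0
    (Eventually.of_forall fun n => by positivity) ?_
  filter_upwards [eventually_ge_atTop 1] with n hn
  have hn' : (0 : ℝ) < n := by exact_mod_cast hn
  have hs : 0 < √(n : ℝ) := Real.sqrt_pos.2 hn'
  rw [div_le_div_iff₀ (by positivity) hs]
  exact hC n

/-- The limiting moments. -/
noncomputable def limitMoment (c : ℝ) (k : ℕ) : ℝ :=
  ∑ π : PairPartition k, toeplitzVolume π * c ^ (k / 2 - height π)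

theorem card_openers {k : ℕ} (π : PairPartition k) : (openers π).card = k / 2 := by
  have := two_mul_card_openers π
  omega

theorem isEmpty_pairPartition_of_odd (m : ℕ) : IsEmpty (PairPartition (2 * m + 1)) :=
  ⟨fun π => by have := two_mul_card_openers π; omega⟩

theorem limitMoment_odd (c : ℝ) (m : ℕ) : limitMoment c (2 * m + 1) = 0 := by
  have := isEmpty_pairPartition_of_odd m
  simp [limitMoment]

theorem limitMoment_even (c : ℝ) (m : ℕ) :
    limitMoment c (2 * m) =
      ∑ π : PairPartition (2 * m), toeplitzVolume π * c ^ (m - height π) := by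
  simp [limitMoment]

open scoped Classical in
theorem height_eq_card {k : ℕ} (π : PairPartition k) :
    height π = ((openers π).filter fun i => IsClosedBlock π i).card := by
  refine congrArg Finset.card (Finset.ext fun i => ?_)
  rw [Finset.mem_filter, Finset.mem_filter, mem_openers]
  exact ⟨fun h => h.2, fun h => ⟨Finset.mem_univ _, h⟩⟩

open scoped Classical in
theorem card_not_isClosedBlock {k : ℕ} (π : PairPartition k) :
    ((openers π).filter fun i => ¬ IsClosedBlock π i).card = k / 2 - height π := by
  have := Finset.card_filter_add_card_filter_not (s := openers π) (fun i => IsClosedBlock π i)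
  rw [height_eq_card, ← card_openers π]
  omega

open scoped Classical in
/-- The solutions of the Toeplitz system without accidental coincidences. -/
noncomputable def genericSolutions {k : ℕ} (π : PairPartition k) (n : ℕ) :
    Finset (Fin (k + 1) → Fin n) :=
  (gridSolutions π n).filter fun x =>
    HasPattern π x ∧ ∀ i ∈ openers π, SamePosition π x i → IsClosedBlock π i

theorem genericSolutions_subset {k : ℕ} (π : PairPartition k) (n : ℕ) :
    genericSolutions π n ⊆ gridSolutions π n := by
  classical exact Finset.filter_subset _ _

theorem negligible_gridSolutions_sdiff {k : ℕ} (π : PairPartition k) :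
    Negligible k fun n => gridSolutions π n \ genericSolutions π n := by
  classical
  have h1 := Negligible.biUnion ((openers π).filter fun i => ¬ IsClosedBlock π i)
    (X := fun i n => (gridSolutions π n).filter fun x => SamePosition π x i) fun i hi =>
      negligible_samePosition π i (mem_openers.1 (Finset.mem_filter.1 hi).1)
        (Finset.mem_filter.1 hi).2
  refine ((negligible_gridSolutions_not_hasPattern π).union h1).mono fun n x hx => ?_
  simp only [genericSolutions, Finset.mem_sdiff, Finset.mem_filter, not_and, not_forall] at hx
  obtain ⟨hx1, hx2⟩ := hx
  by_cases hp : HasPattern π x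
  · obtain ⟨i, hi, hs, hc⟩ := hx2 hx1 hp
    exact Finset.mem_union_right _ (Finset.mem_biUnion.2
      ⟨i, Finset.mem_filter.2 ⟨hi, hc⟩, Finset.mem_filter.2 ⟨hx1, hs⟩⟩)
  · exact Finset.mem_union_left _ (Finset.mem_filter.2 ⟨hx1, hp⟩)

/-- Discarding negligible families does not change the lattice point asymptotics, and n raised to
the number k/2 + 1 of free variables is n·√n^k. -/
theorem tendsto_card_genericSolutions {k : ℕ} (π : PairPartition k) :
    Tendsto (fun n : ℕ => ((genericSolutions π n).card : ℝ) / (n * √n ^ k)) atTop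
      (𝓝 (toeplitzVolume π)) := by
  classical
  have h1 := tendsto_card_gridSolutions π
  have h2 := h1.sub (negligible_gridSolutions_sdiff π).tendsto
  rw [sub_zero] at h2
  refine h2.congr fun n => ?_
  have h3 : (n : ℝ) ^ (freeVars π).card = n * √n ^ k := by
    have h4 : √(n : ℝ) ^ k = (n : ℝ) ^ (openers π).card := by
      conv_lhs => rw [← two_mul_card_openers π, pow_mul, Real.sq_sqrt (Nat.cast_nonneg n)]
    rw [card_freeVars, h4, pow_succ, mul_comm]
  have h5 := Finset.card_sdiff_add_card_eq_card (genericSolutions_subset π n)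
  rw [h3, ← sub_div, ← h5]
  push_cast
  ring

theorem eq_of_hasPattern {k n : ℕ} {π ρ : PairPartition k} {x : Fin (k + 1) → Fin n}
    (hπ : HasPattern π x) (hρ : HasPattern ρ x) : π = ρ :=
  Subtype.ext (funext fun i => by
    have h := (hρ i (π.1 i)).1 ((hπ i (π.1 i)).2 (Or.inr rfl))
    exact h.resolve_left (π.2 i).1)

namespace DiagonalEnsemble

variable {Ω : Type*} [mΩ : MeasurableSpace Ω] {P : Measure Ω} [IsProbabilityMeasure P]
  {a : (n : ℕ) → Fin n → Fin n → Ω → ℝ} {cn : ℕ → ℝ} {c : ℝ}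

/-- For a generic path, "same position" and "closed block" coincide, so the k/2 - h(π) blocks that
are not closed contribute c_n each and the others 1. -/
theorem integral_pathWeight_of_mem_genericSolutions (h : DiagonalEnsemble P a cn c) {k n : ℕ}
    {π : PairPartition k} {x : Fin (k + 1) → Fin n} (hx : x ∈ genericSolutions π n) :
    ∫ ω, pathWeight (a n) x ω ∂P = cn n ^ (k / 2 - height π) := by
  classical
  obtain ⟨hx1, hx2, hx3⟩ := Finset.mem_filter.1 hx
  rw [h.integral_pathWeight_of_hasPattern hx2, ← card_not_isClosedBlock,
    ← Finset.prod_const, Finset.prod_filter]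
  refine Finset.prod_congr rfl fun i hi => ?_
  rw [h.integral_stepEntry_mul hx1]
  by_cases hc : IsClosedBlock π i
  · rw [if_pos (samePosition_of_isClosedBlock hx1 (mem_openers.1 hi) hc), if_neg (not_not.2 hc)]
  · rw [if_neg fun hs => hc (hx3 i hi hs), if_pos hc]

/-- Convergence of the expected moments. -/
theorem tendsto_sum_integral_pathWeight (h : DiagonalEnsemble P a cn c) (k : ℕ) :
    Tendsto (fun n : ℕ => (∑ x ∈ closedPaths k n, ∫ ω, pathWeight (a n) x ω ∂P) /
      (n * √n ^ k)) atTop (𝓝 (limitMoment c k)) := by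
  classical
  set G : (n : ℕ) → Finset (Fin (k + 1) → Fin n) := fun n =>
    Finset.univ.biUnion fun π : PairPartition k => genericSolutions π n with hG
  -- The nongeneric paths whose expectation may be nonzero. Each has no pair pattern at all, or a
  -- pattern without opposite increments, or solves the system with an accidental coincidence.
  set R : (n : ℕ) → Finset (Fin (k + 1) → Fin n) := fun n =>
    (closedPaths k n \ G n).filter fun x =>
      ∀ i, ∃ j, j ≠ i ∧ (increment x j).natAbs = (increment x i).natAbs with hR
  have hGsub : ∀ n, G n ⊆ closedPaths k n := fun n =>
    Finset.biUnion_subset.2 fun π _ =>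
      (genericSolutions_subset π n).trans (gridSolutions_subset_closedPaths π)
  have hRneg : Negligible k R := by
    have h1 := Negligible.biUnion (Finset.univ : Finset (PairPartition k))
      fun π _ => negligible_hasPattern_not_gridSolutions π
    have h2 := Negligible.biUnion (Finset.univ : Finset (PairPartition k))
      fun π _ => negligible_gridSolutions_sdiff π
    refine ((negligible_not_hasPattern k).union (h1.union h2)).mono fun n x hx => ?_
    obtain ⟨hx1, hx2⟩ := Finset.mem_filter.1 hx
    obtain ⟨hx3, hx4⟩ := Finset.mem_sdiff.1 hx1
    simp only [Finset.mem_union, Finset.mem_biUnion, Finset.mem_filter, Finset.mem_univ, true_and,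
      Finset.mem_sdiff]
    by_cases hp : ∃ π : PairPartition k, HasPattern π x
    · obtain ⟨π, hπ⟩ := hp
      right
      by_cases hg : x ∈ gridSolutions π n
      · exact Or.inr ⟨π, hg, fun hx5 => hx4 (Finset.mem_biUnion.2 ⟨π, Finset.mem_univ _, hx5⟩)⟩
      · exact Or.inl ⟨π, hx3, hπ, hg⟩
    · exact Or.inl ⟨hx2, not_exists.1 hp⟩
  have hsplit : ∀ n, ∑ x ∈ closedPaths k n, ∫ ω, pathWeight (a n) x ω ∂P =
      ∑ π : PairPartition k, ((genericSolutions π n).card : ℝ) * cn n ^ (k / 2 - height π) +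
        ∑ x ∈ R n, ∫ ω, pathWeight (a n) x ω ∂P := by
    intro n
    rw [← Finset.sum_sdiff (hGsub n), add_comm]
    congr 1
    · rw [hG, Finset.sum_biUnion]
      · refine Finset.sum_congr rfl fun π _ => ?_
        rw [Finset.sum_congr rfl fun x hx => h.integral_pathWeight_of_mem_genericSolutions hx,
          Finset.sum_const, nsmul_eq_mul]
      · intro π _ ρ _ hne
        refine Finset.disjoint_left.2 fun x hx hx' => hne ?_
        exact eq_of_hasPattern (Finset.mem_filter.1 hx).2.1 (Finset.mem_filter.1 hx').2.1
    · rw [hR, Finset.sum_filter_of_ne]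
      intro x _ hx i
      by_contra hcon
      push Not at hcon
      exact hx (h.integral_pathWeight_eq_zero x i hcon)
  have hmain : Tendsto (fun n : ℕ => ∑ π : PairPartition k,
      ((genericSolutions π n).card : ℝ) / (n * √n ^ k) * cn n ^ (k / 2 - height π)) atTop
      (𝓝 (limitMoment c k)) :=
    tendsto_finsetSum _ fun π _ =>
      (tendsto_card_genericSolutions π).mul (h.tendsto_cov.pow _)
  have hrest : Tendsto (fun n : ℕ => (∑ x ∈ R n, ∫ ω, pathWeight (a n) x ω ∂P) / (n * √n ^ k))
      atTop (𝓝 0) := by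
    obtain ⟨C, hC⟩ := h.exists_abs_integral_pathWeight_le k
    have h0 := hRneg.tendsto.mul_const C
    rw [zero_mul] at h0
    refine squeeze_zero_norm (fun n => ?_) h0
    rw [norm_div, Real.norm_of_nonneg (show (0 : ℝ) ≤ n * √n ^ k by positivity),
      div_mul_eq_mul_div]
    gcongr
    refine (norm_sum_le_of_le _ fun x _ => hC n x).trans (le_of_eq ?_)
    rw [Finset.sum_const, nsmul_eq_mul]
  have := hmain.add hrest
  rw [add_zero] at this
  refine this.congr fun n => ?_
  rw [hsplit, add_div, Finset.sum_div Finset.univ]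
  refine congrArg (· + _) (Finset.sum_congr rfl fun π _ => ?_)
  rw [div_mul_eq_mul_div]

end DiagonalEnsemble

/-! ### Linked quadruples of paths and the fourth central moment. -/

section LinkedPatterns

variable {k : ℕ} {f : Fin 4 × Fin k → Fin 4 × Fin k} {σ : Fin 4 × Fin k → ℤˣ}

/-- The number of steps of the path `p` in the class `b`. -/
def classCount (f : Fin 4 × Fin k → Fin 4 × Fin k) (b : Fin 4 × Fin k) (p : Fin 4) : ℕ :=
  (Finset.univ.filter fun i : Fin k => f (p, i) = b).card

theorem sum_classCount (f : Fin 4 × Fin k → Fin 4 × Fin k) (b : Fin 4 × Fin k) :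
    ∑ p, classCount f b p = (Finset.univ.filter fun e => f e = b).card := by
  simp only [classCount, Finset.card_filter, ← Finset.univ_product_univ, Finset.sum_product]

theorem classCount_pos {b : Fin 4 × Fin k} {p : Fin 4} {i : Fin k} (h : f (p, i) = b) :
    1 ≤ classCount f b p :=
  Finset.card_pos.2 ⟨i, by simp [h]⟩

theorem classCount_add_le (f : Fin 4 × Fin k → Fin 4 × Fin k) (b : Fin 4 × Fin k) {p q : Fin 4}
    (hpq : p ≠ q) :
    classCount f b p + classCount f b q ≤ (Finset.univ.filter fun e => f e = b).card := by
  rw [← sum_classCount, ← Finset.sum_pair hpq]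
  exact Finset.sum_le_sum_of_subset (Finset.subset_univ _)

theorem classCount_add_add_le (f : Fin 4 × Fin k → Fin 4 × Fin k) (b : Fin 4 × Fin k)
    {p q r : Fin 4} (hpq : p ≠ q) (hpr : p ≠ r) (hqr : q ≠ r) :
    classCount f b p + (classCount f b q + classCount f b r) ≤
      (Finset.univ.filter fun e => f e = b).card := by
  rw [← sum_classCount, ← Finset.sum_pair hqr, ← Finset.sum_insert (by simp [hpq, hpr])]
  exact Finset.sum_le_sum_of_subset (Finset.subset_univ _)

/-- A sum of an odd number of signs is odd. -/
theorem odd_sum_units {ι : Type*} (s : Finset ι) (τ : ι → ℤˣ) (hs : Odd s.card) :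
    ∑ i ∈ s, (τ i : ℤ) ≠ 0 := by
  have h1 : (2 : ℤ) ∣ ∑ i ∈ s, ((τ i : ℤ) - 1) := Finset.dvd_sum fun i _ => by
    rcases Int.units_eq_one_or (τ i) with h | h <;> rw [h] <;> decide
  rw [Finset.sum_sub_distrib, Finset.sum_const, nsmul_eq_mul, mul_one] at h1
  obtain ⟨m, hm⟩ := hs
  intro h0
  rw [h0, hm] at h1
  omega

/-- Closedness of a path determines the increment of a class with odd multiplicity. -/
theorem eq_zero_of_odd_classCount {δ : Fin 4 × Fin k → ℤ} (hδ : ∀ e, δ e = σ e * δ (f e))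
    {p : Fin 4} (hp : ∑ i, δ (p, i) = 0) {b : Fin 4 × Fin k} (hb : Odd (classCount f b p))
    (h0 : ∀ i, f (p, i) ≠ b → δ (f (p, i)) = 0) : δ b = 0 := by
  have h1 : ∑ i, δ (p, i) =
      (∑ i ∈ Finset.univ.filter fun i : Fin k => f (p, i) = b, (σ (p, i) : ℤ)) * δ b := by
    rw [Finset.sum_mul, Finset.sum_filter]
    refine Finset.sum_congr rfl fun i _ => ?_
    split_ifs with h
    · rw [hδ, h]
    · rw [hδ, h0 i h, mul_zero]
  rw [h1] at hp
  exact (mul_eq_zero.1 hp).resolve_left (odd_sum_units _ _ hb)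

/-- The 4k steps form at most 2k classes, since each class has at least two members; two fewer
determining increments are needed. Whatever the class count does not save is saved by closedness: a
path meeting a class an odd number of times determines the increment of that class from the others.
-/
theorem exists_determining_set (σ : Fin 4 × Fin k → ℤˣ)
    (h2 : ∀ e, ∃ e', e' ≠ e ∧ f e' = f e)
    (hlink : ∀ p, ∃ i q j, q ≠ p ∧ f (p, i) = f (q, j)) :
    ∃ T : Finset (Fin 4 × Fin k), T.card + 2 ≤ 2 * k ∧
      ∀ δ : Fin 4 × Fin k → ℤ, (∀ e, δ e = σ e * δ (f e)) → (∀ p, ∑ i, δ (p, i) = 0) →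
        (∀ e ∈ T, δ e = 0) → ∀ e, δ e = 0 := by
  classical
  set B := Finset.univ.image f with hB
  have hfB : ∀ e, f e ∈ B := fun e => Finset.mem_image_of_mem f (Finset.mem_univ e)
  have hle := two_mul_card_image_le h2
  have hex := sum_card_fiber_sub_two h2
  rw [Fintype.card_prod, Fintype.card_fin, Fintype.card_fin] at hle hex
  have hfin : ∀ δ : Fin 4 × Fin k → ℤ, (∀ e, δ e = σ e * δ (f e)) → (∀ b ∈ B, δ b = 0) →
      ∀ e, δ e = 0 := fun δ hδ h e => by rw [hδ, h _ (hfB e), mul_zero]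
  have hex1 : ∀ b ∈ B, (Finset.univ.filter fun e => f e = b).card - 2 + 2 * B.card ≤ 4 * k := by
    intro b hb
    rw [← hex]
    gcongr
    exact Finset.single_le_sum
      (f := fun b => (Finset.univ.filter fun e => f e = b).card - 2) (fun _ _ => Nat.zero_le _) hb
  obtain ⟨i, q, j, hq, hij⟩ := hlink 0
  -- Path 0 is linked to path q. A third path r, linked to some q', provides a second linking class,
  -- possibly equal to the first.
  obtain ⟨r, hr0, hrq⟩ : ∃ r : Fin 4, r ≠ 0 ∧ r ≠ q :=
    (by decide : ∀ q : Fin 4, ∃ r : Fin 4, r ≠ 0 ∧ r ≠ q) q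
  obtain ⟨i', q', j', hq', hij'⟩ := hlink r
  have hb1 := hfB (0, i)
  have hb3 := hfB (r, i')
  have c10 : 1 ≤ classCount f (f (0, i)) 0 := classCount_pos rfl
  have c1q : 1 ≤ classCount f (f (0, i)) q := classCount_pos hij.symm
  have c3r : 1 ≤ classCount f (f (r, i')) r := classCount_pos rfl
  have c3q : 1 ≤ classCount f (f (r, i')) q' := classCount_pos hij'.symm
  have f1 := hex1 _ hb1
  have f3 := hex1 _ hb3
  have s1 := classCount_add_le f (f (0, i)) hq.symm
  have s3 := classCount_add_le f (f (r, i')) hq'.symm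
  have t1 := classCount_add_add_le f (f (0, i)) hr0 hrq hq.symm
  rcases (by omega : B.card + 2 ≤ 2 * k ∨ B.card + 1 = 2 * k ∨ B.card = 2 * k) with hc | hc | hc
  · exact ⟨B, hc, fun δ hδ _ hT => hfin δ hδ hT⟩
  -- With 2k - 1 classes the total excess is 2. If all multiplicities were even, two distinct
  -- linking classes would have at least four members each, and a single one, meeting 0, q and r, at
  -- least six; both exceed the excess.
  · obtain ⟨b, hb, p, hodd⟩ : ∃ b ∈ B, ∃ p, Odd (classCount f b p) := by
      by_contra hcon
      push Not at hcon
      simp only [Nat.not_odd_iff_even] at hcon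
      obtain ⟨u1, hu1⟩ := hcon _ hb1 0
      obtain ⟨u2, hu2⟩ := hcon _ hb1 q
      obtain ⟨u3, hu3⟩ := hcon _ hb3 r
      obtain ⟨u4, hu4⟩ := hcon _ hb3 q'
      by_cases hbb : f (0, i) = f (r, i')
      · rw [← hbb] at hu3 c3r
        omega
      · have hsum : ((Finset.univ.filter fun e => f e = f (0, i)).card - 2) +
            ((Finset.univ.filter fun e => f e = f (r, i')).card - 2) + 2 * B.card ≤ 4 * k := by
          rw [← hex, ← Finset.sum_pair
            (f := fun b => (Finset.univ.filter fun e => f e = b).card - 2) hbb]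
          gcongr
          exact Finset.insert_subset hb1 (Finset.singleton_subset_iff.2 hb3)
        omega
    refine ⟨B.erase b, ?_, fun δ hδ hcl hT => hfin δ hδ ?_⟩
    · rw [Finset.card_erase_of_mem hb]
      omega
    · have hδb : δ b = 0 := eq_zero_of_odd_classCount hδ (hcl p) hodd fun l hl =>
        hT _ (Finset.mem_erase.2 ⟨hl, hfB _⟩)
      intro b' hb'
      by_cases h : b' = b
      · rw [h, hδb]
      · exact hT _ (Finset.mem_erase.2 ⟨h, hb'⟩)
  -- With 2k classes all have size two, so the linking class of 0 and q does not meet r. Closedness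
  -- of r recovers the linking class of r first, and closedness of 0 then recovers that of 0.
  · have c1r : classCount f (f (0, i)) r = 0 := by omega
    have c10' : classCount f (f (0, i)) 0 = 1 := by omega
    have c3r' : classCount f (f (r, i')) r = 1 := by omega
    have hne : ∀ l, f (r, l) ≠ f (0, i) := fun l hl => by
      have := classCount_pos hl
      omega
    refine ⟨(B.erase (f (0, i))).erase (f (r, i')), ?_, fun δ hδ hcl hT => hfin δ hδ ?_⟩
    · rw [Finset.card_erase_of_mem (Finset.mem_erase.2 ⟨hne i', hb3⟩),
        Finset.card_erase_of_mem hb1]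
      have : 1 ≤ B.card := Finset.card_pos.2 ⟨_, hb1⟩
      have : 1 ≤ (B.erase (f (0, i))).card :=
        Finset.card_pos.2 ⟨_, Finset.mem_erase.2 ⟨hne i', hb3⟩⟩
      rw [Finset.card_erase_of_mem hb1] at this
      omega
    · have hδ3 : δ (f (r, i')) = 0 :=
        eq_zero_of_odd_classCount hδ (hcl r) (c3r' ▸ odd_one) fun l hl =>
          hT _ (Finset.mem_erase.2 ⟨hl, Finset.mem_erase.2 ⟨hne l, hfB _⟩⟩)
      have hδ1 : δ (f (0, i)) = 0 := by
        refine eq_zero_of_odd_classCount hδ (hcl 0) (c10' ▸ odd_one) fun l hl => ?_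
        by_cases h : f (0, l) = f (r, i')
        · rw [h, hδ3]
        · exact hT _ (Finset.mem_erase.2 ⟨h, Finset.mem_erase.2 ⟨hl, hfB _⟩⟩)
      intro b' hb'
      by_cases h : b' = f (r, i')
      · rw [h, hδ3]
      by_cases h' : b' = f (0, i)
      · rw [h', hδ1]
      exact hT _ (Finset.mem_erase.2 ⟨h, Finset.mem_erase.2 ⟨h', hb'⟩⟩)

end LinkedPatterns

/-- Quadruples of closed paths which use no diagonal only once and in which every path shares
a diagonal with another one. -/
def IsLinked {k n : ℕ} (X : Fin 4 → Fin (k + 1) → Fin n) : Prop :=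
  (∀ p, X p ∈ closedPaths k n) ∧
  (∀ e : Fin 4 × Fin k, ∃ e' : Fin 4 × Fin k, e' ≠ e ∧
    (increment (X e'.1) e'.2).natAbs = (increment (X e.1) e.2).natAbs) ∧
  ∀ p, ∃ i q j, q ≠ p ∧ (increment (X p) i).natAbs = (increment (X q) j).natAbs

open scoped Classical in
-- For each of the finitely many patterns there are n⁴ choices of starting points and at most 2k - 2
-- determining increments, of order n each.
theorem exists_card_isLinked_le (k : ℕ) :
    ∃ C : ℝ, 0 ≤ C ∧ ∀ n : ℕ, ((Finset.univ.filter fun X : Fin 4 → Fin (k + 1) → Fin n =>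
      IsLinked X).card : ℝ) * n ^ 2 ≤ C * (n ^ 4 * n ^ (2 * k)) := by
  set Pat := (Fin 4 × Fin k → Fin 4 × Fin k) × (Fin 4 × Fin k → ℤˣ)
  set L : Pat → (n : ℕ) → Finset (Fin 4 → Fin (k + 1) → Fin n) := fun s n =>
    Finset.univ.filter fun X => IsLinked X ∧
      (∀ e : Fin 4 × Fin k, increment (X e.1) e.2 =
        s.2 e * increment (X (s.1 e).1) (s.1 e).2) ∧
      ∀ e e' : Fin 4 × Fin k, (increment (X e.1) e.2).natAbs = (increment (X e'.1) e'.2).natAbs ↔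
        s.1 e = s.1 e' with hL
  have key : ∀ (s : Pat) (n : ℕ),
      ((L s n).card : ℝ) * n ^ 2 ≤ 3 ^ (2 * k) * (n ^ 4 * n ^ (2 * k)) := by
    rintro ⟨f, σ⟩ n
    rcases Nat.eq_zero_or_pos n with rfl | hn
    · simp
    have hn1 : (1 : ℝ) ≤ n := by exact_mod_cast hn
    rcases (L (f, σ) n).eq_empty_or_nonempty with he | ⟨X₀, hX₀⟩
    · rw [he, Finset.card_empty, Nat.cast_zero, zero_mul]
      positivity
    · obtain ⟨-, ⟨-, hX2, hX3⟩, -, hX5⟩ := Finset.mem_filter.1 hX₀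
      obtain ⟨T, hT, hdet⟩ := exists_determining_set (f := f) σ
        (fun e => by
          obtain ⟨e', h, h'⟩ := hX2 e
          exact ⟨e', h, (hX5 _ _).1 h'⟩)
        (fun p => by
          obtain ⟨i, q, j, h, h'⟩ := hX3 p
          exact ⟨i, q, j, h, (hX5 (p, i) (q, j)).1 h'⟩)
      have h1 := card_le_mul_pow_of_determined (L (f, σ) n) (fun X p => X p 0)
        (fun X (e : Fin 4 × Fin k) => increment (X e.1) e.2) n
        (fun X _ e => abs_increment_le _ _) T fun X hX Y hY h0 hXY => by
          obtain ⟨-, ⟨hXc, -, -⟩, hXσ, -⟩ := Finset.mem_filter.1 hX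
          obtain ⟨-, ⟨hYc, -, -⟩, hYσ, -⟩ := Finset.mem_filter.1 hY
          have hδ := hdet (fun e => increment (X e.1) e.2 - increment (Y e.1) e.2)
            (fun e => by rw [hXσ e, hYσ e]; ring)
            (fun p => by
              simp only [Finset.sum_sub_distrib, sum_increment]
              rw [mem_closedPaths.1 (hXc p), mem_closedPaths.1 (hYc p)]
              ring)
            (fun e he => sub_eq_zero.2 (hXY e he))
          funext p
          exact eq_of_increment_eq (congrFun h0 p) fun i => sub_eq_zero.1 (hδ (p, i))
      rw [Fintype.card_fun, Fintype.card_fin, Fintype.card_fin] at h1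
      have h2 : ((L (f, σ) n).card : ℝ) ≤ n ^ 4 * ((2 * n + 1 : ℕ) : ℝ) ^ T.card := by
        exact_mod_cast h1
      calc ((L (f, σ) n).card : ℝ) * n ^ 2
          ≤ n ^ 4 * (3 ^ T.card * (n : ℝ) ^ T.card) * n ^ 2 := by
            gcongr
            exact h2.trans (by gcongr; exact two_mul_add_one_pow_le hn _)
        _ = 3 ^ T.card * (n ^ 4 * (n : ℝ) ^ (T.card + 2)) := by ring
        _ ≤ _ := by
            gcongr
            · norm_num
            · omega
  refine ⟨(Fintype.card Pat : ℝ) * 3 ^ (2 * k), by positivity, fun n => ?_⟩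
  have hsub : (Finset.univ.filter fun X : Fin 4 → Fin (k + 1) → Fin n => IsLinked X) ⊆
      Finset.univ.biUnion fun s : Pat => L s n := by
    intro X hX
    have hX' := (Finset.mem_filter.1 hX).2
    obtain ⟨f, σ, h1, h2, -⟩ := exists_representative_sign
      fun e : Fin 4 × Fin k => increment (X e.1) e.2
    exact Finset.mem_biUnion.2 ⟨(f, σ), Finset.mem_univ _,
      Finset.mem_filter.2 ⟨Finset.mem_univ _, hX', h1, h2⟩⟩
  have hcard : ((Finset.univ.filter fun X : Fin 4 → Fin (k + 1) → Fin n => IsLinked X).card : ℝ) ≤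
      ∑ s : Pat, ((L s n).card : ℝ) := by
    exact_mod_cast (Finset.card_le_card hsub).trans Finset.card_biUnion_le
  calc _ ≤ (∑ s : Pat, ((L s n).card : ℝ)) * n ^ 2 := by gcongr
    _ = ∑ s : Pat, ((L s n).card : ℝ) * n ^ 2 := Finset.sum_mul _ _ _
    _ ≤ ∑ _s : Pat, 3 ^ (2 * k) * ((n : ℝ) ^ 4 * n ^ (2 * k)) :=
        Finset.sum_le_sum fun s _ => key s n
    _ = _ := by rw [Finset.sum_const, Finset.card_univ, nsmul_eq_mul]; ring

theorem sub_pow_four_le (x y : ℝ) : |x - y| ^ 4 ≤ 8 * (|x| ^ 4 + |y| ^ 4) := by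
  have e : ∀ z : ℝ, |z| ^ 4 = (z ^ 2) ^ 2 := fun z => by
    rw [← pow_mul]; exact (show Even 4 by decide).pow_abs z
  rw [e, e, e]
  nlinarith [sq_nonneg (x ^ 2 - y ^ 2), sq_nonneg (x + y), sq_nonneg (x - y),
    pow_le_pow_left₀ (sq_nonneg (x - y)) (show (x - y) ^ 2 ≤ 2 * (x ^ 2 + y ^ 2) by
      nlinarith [sq_nonneg (x + y)]) 2]

/-- Summable fourth moments imply almost sure convergence to zero. -/
theorem ae_tendsto_zero_of_integral_pow_four_le {Ω : Type*} [MeasurableSpace Ω] {P : Measure Ω}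
    {f : ℕ → Ω → ℝ} (hf : ∀ n, Measurable (f n))
    (hint : ∀ n, Integrable (fun ω => f n ω ^ 4) P) {C : ℝ}
    (hC : ∀ n : ℕ, ∫ ω, f n ω ^ 4 ∂P ≤ C / n ^ 2) :
    ∀ᵐ ω ∂P, Tendsto (fun n => f n ω) atTop (𝓝 0) := by
  have hnn : ∀ n ω, 0 ≤ f n ω ^ 4 := fun n ω => by positivity
  have h1 : ∀ n, ∫⁻ ω, ENNReal.ofReal (f n ω ^ 4) ∂P ≤ ENNReal.ofReal (C / n ^ 2) := fun n => by
    rw [← ofReal_integral_eq_lintegral_ofReal (hint n) (ae_of_all _ (hnn n))]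
    exact ENNReal.ofReal_le_ofReal (hC n)
  have hsum : Summable fun n : ℕ => C / (n : ℝ) ^ 2 := by
    simpa [div_eq_mul_inv] using (Real.summable_nat_pow_inv.2 one_lt_two).mul_left C
  -- The series of fourth powers has finite expectation, hence converges almost surely, and its
  -- terms tend to zero.
  have h2 : ∫⁻ ω, ∑' n, ENNReal.ofReal (f n ω ^ 4) ∂P ≠ ⊤ := by
    rw [lintegral_tsum fun n => ((hf n).pow_const 4).ennreal_ofReal.aemeasurable]
    refine ne_top_of_le_ne_top ?_ (ENNReal.tsum_le_tsum h1)
    exact hsum.tsum_ofReal_ne_top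
  have h3 := ae_lt_top (Measurable.tsum fun n => ((hf n).pow_const 4).ennreal_ofReal) h2
  filter_upwards [h3] with ω hω
  have h4 := ENNReal.tendsto_atTop_zero_of_tsum_ne_top hω.ne
  have h5 : Tendsto (fun n => f n ω ^ 4) atTop (𝓝 0) := by
    have := (ENNReal.tendsto_toReal ENNReal.zero_ne_top).comp h4
    refine this.congr fun n => ?_
    simp [ENNReal.toReal_ofReal (hnn n ω)]
  have h6 : Tendsto (fun n => |f n ω|) atTop (𝓝 0) := by
    have h7 := ((Real.continuous_sqrt.comp Real.continuous_sqrt).tendsto 0).comp h5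
    simp only [Function.comp_def, Real.sqrt_zero] at h7
    refine h7.congr fun n => ?_
    rw [show f n ω ^ 4 = (f n ω ^ 2) ^ 2 by ring, Real.sqrt_sq (sq_nonneg _), Real.sqrt_sq_eq_abs]
  exact (tendsto_zero_iff_abs_tendsto_zero _).2 h6

namespace DiagonalEnsemble

variable {Ω : Type*} [mΩ : MeasurableSpace Ω] {P : Measure Ω}
  {a : (n : ℕ) → Fin n → Fin n → Ω → ℝ} {cn : ℕ → ℝ} {c : ℝ}

/-- The centred weight of a path. -/
noncomputable def centredWeight (P : Measure Ω) {k n : ℕ} (b : Fin n → Fin n → Ω → ℝ)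
    (x : Fin (k + 1) → Fin n) (ω : Ω) : ℝ :=
  pathWeight b x ω - ∫ ω, pathWeight b x ω ∂P

theorem measurable_centredWeight_diagSigma {k n : ℕ} (b : Fin n → Fin n → Ω → ℝ) {S : Set ℕ}
    {x : Fin (k + 1) → Fin n} (h : ∀ i, (increment x i).natAbs ∈ S) :
    Measurable[diagSigma b S] (centredWeight P b x) :=
  (measurable_pathWeight_diagSigma b h).sub_const _

theorem measurable_prod_centredWeight_diagSigma {k n : ℕ} (b : Fin n → Fin n → Ω → ℝ) {S : Set ℕ}
    {X : Fin 4 → Fin (k + 1) → Fin n} (s : Finset (Fin 4))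
    (h : ∀ p ∈ s, ∀ i, (increment (X p) i).natAbs ∈ S) :
    Measurable[diagSigma b S] fun ω => ∏ p ∈ s, centredWeight P b (X p) ω :=
  @Finset.measurable_fun_prod _ _ _ _ _ _ (diagSigma b S) _ s
    fun p hp => measurable_centredWeight_diagSigma b (h p hp)

theorem measurable_centredWeight (h : DiagonalEnsemble P a cn c) {k n : ℕ}
    (x : Fin (k + 1) → Fin n) : Measurable (centredWeight P (a n) x) :=
  (h.measurable_pathWeight x).sub_const _

variable [IsProbabilityMeasure P]

theorem integral_centredWeight (h : DiagonalEnsemble P a cn c) {k n : ℕ}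
    (x : Fin (k + 1) → Fin n) : ∫ ω, centredWeight P (a n) x ω ∂P = 0 := by
  simp only [centredWeight]
  rw [integral_sub (h.integrable_pathWeight x) (integrable_const _)]
  simp

theorem exists_integral_prod_centredWeight_le (h : DiagonalEnsemble P a cn c) (k : ℕ) :
    ∃ C : ℝ, 0 ≤ C ∧ ∀ n, ∀ X : Fin 4 → Fin (k + 1) → Fin n,
      Integrable (fun ω => ∏ p, centredWeight P (a n) (X p) ω) P ∧
        ∫ ω, ∏ p, centredWeight P (a n) (X p) ω ∂P ≤ C := by
  obtain ⟨C, hC⟩ := h.exists_moment_pathWeight_le k 4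
  obtain ⟨D, hD⟩ := h.exists_abs_integral_pathWeight_le k
  have hb : ∀ n, ∀ X : Fin 4 → Fin (k + 1) → Fin n, ∀ ω,
      |∏ p, centredWeight P (a n) (X p) ω| ≤
        1 + ∑ p, 8 * (|pathWeight (a n) (X p) ω| ^ 4 + D ^ 4) := by
    intro n X ω
    refine (abs_prod_le_one_add_sum _ _).trans ?_
    gcongr with p
    refine (sub_pow_four_le _ _).trans ?_
    gcongr
    exact hD n (X p)
  have hi : ∀ n, ∀ X : Fin 4 → Fin (k + 1) → Fin n, ∀ p, Integrable
      (fun ω => 8 * (|pathWeight (a n) (X p) ω| ^ 4 + D ^ 4)) P := fun n X p =>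
    ((hC n (X p)).1.add (integrable_const _)).const_mul _
  have hI : ∀ n, ∀ X : Fin 4 → Fin (k + 1) → Fin n, Integrable
      (fun ω => 1 + ∑ p, 8 * (|pathWeight (a n) (X p) ω| ^ 4 + D ^ 4)) P := fun n X =>
    (integrable_const 1).add (integrable_finsetSum _ fun p _ => hi n X p)
  refine ⟨|1 + ∑ _p : Fin 4, 8 * (C + D ^ 4)|, abs_nonneg _, fun n X => ?_⟩
  have hint : Integrable (fun ω => ∏ p, centredWeight P (a n) (X p) ω) P :=
    (hI n X).mono' (Finset.measurable_fun_prod _ fun p _ =>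
      h.measurable_centredWeight (X p)).aestronglyMeasurable (ae_of_all _ (hb n X))
  refine ⟨hint, le_trans ?_ (le_abs_self _)⟩
  refine (integral_mono hint (hI n X) fun ω => (le_abs_self _).trans (hb n X ω)).trans ?_
  rw [integral_add (integrable_const 1) (integrable_finsetSum _ fun p _ => hi n X p),
    integral_finsetSum _ fun p _ => hi n X p]
  refine add_le_add (by simp) (Finset.sum_le_sum fun p _ => ?_)
  rw [integral_const_mul, integral_add (hC n (X p)).1 (integrable_const _)]
  have := (hC n (X p)).2
  simp only [integral_const, probReal_univ, one_smul]
  linarith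

/-- Only linked quadruples contribute to the fourth central moment. -/
theorem integral_prod_centredWeight_eq_zero (h : DiagonalEnsemble P a cn c) {k n : ℕ}
    {X : Fin 4 → Fin (k + 1) → Fin n} (hcl : ∀ p, X p ∈ closedPaths k n) (hX : ¬ IsLinked X) :
    ∫ ω, ∏ p, centredWeight P (a n) (X p) ω ∂P = 0 := by
  simp only [IsLinked, not_and_or, not_forall] at hX
  rcases hX with ⟨p, hp⟩ | ⟨⟨p, i⟩, hp⟩ | ⟨p, hp⟩
  · exact absurd (hcl p) hp
  · push Not at hp
    -- Step i of path p is alone on its diagonal. The weight of p then has mean zero, so centring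
    -- does not change it, and the centred entry of step i splits off.
    have hzero : ∫ ω, pathWeight (a n) (X p) ω ∂P = 0 :=
      h.integral_pathWeight_eq_zero (X p) i fun j hj => hp (p, j) (by simpa using hj)
    have heq : ∀ ω, ∏ q, centredWeight P (a n) (X q) ω = stepEntry (a n) (X p) i ω *
        ((∏ j ∈ Finset.univ.erase i, stepEntry (a n) (X p) j ω) *
          ∏ q ∈ Finset.univ.erase p, centredWeight P (a n) (X q) ω) := by
      intro ω
      rw [← Finset.mul_prod_erase _ _ (Finset.mem_univ p), centredWeight, hzero, sub_zero,
        pathWeight, ← Finset.mul_prod_erase _ _ (Finset.mem_univ i), mul_assoc]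
    simp only [heq]
    rw [h.integral_mul_of_disjoint n (S := {(increment (X p) i).natAbs})
      (T := {(increment (X p) i).natAbs}ᶜ) disjoint_compl_right
      (measurable_stepEntry_diagSigma _ rfl) ?_, h.integral_stepEntry, zero_mul]
    refine Measurable.mul (measurable_prod_stepEntry_diagSigma _ _ fun j hj => ?_)
      (measurable_prod_centredWeight_diagSigma _ _ fun q hq j => ?_)
    · exact hp (p, j) (by simpa using Finset.ne_of_mem_erase hj)
    · exact hp (q, j) fun h => Finset.ne_of_mem_erase hq (congrArg Prod.fst h)
  · push Not at hp
    -- Path p shares no diagonal with the other three, so its centred weight is independent of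
    -- theirs.
    simp only [← Finset.mul_prod_erase _ _ (Finset.mem_univ p)]
    rw [h.integral_mul_of_disjoint n (S := Set.range fun i => (increment (X p) i).natAbs)
      (T := (Set.range fun i => (increment (X p) i).natAbs)ᶜ) disjoint_compl_right
      (measurable_centredWeight_diagSigma _ fun i => ⟨i, rfl⟩)
      (measurable_prod_centredWeight_diagSigma _ _ fun q hq j => ?_),
      h.integral_centredWeight, zero_mul]
    rintro ⟨i, hi⟩
    exact hp i q j (Finset.ne_of_mem_erase hq) hi

/-- Almost surely, the moments concentrate around their expectations. -/
theorem ae_tendsto_sum_centredWeight (h : DiagonalEnsemble P a cn c) (k : ℕ) :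
    ∀ᵐ ω ∂P, Tendsto (fun n : ℕ => (∑ x ∈ closedPaths k n, centredWeight P (a n) x ω) /
      (n * √n ^ k)) atTop (𝓝 0) := by
  classical
  obtain ⟨C, hC0, hC⟩ := h.exists_integral_prod_centredWeight_le k
  obtain ⟨D, hD0, hD⟩ := exists_card_isLinked_le k
  -- The fourth power of a sum over paths is a sum over quadruples of paths.
  have hexp : ∀ n ω, ((∑ x ∈ closedPaths k n, centredWeight P (a n) x ω) / (n * √n ^ k)) ^ 4 =
      (∑ X ∈ Fintype.piFinset fun _ : Fin 4 => closedPaths k n,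
        ∏ p, centredWeight P (a n) (X p) ω) / (n ^ 4 * n ^ (2 * k)) := by
    intro n ω
    have h1 : (∑ x ∈ closedPaths k n, centredWeight P (a n) x ω) ^ 4 =
        ∏ _p : Fin 4, ∑ x ∈ closedPaths k n, centredWeight P (a n) x ω := by simp
    rw [div_pow, h1, Finset.prod_univ_sum, mul_pow]
    congr 2
    rw [← pow_mul, mul_comm k 4, show 4 * k = 2 * (2 * k) by ring, pow_mul,
      Real.sq_sqrt (Nat.cast_nonneg n)]
  refine ae_tendsto_zero_of_integral_pow_four_le (C := C * D) (fun n => ?_) (fun n => ?_) fun n => ?_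
  · exact (Finset.measurable_fun_sum _ fun x _ => h.measurable_centredWeight x).div_const _
  · simp only [hexp]
    exact (integrable_finsetSum _ fun X _ => (hC n X).1).div_const _
  · simp only [hexp]
    rw [integral_div, integral_finsetSum _ fun X _ => (hC n X).1]
    rcases Nat.eq_zero_or_pos n with rfl | hn
    · simp
    have hn' : (0 : ℝ) < n := by exact_mod_cast hn
    have hle : ∑ X ∈ Fintype.piFinset fun _ : Fin 4 => closedPaths k n,
        ∫ ω, ∏ p, centredWeight P (a n) (X p) ω ∂P ≤
        ((Finset.univ.filter fun X : Fin 4 → Fin (k + 1) → Fin n => IsLinked X).card : ℝ) * C := by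
      rw [← Finset.sum_filter_of_ne (p := IsLinked)]
      · refine (Finset.sum_le_sum fun X _ => (hC n X).2).trans ?_
        rw [Finset.sum_const, nsmul_eq_mul]
        gcongr
        exact Finset.subset_univ _
      · intro X hX hne
        by_contra hcon
        exact hne (h.integral_prod_centredWeight_eq_zero (Fintype.mem_piFinset.1 hX) hcon)
    rw [div_le_div_iff₀ (by positivity) (by positivity)]
    calc _ ≤ ((Finset.univ.filter fun X : Fin 4 → Fin (k + 1) → Fin n =>
          IsLinked X).card : ℝ) * C * n ^ 2 := by gcongr
      _ = ((Finset.univ.filter fun X : Fin 4 → Fin (k + 1) → Fin n =>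
          IsLinked X).card : ℝ) * n ^ 2 * C := by ring
      _ ≤ D * (n ^ 4 * n ^ (2 * k)) * C := mul_le_mul_of_nonneg_right (hD n) hC0
      _ = _ := by ring

end DiagonalEnsemble

/-! ### Spectral moments as traces and sums over closed paths. -/

theorem Matrix.pow_apply_eq_sum_paths {α R : Type*} [Fintype α] [DecidableEq α] [CommSemiring R]
    (A : Matrix α α R) (k : ℕ) (i j : α) :
    (A ^ k) i j = ∑ x : Fin (k + 1) → α, if x 0 = i ∧ x (Fin.last k) = j then
      ∏ l : Fin k, A (x l.castSucc) (x l.succ) else 0 := by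
  induction k generalizing i with
  | zero =>
    rw [← (Equiv.funUnique (Fin 1) α).symm.sum_comp]
    simp only [pow_zero, Matrix.one_apply, Equiv.funUnique_symm_apply, uniqueElim_const,
      Finset.univ_eq_empty, Finset.prod_empty]
    by_cases h : i = j
    · subst h
      simp
    · rw [if_neg h, Finset.sum_eq_zero]
      exact fun x _ => if_neg fun hx => h (hx.1.symm.trans hx.2)
  | succ k ih =>
    symm
    rw [← (Fin.consEquiv fun _ => α).sum_comp, Fintype.sum_prod_type]
    refine (Finset.sum_eq_single i (fun b _ hb => ?_) (by simp)).trans ?_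
    · refine Finset.sum_eq_zero fun x _ => if_neg fun h => hb ?_
      simpa using h.1
    · rw [pow_succ', Matrix.mul_apply]
      simp only [ih, Finset.mul_sum]
      rw [Finset.sum_comm]
      refine Finset.sum_congr rfl fun x _ => ?_
      refine Eq.trans ?_ (Finset.sum_eq_single (x 0) (fun b _ hb => ?_) (by simp)).symm
      · simp [Fin.prod_univ_succ, ← Fin.succ_last, Fin.castSucc_succ]
      · rw [if_neg fun h => hb h.1.symm, mul_zero]

theorem trace_pow_eq_sum_closedPaths {n : ℕ} (A : Matrix (Fin n) (Fin n) ℝ) (k : ℕ) :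
    (A ^ k).trace = ∑ x ∈ closedPaths k n, ∏ l : Fin k, A (x l.castSucc) (x l.succ) := by
  simp only [Matrix.trace, Matrix.diag_apply, Matrix.pow_apply_eq_sum_paths]
  rw [Finset.sum_comm, closedPaths, Finset.sum_filter]
  refine Finset.sum_congr rfl fun x _ => ?_
  rw [Finset.sum_eq_single (x 0)]
  · simp [eq_comm]
  · intro b _ hb
    exact if_neg fun h => hb h.1.symm
  · simp

theorem Matrix.IsHermitian.trace_pow_eq_sum {n : ℕ} {A : Matrix (Fin n) (Fin n) ℝ}
    (hA : A.IsHermitian) (k : ℕ) : (A ^ k).trace = ∑ i, hA.eigenvalues i ^ k := by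
  conv_lhs => rw [hA.spectral_theorem, ← map_pow, Unitary.conjStarAlgAut_apply,
    Matrix.trace_mul_cycle, Unitary.coe_star_mul_self, one_mul, Matrix.diagonal_pow,
    Matrix.trace_diagonal]
  simp

theorem integral_pow_empiricalSpectral {n : ℕ} {A : Matrix (Fin n) (Fin n) ℝ}
    (hA : A.IsHermitian) (k : ℕ) :
    ∫ x, x ^ k ∂(empiricalSpectral hA : Measure ℝ) = (A ^ k).trace / n := by
  rw [empiricalSpectral, FiniteMeasure.toMeasure_smul, FiniteMeasure.toMeasure_sum,
    integral_smul_nnreal_measure, integral_finsetSum_measure, hA.trace_pow_eq_sum]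
  · simp [pointMass, NNReal.smul_def, div_eq_inv_mul]
  · intro i _
    exact integrable_dirac (by simp)

theorem integrable_empiricalSpectral {n : ℕ} {A : Matrix (Fin n) (Fin n) ℝ}
    (hA : A.IsHermitian) (f : ℝ → ℝ) : Integrable f (empiricalSpectral hA : Measure ℝ) := by
  rw [empiricalSpectral, FiniteMeasure.toMeasure_smul, FiniteMeasure.toMeasure_sum]
  refine Integrable.smul_measure_nnreal (integrable_finsetSum_measure.2 fun i _ => ?_)
  exact integrable_dirac (by simp)

theorem isProbabilityMeasure_empiricalSpectral {n : ℕ} (hn : n ≠ 0)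
    {A : Matrix (Fin n) (Fin n) ℝ} (hA : A.IsHermitian) :
    IsProbabilityMeasure (empiricalSpectral hA : Measure ℝ) := by
  have h := integral_pow_empiricalSpectral hA 0
  have hn' : (n : ℝ) ≠ 0 := by exact_mod_cast hn
  simp only [pow_zero, integral_const, smul_eq_mul, mul_one, Matrix.trace_one, Fintype.card_fin,
    div_self hn'] at h
  constructor
  rwa [Measure.real, ENNReal.toReal_eq_one_iff] at h

theorem integral_pow_esd {Ω : Type*} {n : ℕ} (b : Fin n → Fin n → Ω → ℝ) (ω : Ω) (k : ℕ) :
    ∫ x, x ^ k ∂(esd n fun p q => b p q ω : Measure ℝ) =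
      (∑ x ∈ closedPaths k n, pathWeight b x ω) / (n * √n ^ k) := by
  rw [esd, integral_pow_empiricalSpectral, trace_pow_eq_sum_closedPaths]
  have : ∀ x : Fin (k + 1) → Fin n, ∏ l : Fin k,
      symMatrix n (fun p q => b p q ω) (x l.castSucc) (x l.succ) =
        (1 / √n) ^ k * pathWeight b x ω := by
    intro x
    have h : ∀ l : Fin k, symMatrix n (fun p q => b p q ω) (x l.castSucc) (x l.succ) =
        1 / √n * stepEntry b x l ω := fun l => rfl
    simp only [h, Finset.prod_mul_distrib, Finset.prod_const, Finset.card_univ, Fintype.card_fin]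
    rfl
  simp only [this, ← Finset.mul_sum]
  rw [one_div, inv_pow, mul_comm (n : ℝ), ← div_div, div_eq_inv_mul (∑ x ∈ _, _)]

theorem tendsto_esd_of_tendsto_moments {b : (n : ℕ) → Fin n → Fin n → ℝ} {M : ℕ → ℝ}
    {ν : ProbabilityMeasure ℝ} (hν : ∀ k, Integrable (fun x : ℝ => x ^ k) (ν : Measure ℝ))
    (hνM : ∀ k, ∫ x, x ^ k ∂(ν : Measure ℝ) = M k)
    (hM : ∀ t : ℝ, Tendsto (fun m : ℕ => t ^ (2 * m) / (2 * m).factorial * M (2 * m))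
      atTop (𝓝 0))
    (hlim : ∀ k, Tendsto (fun n => ∫ x, x ^ k ∂(esd n (b n) : Measure ℝ)) atTop (𝓝 (M k))) :
    Tendsto (fun n => esd n (b n)) atTop (𝓝 ν.toFiniteMeasure) := by
  -- For n = 0 the empirical distribution is the zero measure, so the probability measures start at
  -- n = 1.
  rw [← tendsto_add_atTop_iff_nat 1]
  let μ : ℕ → ProbabilityMeasure ℝ := fun n => ⟨(esd (n + 1) (b (n + 1)) : Measure ℝ),
    isProbabilityMeasure_empiricalSpectral (Nat.succ_ne_zero n) _⟩
  have h := tendsto_probabilityMeasure_of_tendsto_moments (μ := μ)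
    (fun n k => integrable_empiricalSpectral _ _) hν
    (fun k => (tendsto_add_atTop_iff_nat 1).2 (hlim k)) hνM hM
  exact (ProbabilityMeasure.toFiniteMeasure_continuous.tendsto ν).comp h

theorem exists_limit_of_tendsto_moments_esd {b : (n : ℕ) → Fin n → Fin n → ℝ} {M : ℕ → ℝ}
    (hlim : ∀ k, Tendsto (fun n => ∫ x, x ^ k ∂(esd n (b n) : Measure ℝ)) atTop (𝓝 (M k))) :
    ∃ ν : ProbabilityMeasure ℝ, (∀ k, Integrable (fun x : ℝ => x ^ k) (ν : Measure ℝ)) ∧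
      ∀ k, ∫ x, x ^ k ∂(ν : Measure ℝ) = M k := by
  let μ : ℕ → ProbabilityMeasure ℝ := fun n => ⟨(esd (n + 1) (b (n + 1)) : Measure ℝ),
    isProbabilityMeasure_empiricalSpectral (Nat.succ_ne_zero n) _⟩
  exact exists_probabilityMeasure_of_tendsto_moments (μ := μ)
    (fun n k => integrable_empiricalSpectral _ _)
    (fun k => (tendsto_add_atTop_iff_nat 1).2 (hlim k))

/-! ### Almost sure convergence of the moments and the range of c. -/

namespace DiagonalEnsemble

variable {Ω : Type*} [mΩ : MeasurableSpace Ω] {P : Measure Ω} [IsProbabilityMeasure P]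
  {a : (n : ℕ) → Fin n → Fin n → Ω → ℝ} {cn : ℕ → ℝ} {c : ℝ}

theorem ae_tendsto_moments (h : DiagonalEnsemble P a cn c) :
    ∀ᵐ ω ∂P, ∀ k, Tendsto (fun n => ∫ x, x ^ k ∂(esd n fun p q => a n p q ω : Measure ℝ)) atTop
      (𝓝 (limitMoment c k)) := by
  rw [ae_all_iff]
  intro k
  filter_upwards [h.ae_tendsto_sum_centredWeight k] with ω hω
  have := hω.add (h.tendsto_sum_integral_pathWeight k)
  rw [zero_add] at this
  refine this.congr fun n => ?_
  rw [integral_pow_esd, ← add_div, ← Finset.sum_add_distrib]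
  simp [centredWeight]

/-- The sum of the main diagonal has second moment n(1 + (n - 1)c_n), which is nonnegative. In the
limit this yields c ≥ 0. -/
theorem cov_nonneg_or_sub_one_le (h : DiagonalEnsemble P a cn c) (n : ℕ) :
    -1 ≤ ((n : ℝ) - 1) * cn n ∨ n = 0 := by
  rcases Nat.eq_zero_or_pos n with hn | hn
  · exact Or.inr hn
  left
  have hmem : ∀ p, MemLp (a n p p) 2 P := fun p => h.memLp_entry n p p le_rfl
  have hprod : ∀ p q, ∫ ω, a n p p ω * a n q q ω ∂P = if p = q then 1 else cn n := by
    intro p q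
    split_ifs with hpq
    · subst hpq
      simp only [← sq]
      exact h.variance_one n p p le_rfl
    · exact h.integral_mul_eq_cov (r := 0) (by simp) (by simp) hpq
  have h1 : ∫ ω, (∑ p, a n p p ω) ^ 2 ∂P = ∑ p : Fin n, ∑ q : Fin n, if p = q then 1 else cn n := by
    have hi : ∀ p q, Integrable (fun ω => a n p p ω * a n q q ω) P := fun p q =>
      (hmem p).integrable_mul (hmem q)
    simp only [sq, Finset.sum_mul_sum]
    rw [integral_finsetSum _ fun p _ => integrable_finsetSum _ fun q _ => hi p q]
    refine Finset.sum_congr rfl fun p _ => ?_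
    rw [integral_finsetSum _ fun q _ => hi p q]
    exact Finset.sum_congr rfl fun q _ => hprod p q
  have h2 : ∀ p : Fin n, ∑ q : Fin n, (if p = q then 1 else cn n) = 1 + (n - 1) * cn n := by
    intro p
    have : ∀ q : Fin n, (if p = q then 1 else cn n) = cn n + if p = q then 1 - cn n else 0 :=
      fun q => by split_ifs <;> ring
    simp only [this, Finset.sum_add_distrib, Finset.sum_ite_eq, Finset.mem_univ, if_true,
      Finset.sum_const, Finset.card_univ, Fintype.card_fin, nsmul_eq_mul]
    ring
  simp only [h2, Finset.sum_const, Finset.card_univ, Fintype.card_fin, nsmul_eq_mul] at h1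
  have h3 : 0 ≤ (n : ℝ) * (1 + (n - 1) * cn n) := by
    rw [← h1]
    exact integral_nonneg fun ω => sq_nonneg _
  have hn' : (0 : ℝ) < n := by exact_mod_cast hn
  have := nonneg_of_mul_nonneg_right h3 hn'
  linarith

/-- The inequality 2uv ≤ u² + v² for the first two entries of the main diagonal. -/
theorem cov_le_one (h : DiagonalEnsemble P a cn c) (n : ℕ) (hn : 2 ≤ n) : cn n ≤ 1 := by
  set p : Fin n := ⟨0, by omega⟩
  set q : Fin n := ⟨1, by omega⟩
  have hpq : p ≠ q := by simp [p, q]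
  have hp := h.memLp_entry n p p le_rfl
  have hq := h.memLp_entry n q q le_rfl
  have h1 := h.integral_mul_eq_cov (r := 0) (p := p) (q := p) (p' := q) (q' := q)
    (by simp) (by simp) hpq
  have h2 := h.variance_one n p p le_rfl
  have h3 := h.variance_one n q q le_rfl
  have h4 : ∫ ω, 2 * (a n p p ω * a n q q ω) ∂P ≤ ∫ ω, (a n p p ω ^ 2 + a n q q ω ^ 2) ∂P :=
    integral_mono ((hp.integrable_mul hq).const_mul 2) (hp.integrable_sq.add hq.integrable_sq)
      fun ω => by simp only; nlinarith [sq_nonneg (a n p p ω - a n q q ω)]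
  rw [integral_const_mul, h1, integral_add hp.integrable_sq hq.integrable_sq, h2, h3] at h4
  linarith

theorem mem_Icc (h : DiagonalEnsemble P a cn c) : c ∈ Set.Icc (0 : ℝ) 1 := by
  constructor
  · have h0 : Tendsto (fun n : ℕ => -(1 / ((n : ℝ) - 1))) atTop (𝓝 0) := by
      rw [← neg_zero]
      refine Tendsto.neg (tendsto_const_nhds.div_atTop ?_)
      exact tendsto_atTop_add_const_right _ (-1) tendsto_natCast_atTop_atTop
    refine le_of_tendsto_of_tendsto h0 h.tendsto_cov ?_
    filter_upwards [eventually_ge_atTop 2] with n hn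
    have hn' : (0 : ℝ) < (n : ℝ) - 1 := by
      have : (2 : ℝ) ≤ n := by exact_mod_cast hn
      linarith
    have := (h.cov_nonneg_or_sub_one_le n).resolve_right (by omega)
    rw [← neg_div, div_le_iff₀ hn']
    linarith
  · exact le_of_tendsto h.tendsto_cov
      ((eventually_ge_atTop 2).mono fun n hn => h.cov_le_one n hn)

end DiagonalEnsemble

/-! ### A Gaussian ensemble for every c in [0, 1]. -/

section GaussianArray

/-- The law of an array of independent standard Gaussian variables. -/
noncomputable def gaussianArray : Measure (ℕ → Option ℕ → ℝ) :=
  Measure.infinitePi fun _ => Measure.infinitePi fun _ => gaussianReal 0 1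

instance : IsProbabilityMeasure gaussianArray := by
  unfold gaussianArray; infer_instance

theorem measurePreserving_eval_gaussianArray (r : ℕ) (o : Option ℕ) :
    MeasurePreserving (fun ω : ℕ → Option ℕ → ℝ => ω r o) gaussianArray (gaussianReal 0 1) :=
  (measurePreserving_eval_infinitePi (fun _ : Option ℕ => gaussianReal 0 1) o).comp
    (measurePreserving_eval_infinitePi
      (fun _ : ℕ => Measure.infinitePi fun _ : Option ℕ => gaussianReal 0 1) r)

theorem memLp_eval_gaussianArray (r : ℕ) (o : Option ℕ) (p : ℝ≥0) :
    MemLp (fun ω : ℕ → Option ℕ → ℝ => ω r o) p gaussianArray :=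
  (memLp_id_gaussianReal p).comp_measurePreserving (measurePreserving_eval_gaussianArray r o)

theorem integral_eval_gaussianArray (r : ℕ) (o : Option ℕ) :
    ∫ ω, ω r o ∂gaussianArray = 0 := by
  have h := measurePreserving_eval_gaussianArray r o
  have := integral_map (μ := gaussianArray) h.measurable.aemeasurable (f := fun x : ℝ => x)
    (by fun_prop)
  rw [h.map_eq, integral_id_gaussianReal] at this
  exact this.symm

theorem indepFun_eval_gaussianArray (r : ℕ) {o o' : Option ℕ} (h : o ≠ o') :
    IndepFun (fun ω : ℕ → Option ℕ → ℝ => ω r o) (fun ω => ω r o') gaussianArray := by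
  have := iIndepFun_uncurry_infinitePi' (ι := ℕ) (κ := Option ℕ) (Ω := fun _ _ => ℝ)
    (X := fun _ _ x => x) (fun _ _ => gaussianReal 0 1) (fun _ _ => measurable_id)
  exact this.indepFun (i := (r, o)) (j := (r, o')) (by simpa using h)

theorem covariance_eval_gaussianArray (r : ℕ) (o o' : Option ℕ) :
    covariance (fun ω => ω r o) (fun ω => ω r o') gaussianArray = if o = o' then 1 else 0 := by
  split_ifs with h
  · subst h
    have hm := measurePreserving_eval_gaussianArray r o
    rw [covariance_self hm.measurable.aemeasurable]
    have := variance_map (μ := gaussianArray) (X := fun x : ℝ => x) (Y := fun ω => ω r o)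
      (by fun_prop) hm.measurable.aemeasurable
    rw [hm.map_eq, variance_fun_id_gaussianReal] at this
    simpa [Function.comp_def] using this.symm
  · exact (indepFun_eval_gaussianArray r h).covariance_eq_zero
      (memLp_eval_gaussianArray r o 2) (memLp_eval_gaussianArray r o' 2)

/-- The entry at position `p` of the diagonal `r` in the standard ensemble with covariance `c`. -/
noncomputable def gaussianEntry (c : ℝ) (r p : ℕ) (ω : ℕ → Option ℕ → ℝ) : ℝ :=
  √c * ω r none + √(1 - c) * ω r (some p)

theorem measurable_gaussianEntry (c : ℝ) (r p : ℕ) : Measurable (gaussianEntry c r p) := by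
  unfold gaussianEntry; fun_prop

theorem memLp_gaussianEntry (c : ℝ) (r p : ℕ) (q : ℝ≥0) :
    MemLp (gaussianEntry c r p) q gaussianArray :=
  ((memLp_eval_gaussianArray r none q).const_mul _).add
    ((memLp_eval_gaussianArray r (some p) q).const_mul _)

theorem integrable_eval_gaussianArray (r : ℕ) (o : Option ℕ) :
    Integrable (fun ω : ℕ → Option ℕ → ℝ => ω r o) gaussianArray :=
  memLp_one_iff_integrable.1 (memLp_eval_gaussianArray r o 1)

theorem integral_gaussianEntry (c : ℝ) (r p : ℕ) :
    ∫ ω, gaussianEntry c r p ω ∂gaussianArray = 0 := by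
  unfold gaussianEntry
  rw [integral_add ((integrable_eval_gaussianArray r none).const_mul _)
    ((integrable_eval_gaussianArray r (some p)).const_mul _), integral_const_mul,
    integral_const_mul, integral_eval_gaussianArray, integral_eval_gaussianArray]
  simp

theorem covariance_gaussianEntry {c : ℝ} (hc : c ∈ Set.Icc (0 : ℝ) 1) (r p q : ℕ) :
    covariance (gaussianEntry c r p) (gaussianEntry c r q) gaussianArray =
      if p = q then 1 else c := by
  have hm : ∀ (s : ℝ) (o : Option ℕ), MemLp (fun ω : ℕ → Option ℕ → ℝ => s * ω r o) 2
      gaussianArray := fun s o => (memLp_eval_gaussianArray r o 2).const_mul s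
  have he : ∀ p, gaussianEntry c r p =
      (fun ω : ℕ → Option ℕ → ℝ => √c * ω r none) + fun ω => √(1 - c) * ω r (some p) :=
    fun p => rfl
  rw [he, he, covariance_add_left (hm _ _) (hm _ _) ((hm _ _).add (hm _ _)),
    covariance_add_right (hm _ _) (hm _ _) (hm _ _),
    covariance_add_right (hm _ _) (hm _ _) (hm _ _)]
  simp only [covariance_const_mul_left, covariance_const_mul_right,
    covariance_eval_gaussianArray, Option.some.injEq, reduceCtorEq, if_true, if_false, mul_zero,
    mul_one, add_zero, zero_add, Real.mul_self_sqrt hc.1]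
  split_ifs with h
  · rw [mul_one, Real.mul_self_sqrt (sub_nonneg.2 hc.2)]
    ring
  · ring

/-- Adding √c times a variable common to the diagonal (index `none`) to √(1 - c) times an individual
one gives variance 1 and covariance exactly c. The ensemble serves to show that `limitMoment c` is a
moment sequence. -/
theorem diagonalEnsemble_gaussian {c : ℝ} (hc : c ∈ Set.Icc (0 : ℝ) 1) :
    DiagonalEnsemble gaussianArray
      (fun n (p q : Fin n) => gaussianEntry c ((q : ℕ) - p) p) (fun _ => c) c where
  measurable n p q _ := measurable_gaussianEntry _ _ _
  mean_zero n p q _ := integral_gaussianEntry _ _ _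
  variance_one n p q _ := by
    have h := covariance_gaussianEntry hc ((q : ℕ) - p) p p
    rw [covariance_eq_sub (memLp_gaussianEntry _ _ _ 2) (memLp_gaussianEntry _ _ _ 2),
      integral_gaussianEntry, zero_mul, sub_zero, if_pos rfl] at h
    simpa [sq] using h
  moments k := by
    have hmp := measurePreserving_eval_gaussianArray
    have hi : ∀ r o, Integrable (fun ω : ℕ → Option ℕ → ℝ => |ω r o| ^ k) gaussianArray :=
      fun r o => by simpa using (memLp_eval_gaussianArray r o k).integrable_norm_pow'
    have hI : ∀ r o, ∫ ω, |ω r o| ^ k ∂gaussianArray = ∫ x, |x| ^ k ∂gaussianReal 0 1 := by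
      intro r o
      have h := hmp r o
      have := integral_map (μ := gaussianArray) h.measurable.aemeasurable
        (f := fun x : ℝ => |x| ^ k) (by fun_prop)
      rw [h.map_eq] at this
      exact this.symm
    have hs1 : |√c| ≤ 1 := by
      rw [abs_of_nonneg (Real.sqrt_nonneg _)]; exact Real.sqrt_le_one.2 hc.2
    have hs2 : |√(1 - c)| ≤ 1 := by
      rw [abs_of_nonneg (Real.sqrt_nonneg _)]; exact Real.sqrt_le_one.2 (by linarith [hc.1])
    have hle : ∀ r p ω, |gaussianEntry c r p ω| ^ k ≤
        2 ^ k * (|ω r none| ^ k + |ω r (some p)| ^ k) := by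
      intro r p ω
      have h1 : |gaussianEntry c r p ω| ≤ |ω r none| + |ω r (some p)| := by
        refine (abs_add_le _ _).trans ?_
        rw [abs_mul, abs_mul]
        exact add_le_add (mul_le_of_le_one_left (abs_nonneg _) hs1)
          (mul_le_of_le_one_left (abs_nonneg _) hs2)
      have h2 : |ω r none| + |ω r (some p)| ≤ 2 * max |ω r none| |ω r (some p)| := by
        rw [two_mul]
        exact add_le_add (le_max_left _ _) (le_max_right _ _)
      refine (pow_le_pow_left₀ (abs_nonneg _) (h1.trans h2) k).trans ?_
      rw [mul_pow]
      gcongr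
      rcases le_total |ω r none| |ω r (some p)| with h | h
      · rw [max_eq_right h]; exact le_add_of_nonneg_left (by positivity)
      · rw [max_eq_left h]; exact le_add_of_nonneg_right (by positivity)
    refine ⟨2 ^ k * (2 * ∫ x, |x| ^ k ∂gaussianReal 0 1), fun n p q _ => ?_⟩
    have hint : Integrable (fun ω => |gaussianEntry c ((q : ℕ) - p) p ω| ^ k) gaussianArray := by
      simpa using (memLp_gaussianEntry c ((q : ℕ) - p) p k).integrable_norm_pow'
    refine ⟨hint, (integral_mono hint (((hi _ _).add (hi _ _)).const_mul _)
      (hle _ _)).trans (le_of_eq ?_)⟩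
    rw [integral_const_mul]
    simp only [Pi.add_apply]
    rw [integral_add (hi _ _) (hi _ _), hI, hI, two_mul]
  indep n := by
    -- Diagonal r is a function of row r of the array alone, and the rows are independent.
    have h := iIndepFun_infinitePi (ι := ℕ) (Ω := fun _ => Option ℕ → ℝ)
      (P := fun _ : ℕ => Measure.infinitePi fun _ : Option ℕ => gaussianReal 0 1)
      (X := fun (r : ℕ) (y : Option ℕ → ℝ) (z : {z : Fin n × Fin n // (z.1 : ℕ) + r = z.2}) =>
        √c * y none + √(1 - c) * y (some z.1.1)) (by fun_prop)
    convert! h.precomp (g := fun r : Fin n => (r : ℕ)) Fin.val_injective using 1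
    funext r ω z
    have : ((z.1.2 : ℕ) - z.1.1) = r := by have := z.2; omega
    simp only [gaussianEntry, this]
  cov_eq n r p q p' q' hpq hpq' hne := by
    have h1 : (q : ℕ) - p = r := by omega
    have h2 : (q' : ℕ) - p' = r := by omega
    rw [h1, h2, covariance_gaussianEntry hc, if_neg fun h => hne (Fin.ext h)]
  tendsto_cov := tendsto_const_nhds

end GaussianArray

/-! ### Toeplitz matrices, growth of the limiting moments, existence of the limit laws. -/

/-- The Toeplitz ensemble. -/
theorem IsStandardIID.diagonalEnsemble {Ω : Type*} [MeasurableSpace Ω] {P : Measure Ω}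
    [IsProbabilityMeasure P] {ξ : ℕ → Ω → ℝ} (h : IsStandardIID P ξ) :
    DiagonalEnsemble P (fun n (p q : Fin n) => ξ ((q : ℕ) - p)) (fun _ => 1) 1 := by
  have hid : ∀ (i : ℕ) (f : ℝ → ℝ), Measurable f →
      ∫ ω, f (ξ i ω) ∂P = ∫ ω, f (ξ 0 ω) ∂P := fun i f hf =>
    ((h.ident i).comp hf).integral_eq
  have hmean : ∀ i, ∫ ω, ξ i ω ∂P = 0 := fun i => (hid i id measurable_id).trans h.mean_zero
  have hvar : ∀ i, ∫ ω, ξ i ω ^ 2 ∂P = 1 := fun i =>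
    (hid i (fun x => x ^ 2) (by fun_prop)).trans h.variance_one
  have hint : ∀ i k, Integrable (fun ω => |ξ i ω| ^ k) P := fun i k =>
    (((h.ident i).comp (show Measurable fun x : ℝ => |x| ^ k by fun_prop)).integrable_iff).2
      (h.moments k)
  have hmem : ∀ i, MemLp (ξ i) 2 P := fun i => by
    rw [memLp_two_iff_integrable_sq (h.measurable i).aestronglyMeasurable]
    simpa using hint i 2
  exact
    { measurable := fun n p q _ => h.measurable _
      mean_zero := fun n p q _ => hmean _
      variance_one := fun n p q _ => hvar _
      moments := fun k => ⟨∫ ω, |ξ 0 ω| ^ k ∂P, fun n p q _ =>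
        ⟨hint _ k, (hid _ (fun x => |x| ^ k) (by fun_prop)).le⟩⟩
      indep := fun n => by
        have h1 := (h.indep.precomp (g := fun r : Fin n => (r : ℕ)) Fin.val_injective).comp
          (fun r x (_ : {z : Fin n × Fin n // (z.1 : ℕ) + r = z.2}) => x) (by fun_prop)
        convert! h1 using 1
        funext r ω z
        have : ((z.1.2 : ℕ) - z.1.1) = r := by have := z.2; omega
        simp only [this, Function.comp_apply]
      cov_eq := fun n r p q p' q' hpq hpq' _ => by
        have h1 : (q : ℕ) - p = r := by omega
        have h2 : (q' : ℕ) - p' = r := by omega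
        rw [h1, h2, covariance_eq_sub (hmem r) (hmem r), hmean, zero_mul, sub_zero]
        simpa [sq] using hvar r
      tendsto_cov := tendsto_const_nhds }

/-- A pair partition is given by its set of openers, among 2^{2m} subsets, and a bijection from the
openers to the closers, at most m! of them. -/
theorem card_pairPartition_le (m : ℕ) :
    Fintype.card (PairPartition (2 * m)) ≤ 4 ^ m * m.factorial := by
  classical
  have h1 : Fintype.card (PairPartition (2 * m)) =
      ∑ O : Finset (Fin (2 * m)), (Finset.univ.filter fun π : PairPartition (2 * m) =>
        openers π = O).card := by
    rw [← Finset.card_univ]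
    exact Finset.card_eq_sum_card_fiberwise fun _ _ => Finset.mem_coe.2 (Finset.mem_univ _)
  have h2 : ∀ O : Finset (Fin (2 * m)), (Finset.univ.filter fun π : PairPartition (2 * m) =>
      openers π = O).card ≤ m.factorial := by
    intro O
    rcases (Finset.univ.filter fun π : PairPartition (2 * m) =>
      openers π = O).eq_empty_or_nonempty with h | ⟨π₀, hπ₀⟩
    · rw [h]; exact Nat.zero_le _
    have hO : openers π₀ = O := (Finset.mem_filter.1 hπ₀).2
    have c1 : O.card = m := by rw [← hO]; have := two_mul_card_openers π₀; omega
    have c2 : Oᶜ.card = m := by rw [← hO, card_compl_openers, hO, c1]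
    have hmap : ∀ π : {π : PairPartition (2 * m) // openers π = O}, ∀ i : O, π.1.1 i ∈ Oᶜ := by
      rintro ⟨π, rfl⟩ ⟨i, hi⟩
      rw [mem_openers] at hi
      rw [Finset.mem_compl, mem_openers, (π.2 i).2, not_lt]
      exact hi.le
    let F : {π : PairPartition (2 * m) // openers π = O} → (O ↪ (Oᶜ : Finset (Fin (2 * m)))) :=
      fun π => ⟨fun i => ⟨π.1.1 i, hmap π i⟩, fun i j hij => by
        have := congrArg Subtype.val hij
        simp only at this
        refine Subtype.ext ?_
        rw [← (π.1.2 i).2, this, (π.1.2 j).2]⟩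
    have hF : Function.Injective F := by
      rintro ⟨π, hπ⟩ ⟨ρ, hρ⟩ hπρ
      have h3 : ∀ i ∈ O, π.1 i = ρ.1 i := fun i hi =>
        congrArg Subtype.val (DFunLike.congr_fun hπρ ⟨i, hi⟩)
      refine Subtype.ext (Subtype.ext (funext fun i => ?_))
      by_cases hi : i ∈ O
      · exact h3 i hi
      · have hi' : π.1 i ∈ O := by
          rw [← hπ, mem_openers, not_lt] at hi
          rw [← hπ, mem_openers, (π.2 i).2]
          exact lt_of_le_of_ne hi (π.2 i).1
        have := h3 _ hi'
        rw [(π.2 i).2] at this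
        change π.1 i = ρ.1 i
        conv_rhs => rw [this]
        rw [(ρ.2 _).2]
    have h4 := Fintype.card_le_of_injective F hF
    rw [Fintype.card_embedding_eq, Fintype.card_coe, Fintype.card_coe, c1, c2,
      Nat.descFactorial_self, Fintype.card_subtype] at h4
    exact h4
  rw [h1]
  refine (Finset.sum_le_card_nsmul _ _ _ fun O _ => h2 O).trans (le_of_eq ?_)
  rw [Finset.card_univ, Fintype.card_finset, Fintype.card_fin, smul_eq_mul, pow_mul]
  norm_num

theorem abs_limitMoment_even_le {c : ℝ} (hc : c ∈ Set.Icc (0 : ℝ) 1) (m : ℕ) :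
    |limitMoment c (2 * m)| ≤ 4 ^ m * m.factorial := by
  have h1 : |limitMoment c (2 * m)| ≤ Fintype.card (PairPartition (2 * m)) := by
    rw [limitMoment, ← Finset.card_univ, Finset.cast_card]
    refine Finset.abs_sum_le_sum_abs _ _ |>.trans (Finset.sum_le_sum fun π _ => ?_)
    rw [abs_of_nonneg (mul_nonneg (toeplitzVolume_nonneg π) (pow_nonneg hc.1 _))]
    exact mul_le_one₀ (toeplitzVolume_le_one π) (pow_nonneg hc.1 _) (pow_le_one₀ hc.1 hc.2)
  exact h1.trans (by exact_mod_cast card_pairPartition_le m)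

/-- Since (m!)² ≤ (2m)!, the terms are dominated by (4t²)^m/m!. This is the growth condition of the
method of moments. -/
theorem tendsto_limitMoment_div_factorial {c : ℝ} (hc : c ∈ Set.Icc (0 : ℝ) 1) (t : ℝ) :
    Tendsto (fun m : ℕ => t ^ (2 * m) / (2 * m).factorial * limitMoment c (2 * m))
      atTop (𝓝 0) := by
  refine squeeze_zero_norm (fun m => ?_)
    (FloorSemiring.tendsto_pow_div_factorial_atTop (4 * t ^ 2))
  have h1 : ((m.factorial : ℝ)) * m.factorial ≤ (2 * m).factorial := by
    have := Nat.factorial_mul_factorial_dvd_factorial_add m m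
    rw [← two_mul] at this
    exact_mod_cast Nat.le_of_dvd (Nat.factorial_pos _) this
  have h2 : (0 : ℝ) < m.factorial := by positivity
  rw [norm_mul, Real.norm_of_nonneg (div_nonneg ((even_two_mul m).pow_nonneg t) (by positivity)),
    Real.norm_eq_abs]
  calc t ^ (2 * m) / (2 * m).factorial * |limitMoment c (2 * m)|
      ≤ t ^ (2 * m) / (m.factorial * m.factorial) * (4 ^ m * m.factorial) := by
        have := (even_two_mul m).pow_nonneg t
        gcongr
        exact abs_limitMoment_even_le hc m
    _ = (4 * t ^ 2) ^ m / m.factorial := by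
        rw [mul_pow, ← pow_mul]
        field_simp

/-- The limit laws exist. -/
theorem exists_measure_limitMoment {c : ℝ} (hc : c ∈ Set.Icc (0 : ℝ) 1) :
    ∃ ν : ProbabilityMeasure ℝ, (∀ k, Integrable (fun x : ℝ => x ^ k) (ν : Measure ℝ)) ∧
      ∀ k, ∫ x, x ^ k ∂(ν : Measure ℝ) = limitMoment c k := by
  -- A single realisation suffices: its spectral distributions are probability measures with
  -- converging moments.
  obtain ⟨ω, hω⟩ := (diagonalEnsemble_gaussian hc).ae_tendsto_moments.exists
  exact exists_limit_of_tendsto_moments_esd hω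

/-! ### Noncrossing pairings and Catalan numbers. -/

/-- `f` is a noncrossing pairing of the integers in `[a, b)`, extended by the identity. -/
structure IsNoncrossingPairing (a b : ℕ) (f : ℕ → ℕ) : Prop where
  eq_self : ∀ x, ¬ (a ≤ x ∧ x < b) → f x = x
  mem : ∀ x, a ≤ x → x < b → a ≤ f x ∧ f x < b
  ne_self : ∀ x, a ≤ x → x < b → f x ≠ x
  involutive : ∀ x, f (f x) = x
  noncrossing : ∀ x l, x < l → l < f x → x < f l ∧ f l < f x

/-- A fixed point free involution cancels the sum of ones modulo 2. -/
theorem IsNoncrossingPairing.even {a b : ℕ} {f : ℕ → ℕ} (h : IsNoncrossingPairing a b f) :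
    Even (b - a) := by
  have h1 : ∑ _x ∈ Finset.Ico a b, (1 : ZMod 2) = 0 := by
    refine Finset.sum_involution (fun x _ => f x) (fun _ _ => by decide) (fun x hx _ => ?_)
      (fun x hx => ?_) (fun x _ => h.involutive x)
    · obtain ⟨h1, h2⟩ := Finset.mem_Ico.1 hx
      exact h.ne_self x h1 h2
    · obtain ⟨h1, h2⟩ := Finset.mem_Ico.1 hx
      exact Finset.mem_Ico.2 (h.mem x h1 h2)
  rw [Finset.sum_const, Nat.card_Ico, nsmul_eq_mul, mul_one, ZMod.natCast_eq_zero_iff] at h1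
  exact even_iff_two_dvd.2 h1

/-- Put the block `{a, j}` around `g` and `h` to the right of it. -/
def gluePairing (a j : ℕ) (g h : ℕ → ℕ) (x : ℕ) : ℕ :=
  if x = a then j else if x = j then a else if x < j then g x else h x

theorem isNoncrossingPairing_gluePairing {a j b : ℕ} {g h : ℕ → ℕ} (haj : a < j) (hjb : j < b)
    (hg : IsNoncrossingPairing (a + 1) j g) (hh : IsNoncrossingPairing (j + 1) b h) :
    IsNoncrossingPairing a b (gluePairing a j g h) := by
  have g1 : ∀ x, a < x → x < j → gluePairing a j g h x = g x ∧ a < g x ∧ g x < j :=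
    fun x h1 h2 => by
      have := hg.mem x h1 h2
      refine ⟨?_, by omega, by omega⟩
      rw [gluePairing, if_neg (by omega), if_neg (by omega), if_pos h2]
  have h1 : ∀ x, j < x → x < b → gluePairing a j g h x = h x ∧ j < h x ∧ h x < b :=
    fun x h1 h2 => by
      have := hh.mem x h1 h2
      refine ⟨?_, by omega, by omega⟩
      rw [gluePairing, if_neg (by omega), if_neg (by omega), if_neg (by omega)]
  have ha : gluePairing a j g h a = j := by simp [gluePairing]
  have hj : gluePairing a j g h j = a := by simp [gluePairing, haj.ne']
  have hout : ∀ x, ¬ (a ≤ x ∧ x < b) → gluePairing a j g h x = x := fun x hx => by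
    rw [gluePairing, if_neg (by omega), if_neg (by omega)]
    split_ifs with hxj
    · exact hg.eq_self x (by omega)
    · exact hh.eq_self x (by omega)
  have hcases : ∀ x, x = a ∨ x = j ∨ (a < x ∧ x < j) ∨ (j < x ∧ x < b) ∨ ¬ (a ≤ x ∧ x < b) :=
    fun x => by omega
  refine ⟨hout, fun x hx1 hx2 => ?_, fun x hx1 hx2 => ?_, fun x => ?_, fun x l hxl hl => ?_⟩
  · rcases hcases x with rfl | rfl | ⟨h2, h3⟩ | ⟨h2, h3⟩ | h2
    · rw [ha]; omega
    · rw [hj]; omega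
    · have := g1 x h2 h3; omega
    · have := h1 x h2 h3; omega
    · exact absurd ⟨hx1, hx2⟩ h2
  · rcases hcases x with rfl | rfl | ⟨h2, h3⟩ | ⟨h2, h3⟩ | h2
    · rw [ha]; omega
    · rw [hj]; omega
    · rw [(g1 x h2 h3).1]; exact hg.ne_self x h2 h3
    · rw [(h1 x h2 h3).1]; exact hh.ne_self x h2 h3
    · exact absurd ⟨hx1, hx2⟩ h2
  · rcases hcases x with rfl | rfl | ⟨h2, h3⟩ | ⟨h2, h3⟩ | h2
    · rw [ha, hj]
    · rw [hj, ha]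
    · obtain ⟨e, h4, h5⟩ := g1 x h2 h3
      rw [e, (g1 _ h4 h5).1, hg.involutive]
    · obtain ⟨e, h4, h5⟩ := h1 x h2 h3
      rw [e, (h1 _ h4 h5).1, hh.involutive]
    · rw [hout x h2, hout x h2]
  · rcases hcases x with rfl | rfl | ⟨h2, h3⟩ | ⟨h2, h3⟩ | h2
    · rw [ha] at hl ⊢
      have := g1 l hxl hl
      omega
    · rw [hj] at hl
      omega
    · obtain ⟨e, h4, h5⟩ := g1 x h2 h3
      rw [e] at hl ⊢
      rw [(g1 l (by omega) (by omega)).1]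
      exact hg.noncrossing x l hxl hl
    · obtain ⟨e, h4, h5⟩ := h1 x h2 h3
      rw [e] at hl ⊢
      rw [(h1 l (by omega) (by omega)).1]
      exact hh.noncrossing x l hxl hl
    · rw [hout x h2] at hl
      omega

theorem IsNoncrossingPairing.restrict {a b c d : ℕ} {f : ℕ → ℕ}
    (hf : IsNoncrossingPairing a b f) (hc : a ≤ c) (hd : d ≤ b)
    (h : ∀ x, c ≤ x → x < d → c ≤ f x ∧ f x < d) :
    IsNoncrossingPairing c d fun x => if c ≤ x ∧ x < d then f x else x := by
  refine ⟨fun x hx => if_neg hx, fun x h1 h2 => ?_, fun x h1 h2 => ?_, fun x => ?_,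
    fun x l hxl hl => ?_⟩
  · simp only [if_pos (And.intro h1 h2)]
    exact h x h1 h2
  · simp only [if_pos (And.intro h1 h2)]
    exact hf.ne_self x (by omega) (by omega)
  · by_cases hx : c ≤ x ∧ x < d
    · simp only [if_pos hx, if_pos (h x hx.1 hx.2), hf.involutive]
    · simp only [if_neg hx]
  · by_cases hx : c ≤ x ∧ x < d
    · simp only [if_pos hx] at hl ⊢
      have := h x hx.1 hx.2
      have hl' : c ≤ l ∧ l < d := by omega
      simp only [if_pos hl']
      exact hf.noncrossing x l hxl hl
    · simp only [if_neg hx] at hl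
      omega

/-- The block of the leftmost point separates the interval into the part under it and the part to
its right, and noncrossing means that no block joins the two. -/
theorem IsNoncrossingPairing.exists_glue {a b : ℕ} {f : ℕ → ℕ} (hab : a < b)
    (hf : IsNoncrossingPairing a b f) :
    ∃ g h, a < f a ∧ f a < b ∧ IsNoncrossingPairing (a + 1) (f a) g ∧
      IsNoncrossingPairing (f a + 1) b h ∧ f = gluePairing a (f a) g h := by
  have h1 := hf.mem a le_rfl hab
  have h2 := hf.ne_self a le_rfl hab
  have h3 : ∀ x, a + 1 ≤ x → x < f a → a + 1 ≤ f x ∧ f x < f a := fun x hx hx' =>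
    hf.noncrossing a x hx hx'
  have h4 : ∀ x, f a + 1 ≤ x → x < b → f a + 1 ≤ f x ∧ f x < b := by
    intro x hx hx'
    have h5 := hf.mem x (by omega) hx'
    have h6 : f x ≠ a := fun h => by have := hf.involutive x; rw [h] at this; omega
    have h7 : f x ≠ f a := fun h => by
      have := hf.involutive x
      rw [h, hf.involutive] at this; omega
    have h8 : ¬ (a + 1 ≤ f x ∧ f x < f a) := fun h => by
      have := h3 _ h.1 h.2
      rw [hf.involutive] at this; omega
    omega
  refine ⟨_, _, by omega, h1.2, hf.restrict (by omega) h1.2.le h3, hf.restrict (by omega) le_rfl h4,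
    funext fun x => ?_⟩
  simp only [gluePairing]
  split_ifs with e1 e2 e3 e4 e5
  · rw [e1]
  · rw [e2, hf.involutive]
  · rfl
  · exact hf.eq_self x (by omega)
  · rfl
  · exact hf.eq_self x (by omega)

/-- The part under the block of a has even length 2i, so the decomposition reproduces the Catalan
recursion. The left end a stays arbitrary because the induction is applied to shifted intervals. -/
theorem finite_and_card_noncrossingPairing (m : ℕ) : ∀ a : ℕ,
    Finite {f // IsNoncrossingPairing a (a + 2 * m) f} ∧
      Nat.card {f // IsNoncrossingPairing a (a + 2 * m) f} = catalan m := by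
  induction m using Nat.strong_induction_on with
  | _ m ih =>
    intro a
    rcases m with _ | m
    · have hu : ∀ f, IsNoncrossingPairing a (a + 2 * 0) f ↔ f = id := by
        intro f
        constructor
        · exact fun h => funext fun x => h.eq_self x (by omega)
        · rintro rfl
          exact ⟨fun _ _ => rfl, fun x _ _ => by simp only [id]; omega, fun x _ _ => by omega,
            fun _ => rfl, fun x l _ _ => by simp only [id] at *; omega⟩
      simp only [hu]
      exact ⟨inferInstance, by simp⟩
    · let S : Fin (m + 1) → Type := fun i =>
        {g // IsNoncrossingPairing (a + 1) (a + 1 + 2 * (i : ℕ)) g} ×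
          {h // IsNoncrossingPairing (a + 1 + 2 * (i : ℕ) + 1)
            (a + 1 + 2 * (i : ℕ) + 1 + 2 * (m - i)) h}
      have hend : ∀ i : Fin (m + 1),
          a + 1 + 2 * (i : ℕ) + 1 + 2 * (m - i) = a + 2 * (m + 1) := fun i => by
        have := i.2; omega
      let F : (Σ i, S i) → {f // IsNoncrossingPairing a (a + 2 * (m + 1)) f} := fun s =>
        ⟨gluePairing a (a + 1 + 2 * (s.1 : ℕ)) s.2.1.1 s.2.2.1,
          isNoncrossingPairing_gluePairing (by omega) (by have := s.1.2; omega) s.2.1.2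
            (hend s.1 ▸ s.2.2.2)⟩
      have hfin : ∀ i, Finite (S i) := fun i => by
        have h1 := (ih i (by omega) (a + 1)).1
        have h2 := (ih (m - i) (by omega) (a + 1 + 2 * (i : ℕ) + 1)).1
        exact Finite.instProd
      have hinj : Function.Injective F := by
        rintro ⟨i, ⟨g, hg⟩, ⟨h, hh⟩⟩ ⟨i', ⟨g', hg'⟩, ⟨h', hh'⟩⟩ heq
        have heq' : ∀ x, gluePairing a (a + 1 + 2 * (i : ℕ)) g h x =
            gluePairing a (a + 1 + 2 * (i' : ℕ)) g' h' x := fun x =>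
          congrFun (congrArg Subtype.val heq) x
        have hi : i = i' := by
          have := heq' a
          simp only [gluePairing, if_true] at this
          exact Fin.ext (by omega)
        subst hi
        have hgg : g = g' := funext fun x => by
          by_cases hx : a + 1 ≤ x ∧ x < a + 1 + 2 * (i : ℕ)
          · have := heq' x
            simpa only [gluePairing, if_neg (show ¬ x = a by omega),
              if_neg (show ¬ x = a + 1 + 2 * (i : ℕ) by omega), if_pos hx.2] using this
          · rw [hg.eq_self x hx, hg'.eq_self x hx]
        have hhh : h = h' := funext fun x => by
          by_cases hx : a + 1 + 2 * (i : ℕ) + 1 ≤ x ∧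
              x < a + 1 + 2 * (i : ℕ) + 1 + 2 * (m - i)
          · have := heq' x
            simpa only [gluePairing, if_neg (show ¬ x = a by omega),
              if_neg (show ¬ x = a + 1 + 2 * (i : ℕ) by omega),
              if_neg (show ¬ x < a + 1 + 2 * (i : ℕ) by omega)] using this
          · rw [hh.eq_self x hx, hh'.eq_self x hx]
        subst hgg hhh
        rfl
      have hsurj : Function.Surjective F := by
        rintro ⟨f, hf⟩
        obtain ⟨g, h, h1, h2, hg, hh, heq⟩ := hf.exists_glue (by omega)
        obtain ⟨i, hi⟩ := hg.even
        have hfa : f a = a + 1 + 2 * i := by omega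
        have him : i < m + 1 := by omega
        rw [hfa] at hg hh heq
        exact ⟨⟨⟨i, him⟩, ⟨g, hg⟩, ⟨h, (hend ⟨i, him⟩).symm ▸ hh⟩⟩, Subtype.ext heq.symm⟩
      refine ⟨Finite.of_surjective F hsurj, ?_⟩
      rw [← Nat.card_eq_of_bijective F ⟨hinj, hsurj⟩, Nat.card_sigma, catalan_succ]
      refine Finset.sum_congr rfl fun i _ => ?_
      rw [Nat.card_prod, (ih i (by omega) _).2, (ih (m - i) (by omega) _).2]

/-! ### The case c = 0. -/

/-- All blocks are counted by the height. -/
def IsNoncrossing {k : ℕ} (π : PairPartition k) : Prop :=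
  ∀ i ∈ openers π, IsClosedBlock π i

theorem card_isNoncrossing (m : ℕ) :
    Nat.card {π : PairPartition (2 * m) // IsNoncrossing π} = catalan m := by
  rw [← (finite_and_card_noncrossingPairing m 0).2, zero_add]
  let ext : PairPartition (2 * m) → ℕ → ℕ := fun π x =>
    if h : x < 2 * m then π.1 ⟨x, h⟩ else x
  have hext : ∀ π (i : Fin (2 * m)), ext π i = π.1 i := fun π i => by simp [ext]
  have hout : ∀ π x, ¬ x < 2 * m → ext π x = x := fun π x hx => by simp [ext, hx]
  refine Nat.card_eq_of_bijective (fun π => ⟨ext π.1, ?_⟩) ⟨?_, ?_⟩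
  · obtain ⟨π, hπ⟩ := π
    refine ⟨fun x hx => hout π x (by omega), fun x _ hx => ?_, fun x _ hx => ?_, fun x => ?_,
      fun x l hxl hl => ?_⟩
    · have := hext π ⟨x, hx⟩
      have h2 := (π.1 ⟨x, hx⟩).2
      simp only at *
      omega
    · have := hext π ⟨x, hx⟩
      have h2 := (π.2 ⟨x, hx⟩).1
      rw [Ne, Fin.ext_iff] at h2
      simp only at *
      omega
    · by_cases hx : x < 2 * m
      · have h1 := hext π ⟨x, hx⟩
        simp only at h1
        rw [h1, hext, (π.2 _).2]
      · rw [hout π x hx, hout π x hx]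
    · by_cases hx : x < 2 * m
      · have h1 := hext π ⟨x, hx⟩
        simp only at h1
        rw [h1] at hl ⊢
        have hl' : l < 2 * m := hl.trans (π.1 ⟨x, hx⟩).2
        have h2 := hext π ⟨l, hl'⟩
        simp only at h2
        rw [h2]
        have h3 : (⟨x, hx⟩ : Fin (2 * m)) < π.1 ⟨x, hx⟩ := Fin.lt_def.2 (hxl.trans hl)
        exact hπ ⟨x, hx⟩ (mem_openers.2 h3) ⟨l, hl'⟩ hxl hl
      · rw [hout π x hx] at hl
        omega
  · rintro ⟨π, hπ⟩ ⟨ρ, hρ⟩ h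
    refine Subtype.ext (Subtype.ext (funext fun i => Fin.ext ?_))
    have := congrFun (congrArg Subtype.val h) i
    simpa only [hext] using this
  · rintro ⟨f, hf⟩
    let π : PairPartition (2 * m) := ⟨fun i => ⟨f i, (hf.mem i (Nat.zero_le _) i.2).2⟩, fun i =>
      ⟨fun h => hf.ne_self i (Nat.zero_le _) i.2 (Fin.ext_iff.1 h),
        Fin.ext (hf.involutive i)⟩⟩
    refine ⟨⟨π, fun i _ l hil hl => hf.noncrossing i l hil hl⟩, Subtype.ext (funext fun x => ?_)⟩
    by_cases hx : x < 2 * m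
    · exact hext π ⟨x, hx⟩
    · exact (hout π x hx).trans (hf.eq_self x (by omega)).symm

/-- The solution of the Toeplitz system of a noncrossing partition with given free variables. -/
noncomputable def noncrossingSolution {k : ℕ} (π : PairPartition k) (y : freeVars π → ℝ)
    (v : Fin (k + 1)) : ℝ :=
  if h : v ∈ freeVars π then y ⟨v, h⟩
  else noncrossingSolution π y
    (π.1 (Classical.choose (not_not.1 (mem_freeVars.not.1 h)))).castSucc
termination_by (v : ℕ)
decreasing_by
  have hs := Classical.choose_spec (not_not.1 (mem_freeVars.not.1 h))
  have := Fin.lt_def.1 hs.1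
  have := Fin.ext_iff.1 hs.2
  simp only [Fin.val_succ, Fin.val_castSucc] at *
  omega

theorem noncrossingSolution_of_mem {k : ℕ} (π : PairPartition k) (y : freeVars π → ℝ)
    (v : freeVars π) : noncrossingSolution π y v = y v := by
  rw [noncrossingSolution, dif_pos v.2]

theorem noncrossingSolution_succ {k : ℕ} (π : PairPartition k) (y : freeVars π → ℝ)
    {j : Fin k} (hj : π.1 j < j) :
    noncrossingSolution π y j.succ = noncrossingSolution π y (π.1 j).castSucc := by
  have h : j.succ ∉ freeVars π := fun h => mem_freeVars.1 h ⟨j, hj, rfl⟩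
  rw [noncrossingSolution, dif_neg h]
  have hs := Classical.choose_spec (not_not.1 (mem_freeVars.not.1 h))
  rw [← Fin.succ_injective _ hs.2]

/-- Induction on the closing element: the increments inside a block cancel in pairs, so the path
returns to where the opening step ended, and by construction the closing step goes back to where the
opening step began. -/
theorem solvesToeplitzSystem_noncrossingSolution {k : ℕ} {π : PairPartition k}
    (hπ : IsNoncrossing π) (y : freeVars π → ℝ) :
    SolvesToeplitzSystem π (noncrossingSolution π y) := by
  classical
  set x := noncrossingSolution π y with hx
  have key : ∀ j : Fin k, π.1 j < j →
      x j.succ - x j.castSucc + x (π.1 j).succ - x (π.1 j).castSucc = 0 := by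
    intro j
    induction j using WellFoundedLT.induction with
    | ind j ih =>
      intro hj
      have hop : π.1 j ∈ openers π := by rw [mem_openers, (π.2 j).2]; exact hj
      have hcl := hπ _ hop
      rw [IsClosedBlock, (π.2 j).2] at hcl
      have hsum := sum_sub_between x hj
      rw [← Finset.sum_filter, sum_pair_eq_zero π] at hsum
      · rw [hx, noncrossingSolution_succ π y hj, ← hx]
        linarith
      · intro l hl
        simp only [Finset.mem_filter, Finset.mem_univ, true_and] at hl ⊢
        exact hcl l hl.1 hl.2
      · intro l hl
        simp only [Finset.mem_filter, Finset.mem_univ, true_and] at hl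
        rcases lt_or_gt_of_ne (π.2 l).1 with h | h
        · have := ih l hl.2 h
          linarith
        · have := ih (π.1 l) (hcl l hl.1 hl.2).2 (by rw [(π.2 l).2]; exact h)
          rw [(π.2 l).2] at this
          linarith
  intro i
  rcases lt_or_gt_of_ne (π.2 i).1 with h | h
  · exact key i h
  · have := key (π.1 i) (by rw [(π.2 i).2]; exact h)
    rw [(π.2 i).2] at this
    linarith

/-- Every dependent variable of the solution equals some free variable, so the constraints in [0, 1]
are automatic and the section is the whole cube. -/
theorem toeplitzVolume_of_isNoncrossing {k : ℕ} {π : PairPartition k} (hπ : IsNoncrossing π) :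
    toeplitzVolume π = 1 := by
  have h : toeplitzSection π = Set.Icc 0 1 := by
    refine (toeplitzSection_subset_Icc π).antisymm fun y hy => ?_
    refine ⟨noncrossingSolution π y, solvesToeplitzSystem_noncrossingSolution hπ y, ?_,
      noncrossingSolution_of_mem π y⟩
    intro v
    induction v using WellFoundedLT.induction with
    | ind v ih =>
      by_cases hv : v ∈ freeVars π
      · rw [noncrossingSolution_of_mem π y ⟨v, hv⟩]
        exact ⟨hy.1 _, hy.2 _⟩
      · rw [mem_freeVars, not_not] at hv
        obtain ⟨i, hi, rfl⟩ := hv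
        rw [noncrossingSolution_succ π y hi]
        exact ih _ (Fin.castSucc_lt_succ.trans (by simpa using hi))
  rw [toeplitzVolume, h, volume_Icc_zero_one_pi, ENNReal.toReal_one]

/-- With 0^0 = 1, exactly the partitions all of whose blocks are counted by the height survive, each
with weight one. -/
theorem limitMoment_zero_even (m : ℕ) : limitMoment 0 (2 * m) = catalan m := by
  classical
  rw [limitMoment_even, ← card_isNoncrossing, Nat.card_eq_fintype_card, Fintype.card_subtype,
    ← Finset.sum_boole]
  refine Finset.sum_congr rfl fun π _ => ?_
  have hm : m - height π = ((openers π).filter fun i => ¬ IsClosedBlock π i).card := by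
    rw [card_not_isClosedBlock]; congr 1; omega
  split_ifs with h
  · have h0 : m - height π = 0 := by
      rw [hm, Finset.card_eq_zero, Finset.filter_eq_empty_iff]
      exact fun i hi => not_not.2 (h i hi)
    rw [h0, pow_zero, mul_one, toeplitzVolume_of_isNoncrossing h]
  · have h0 : m - height π ≠ 0 := by
      rw [hm, Finset.card_ne_zero]
      simp only [IsNoncrossing, not_forall] at h
      obtain ⟨i, hi, hc⟩ := h
      exact ⟨i, Finset.mem_filter.2 ⟨hi, hc⟩⟩
    rw [zero_pow h0, mul_zero]

/-! ### Weak convergence and the main theorem. -/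

theorem DiagonalEnsemble.ae_tendsto_esd {Ω : Type*} [MeasurableSpace Ω] {P : Measure Ω}
    [IsProbabilityMeasure P] {a : (n : ℕ) → Fin n → Fin n → Ω → ℝ} {cn : ℕ → ℝ} {c : ℝ}
    (h : DiagonalEnsemble P a cn c) {ν : ProbabilityMeasure ℝ}
    (hν : ∀ k, Integrable (fun x : ℝ => x ^ k) (ν : Measure ℝ))
    (hνM : ∀ k, ∫ x, x ^ k ∂(ν : Measure ℝ) = limitMoment c k) :
    ∀ᵐ ω ∂P, Tendsto (fun n => esd n (fun p q => a n p q ω)) atTop (𝓝 ν.toFiniteMeasure) := by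
  filter_upwards [h.ae_tendsto_moments] with ω hω
  exact tendsto_esd_of_tendsto_moments hν hνM (tendsto_limitMoment_div_factorial h.mem_Icc) hω

theorem eq_semicircleLaw_of_moments {ν : ProbabilityMeasure ℝ}
    (hν : ∀ k, Integrable (fun x : ℝ => x ^ k) (ν : Measure ℝ))
    (hνM : ∀ k, ∫ x, x ^ k ∂(ν : Measure ℝ) = limitMoment 0 k) :
    (ν : Measure ℝ) = semicircleLaw := by
  let s : ProbabilityMeasure ℝ := ⟨semicircleLaw, isProbabilityMeasure_semicircleLaw⟩
  have hs : ∀ k, ∫ x, x ^ k ∂(s : Measure ℝ) = limitMoment 0 k := by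
    intro k
    obtain ⟨m, rfl | rfl⟩ := Nat.even_or_odd' k
    · rw [limitMoment_zero_even]
      exact moment_semicircleLaw_even m
    · rw [limitMoment_odd]
      exact moment_semicircleLaw_odd m
  -- Moment determinacy from the method of moments: the constant sequence s converges to ν, hence
  -- equals it.
  have h := tendsto_probabilityMeasure_of_tendsto_moments (μ := fun _ => s)
    (fun _ k => integrable_semicircleLaw (continuous_pow k)) hν
    (fun k => by rw [← hs k]; exact tendsto_const_nhds) hνM
    (tendsto_limitMoment_div_factorial ⟨le_rfl, zero_le_one⟩)
  rw [tendsto_nhds_unique h tendsto_const_nhds]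
  rfl

theorem theorem1 :
    ∃ ν : ℝ → ProbabilityMeasure ℝ,
      -- almost sure weak convergence to `ν c`, for every ensemble satisfying the conditions
      (∀ (Ω : Type*) (_ : MeasurableSpace Ω) (P : Measure Ω) (_ : IsProbabilityMeasure P)
          (a : (n : ℕ) → Fin n → Fin n → Ω → ℝ) (cn : ℕ → ℝ) (c : ℝ),
        DiagonalEnsemble P a cn c →
          c ∈ Set.Icc (0 : ℝ) 1 ∧
          ∀ᵐ ω ∂P, Tendsto (fun n => esd n (fun p q => a n p q ω)) atTop
            (𝓝 (ν c).toFiniteMeasure)) ∧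
      -- the moments of `ν c`
      (∀ c ∈ Set.Icc (0 : ℝ) 1,
        (∀ k : ℕ, Integrable (fun x : ℝ => x ^ k) (ν c : Measure ℝ)) ∧
        (∀ m : ℕ, ∫ x, x ^ (2 * m + 1) ∂(ν c : Measure ℝ) = 0) ∧
        (∀ m : ℕ, ∫ x, x ^ (2 * m) ∂(ν c : Measure ℝ) =
          ∑ π : PairPartition (2 * m), toeplitzVolume π * c ^ (m - height π))) ∧
      -- `ν 0` is the semicircle law
      (ν 0 : Measure ℝ) = semicircleLaw ∧
      -- `ν 1` is the limit law of random symmetric Toeplitz matrices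
      (∀ (Ω : Type*) (_ : MeasurableSpace Ω) (P : Measure Ω) (_ : IsProbabilityMeasure P)
          (ξ : ℕ → Ω → ℝ), IsStandardIID P ξ →
        ∀ᵐ ω ∂P, Tendsto (fun n => toeplitzESD n (fun i => ξ i ω)) atTop
          (𝓝 (ν 1).toFiniteMeasure)) := by
  classical
  -- Outside [0, 1] the value is arbitrary, since the conditions force c into this interval.
  let ν : ℝ → ProbabilityMeasure ℝ := fun c =>
    if hc : c ∈ Set.Icc (0 : ℝ) 1 then (exists_measure_limitMoment hc).choose
    else ⟨Measure.dirac 0, inferInstance⟩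
  have hν : ∀ c ∈ Set.Icc (0 : ℝ) 1, (∀ k, Integrable (fun x : ℝ => x ^ k) (ν c : Measure ℝ)) ∧
      ∀ k, ∫ x, x ^ k ∂(ν c : Measure ℝ) = limitMoment c k := fun c hc => by
    have e : ν c = (exists_measure_limitMoment hc).choose := dif_pos hc
    rw [e]
    exact (exists_measure_limitMoment hc).choose_spec
  refine ⟨ν, fun Ω _ P _ a cn c h => ⟨h.mem_Icc, ?_⟩, fun c hc => ⟨(hν c hc).1, fun m => ?_,
    fun m => ?_⟩, ?_, fun Ω _ P _ ξ h => ?_⟩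
  · exact h.ae_tendsto_esd (hν c h.mem_Icc).1 (hν c h.mem_Icc).2
  · rw [(hν c hc).2, limitMoment_odd]
  · rw [(hν c hc).2, limitMoment_even]
  · have h0 := hν 0 ⟨le_rfl, zero_le_one⟩
    exact eq_semicircleLaw_of_moments h0.1 h0.2
  · have h1 := hν 1 ⟨zero_le_one, le_rfl⟩
    exact h.diagonalEnsemble.ae_tendsto_esd h1.1 h1.2
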